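/- **Normal o-graphs.** A normal o-graph is an oriented virtual link diagram up to planar isotopy and the Reidemeister-type moves involving virtual crossings; no component is a circle without real crossings. It represents a branched standard polyhedron $P$ (true vertices = real crossings; $1$-cells = edges joining real crossings, canonically oriented). The boundaries of the $2$-cells are encoded by three parallel lines along each edge, numbered $1,2,3$ from left to right along the orientation of the edge; the boundary orientation of the $2$-cells agrees with that of the edge on lines $1,2$ and is opposite on line $3$. Write $o_l,u_l$ (resp. $o^l,u^l$) for line $l$ on the incoming (resp. outgoing) over- and under-edge of a crossing. The lines are joined in the pairs $$o_2o^2,\quad u_1u^1,\quad o_1u^2,\quad u_3o^3,\quad u_2o_3,\quad o^1u^3\qquad\text{(positive crossing)},$$ $$o_2o^2,\quad u_1u^1,\quad u_2o^1,\quad o_3u^3,\quad o_1u_3,\quad u^2o^3\qquad\text{(negative crossing)}.$$ The last two pairs in each row, where two incoming or two outgoing lines meet, are the corners with a solid dot. **Framed integral normal o-graphs.** An integral normal o-graph is a normal o-graph with an integer weight on each edge, i.e. a cochain $x\in C^1(P;\mathbb Z)$ (when an edge is subdivided its weight is the sum of the weights of its parts). The rotation number along a path in the boundary of a $2$-cell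 is the sum of $\pm x(e)$ over the traversed edges ($+$ if $e$ is traversed along its orientation, $-$ otherwise) and of $-\frac12$ for each solid dot passed. We call $(P,x)$ *framed* if $\delta x=c_P$, where $c_P=-\sum_i(1-\frac{n_i}{2})\hat\Delta_i$ is the Euler cochain and $n_i$ is the number of solid dots on $\partial\Delta_i$; equivalently, the rotation number along the boundary of each $2$-cell is $-1$. **Integral H-move.** At a real crossing, add $1$ to the weights of the two incoming edges and $-1$ to those of the two outgoing edges. **Integral pure sliding moves.** Let a left and a right vertical segment of edges (possibly of the same edge) lie on the boundary of a common $2$-cell $\Delta$ between them, so that the boundary of $\Delta$ goes down the left segment, then along a path from its bottom to the bottom of the right segment, then up the right segment. Let $p$ be the rotation number along that path. The move replaces the two segments by two segments that cross twice, at real crossings of opposite signs (as in a Reidemeister II move), where * (I) both segments go up, $\Delta$ is on line $3$ of the left and line $2$ of the right segment, the left one passes over; * (II) both go up, $\Delta$ is on line $3$ of the left and line $1$ of the right segment, the left one passes under; * (III) the left one goes down and the right one up, $\Delta$ is on line $1$ of the left and line $2$ of the right segment, the left one passes over; * (IV) the left one goes up and the right one down, $\Delta$ is on line $3$ of both, the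 left one passes over. If the segments have weights $k$ (left) and $l$ (right), then after the move the three parts (bottom, middle, top) of the left segment have weights $0,0,k$ and those of the right segment have weights $a,m,l-a-m$, where $(a,m)=(-p-\frac12,0)$ for I and II, $(a,m)=(-p-1,1)$ for III, $(a,m)=(p+1,-1)$ for IV. (Up to H-moves at the two new crossings these are the only weights for which the new diagram is framed and all weights outside are unchanged.) **Integral MP moves.** Each of the 16 moves replaces a tangle with two real crossings and three open strands $e,s_1,s_2$ by one with three real crossings $0,1,2$. Tangles are given by Gauss codes: $iO$ and $iU$ mean passing over and under crossing $i$. Before the move the strands are $e=(0b,1b')$, $s_1=(0\bar b)$, $s_2=(1\bar b')$, where $b,b'\in\{O,U\}$ and $\bar O=U$, $\bar U=O$; in the table we list $bb'$ and the signs of the crossings $0,1$. After the move we list the signs of $0,1,2$ and the three strands. | move | before | after: signs | $e$ | $s_1$ | $s_2$ | |---|---|---|---|---|---| | A1 | OO, ++ | ++− | 1O | 0O 1U 2O | 0U 2U | | A2 | OO, +− | ++− | 0O | 2O 0U 1O | 1U 2U | | A3 | OO, −− | +−− | 1O | 0U 2U | 0O 1U 2O | | A4 | OO, +− | +−− | 2O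 | 0U 1U | 1O 2U 0O | | B1 | UU, −− | +−− | 2U | 1U 2O 0U | 1O 0O | | B2 | UU, −+ | +−− | 1U | 0U 1O 2U | 2O 0O | | B3 | UU, ++ | ++− | 0U | 2O 1O | 2U 0O 1U | | B4 | UU, −+ | ++− | 1U | 2O 0O | 0U 1O 2U | | C1 | UO, −+ | ++− | 1O 2U | 0O 2O | 0U 1U | | C2 | UO, −− | −−− | 0O 2U | 1O 2O | 0U 1U | | C3 | UO, ++ | ++− | 0O 1U | 1O 2O | 2U 0U | | C4 | UO, +− | ++− | 2O 0U | 0O 1O | 2U 1U | | D1 | OU, −+ | +−− | 0U 1O | 1U 2U | 0O 2O | | D2 | OU, ++ | +++ | 0U 2O | 1U 2U | 0O 1O | | D3 | OU, −− | +−− | 1U 2O | 2U 0U | 0O 1O | | D4 | OU, +− | +−− | 2U 0O | 1U 0U | 1O 2O | All weights in the two tangles are $0$, except that after the cyclic moves the last inner edge of $s_1$ and the outgoing open edge of $s_1$ have weights $-1,+1$ (A2, A4, B2, B4) or $+1,-1$ (C3, D3). Weights that come to lie on the same edge are added. The weights inside the two tangles may also be changed by H-moves at the crossings of the tangles. The *primary*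 integral MP move is D2 with all weights in the two tangles equal to $0$. **Theorem.** If an integral normal o-graph $\Gamma'$ is obtained from a framed integral normal o-graph $\Gamma$ by one of the 16 integral MP moves, then $\Gamma'$ is obtained from $\Gamma$ by a finite sequence of primary integral MP moves, integral pure sliding moves I--IV, integral H-moves and inverses of such moves, through framed integral normal o-graphs. -/

import Mathlib

/-!
# Integral normal o-graphs and their moves

A normal o-graph is an oriented virtual link diagram up to planar isotopy and the Reidemeister type
moves which involve virtual crossings. Up to these moves a diagram is determined by its crossings
(real crossings carry a sign, and each crossing has two strands) together with the way in which the
outgoing ends at the crossings are joined by edges to the incoming ends.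

At a crossing `v` the two strands are `(v, true)` and `(v, false)`. If `v` is a real crossing,
`(v, true)` is the over-strand and `(v, false)` is the under-strand. The same pair denotes the
incoming end, the outgoing end, and the edge which starts at the outgoing end.
-/

/-- An oriented virtual link diagram with an integer weight on each edge.
`kind v` is `1` or `-1` for a positive or negative real crossing and `0` for a virtual crossing.
`next s` is the incoming end at which the edge starting at the outgoing end `s` arrives. -/
structure VDiagram : Type 1 where
  V : Type
  [fin : Finite V]
  kind : V → SignType
  next : V × Bool ≃ V × Bool
  weight : V × Bool → ℤ

namespace VDiagram

/-! ### Diagrams up to isomorphism and virtual moves -/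

/-- Isomorphism of weighted diagrams. -/
def Iso (D D' : VDiagram) : Prop :=
  ∃ φ : D.V ≃ D'.V,
    (∀ v, D'.kind (φ v) = D.kind v) ∧
    (∀ v b, D'.next (φ v, b) = (φ (D.next (v, b)).1, (D.next (v, b)).2)) ∧
    (∀ v b, D'.weight (φ v, b) = D.weight (v, b))

/-- The connections of the disjoint union of `D` and one more crossing, whose two strands are closed
up to two separate loops. It only serves to define `insertVirtual`. -/
def addLoops (D : VDiagram) : (D.V ⊕ Unit) × Bool ≃ (D.V ⊕ Unit) × Bool :=
  (Equiv.sumProdDistrib D.V Unit Bool).trans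
    ((Equiv.sumCongr D.next (Equiv.refl _)).trans (Equiv.sumProdDistrib D.V Unit Bool).symm)

open Classical in
/-- Insert a new virtual crossing `Sum.inr ()`: first its strand `true` is inserted into the edge
`s₁`, then its strand `false` is inserted into an edge `s₂` of the resulting diagram
(which may be a part of the same edge, before or after the strand `true`).
The weight of an edge that gets divided is divided arbitrarily, the parts having the same sum. -/
noncomputable def insertVirtual (D : VDiagram) (s₁ : D.V × Bool) (s₂ : (D.V ⊕ Unit) × Bool)
    (u₁ u₂ : ℤ) : VDiagram :=
  haveI := D.fin
  let q₁ : (D.V ⊕ Unit) × Bool := (Sum.inr (), true)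
  let q₂ : (D.V ⊕ Unit) × Bool := (Sum.inr (), false)
  let t₁ : (D.V ⊕ Unit) × Bool := (Sum.inl s₁.1, s₁.2)
  let w₀ : (D.V ⊕ Unit) × Bool → ℤ := fun s => Sum.elim (fun v => D.weight (v, s.2)) (fun _ => 0) s.1
  let w₁ := Function.update (Function.update w₀ t₁ (w₀ t₁ - u₁)) q₁ u₁
  { V := D.V ⊕ Unit
    kind := Sum.elim D.kind (fun _ => 0)
    next := (Equiv.swap s₂ q₂).trans ((Equiv.swap t₁ q₁).trans D.addLoops)
    weight := Function.update (Function.update w₁ s₂ (w₁ s₂ - u₂)) q₂ u₂ }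

/-- The relation generating the equivalence of diagrams: isomorphism, and insertion of a virtual
crossing. -/
inductive Equivalent : VDiagram → VDiagram → Prop
  | iso {D D' : VDiagram} (h : Iso D D') : Equivalent D D'
  | insert (D : VDiagram) (s₁ : D.V × Bool) (s₂ : (D.V ⊕ Unit) × Bool) (u₁ u₂ : ℤ)
      (h : s₂ ≠ (Sum.inr (), false)) : Equivalent D (D.insertVirtual s₁ s₂ u₁ u₂)

/-- No component of the link diagram is a circle without real crossings, so that the singular set
of the associated polyhedron is a union of true vertices and open edges. -/
def NoFreeCircle (D : VDiagram) : Prop :=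
  ∀ s : D.V × Bool, ∃ n : ℕ, D.kind ((D.next)^[n] s).1 ≠ 0

/-! ### Circuits: the boundaries of the `2`-cells

Along an edge of the diagram run three parallel lines, numbered `0, 1, 2` from left to right when one
looks along the edge (the first, second and third line). They are the parts of the boundaries of
`2`-cells that are attached to the edge. The boundary orientation of the `2`-cells agrees with
the orientation of the edge on lines `0` and `1`, and is opposite to it on line `2`. -/

/-- A line along an edge. -/
abbrev Germ (D : VDiagram) : Type := (D.V × Bool) × Fin 3

/-- How the lines are connected at a crossing. If one follows the boundary orientation and arrives at
the crossing on line `l` of strand `b`, then one leaves it on line `(corner ε b l).2` of strand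
`(corner ε b l).1`. Here lines `0, 1` are followed from incoming ends to outgoing ends, and
line `2` is followed from outgoing ends to incoming ends. -/
def corner : SignType → Bool → Fin 3 → Bool × Fin 3
  | .zero, b, l => (b, l)
  | .pos, true, 0 => (false, 1)
  | .pos, true, 1 => (true, 1)
  | .pos, true, 2 => (false, 2)
  | .pos, false, 0 => (false, 0)
  | .pos, false, 1 => (true, 2)
  | .pos, false, 2 => (true, 0)
  | .neg, true, 0 => (false, 2)
  | .neg, true, 1 => (true, 1)
  | .neg, true, 2 => (false, 1)
  | .neg, false, 0 => (false, 0)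
  | .neg, false, 1 => (true, 0)
  | .neg, false, 2 => (true, 2)

/-- The next line on the boundary of a `2`-cell, following the boundary orientation. -/
def succ (D : VDiagram) (g : D.Germ) : D.Germ :=
  let p : D.V × Bool := if g.2 = 2 then g.1 else D.next g.1
  let c := corner (D.kind p.1) p.2 g.2
  (if c.2 = 2 then D.next.symm (p.1, c.1) else (p.1, c.1), c.2)

/-- The contribution of an edge to the rotation number along the boundary of a `2`-cell, which is also
its contribution to the coboundary of the weight: the weight of the edge, up to orientation. -/
def along (D : VDiagram) (g : D.Germ) : ℤ := if g.2 = 2 then -D.weight g.1 else D.weight g.1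

/-- There is a solid dot at the corner at the end of the line `g`: the boundary of the
`2`-cell changes there from following the orientation of the edges to opposing it, or back. -/
def Dot (D : VDiagram) (g : D.Germ) : Prop := ¬ (g.2 = 2 ↔ (D.succ g).2 = 2)

open Classical in
/-- The contribution to the rotation number of the corner at the end of the line `g`. -/
noncomputable def turn (D : VDiagram) (g : D.Germ) : ℚ := if D.Dot g then -1 / 2 else 0

/-- The value of `δ x` on the `2`-cell with `g` on its boundary, where `x` is the weight. -/
noncomputable def coboundary (D : VDiagram) (g : D.Germ) : ℤ :=
  ∑ i ∈ Finset.range (Function.minimalPeriod D.succ g), D.along (D.succ^[i] g)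

open Classical in
/-- The number of solid dots on the boundary of the `2`-cell with `g` on its boundary. -/
noncomputable def dots (D : VDiagram) (g : D.Germ) : ℕ :=
  ((Finset.range (Function.minimalPeriod D.succ g)).filter fun i => D.Dot (D.succ^[i] g)).card

/-- The value of the Euler cochain on the `2`-cell with `g` on its boundary. -/
noncomputable def euler (D : VDiagram) (g : D.Germ) : ℚ := -(1 - (D.dots g : ℚ) / 2)

/-- The weight `x` satisfies `δ x = c_P`, with `c_P` the Euler cochain. -/
def Framed (D : VDiagram) : Prop := ∀ g : D.Germ, (D.coboundary g : ℚ) = D.euler g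

/-! ### The H-move -/

/-- Add the coboundary of the `0`-cochain `f` to the weight. -/
def gauge (D : VDiagram) (f : D.V → ℤ) : VDiagram :=
  { D with weight := fun s => D.weight s + f (D.next s).1 - f s.1 }

open Classical in
/-- The integral H-move at a real crossing: the weights of the two incoming edges are increased by one,
and the weights of the two outgoing edges are decreased by one. -/
def HMove (D D' : VDiagram) : Prop :=
  ∃ v : D.V, D.kind v ≠ 0 ∧ D' = D.gauge (fun u => if u = v then 1 else 0)

end VDiagram

/-! ### Pure sliding moves -/

/-- The four types of pure sliding moves. -/
inductive SlideType
  | I | II | III | IV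

namespace SlideType

/-- Is the left edge directed upwards in the picture of the move? -/
def leftUp : SlideType → Bool
  | I => true | II => true | III => false | IV => true

/-- Is the right edge directed upwards in the picture of the move? -/
def rightUp : SlideType → Bool
  | I => true | II => true | III => true | IV => false

/-- Does the left edge pass over the right edge after the move? -/
def leftOver : SlideType → Bool
  | I => true | II => false | III => true | IV => true

/-- The line on the left edge that belongs to the `2`-cell between the edges. -/
def leftLine : SlideType → Fin 3
  | I => 2 | II => 2 | III => 0 | IV => 2

/-- The line on the right edge that belongs to the `2`-cell between the edges. -/
def rightLine : SlideType → Fin 3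
  | I => 1 | II => 0 | III => 1 | IV => 2

/-- The sign of the lower one of the two new crossings. The upper one has the opposite sign. -/
def bottomSign : SlideType → SignType
  | I => 1 | II => -1 | III => -1 | IV => -1

/-- The new weight on the part of the right edge below the new crossings, in terms of the
rotation number `p`. -/
def lowWeight : SlideType → ℚ → ℚ
  | I, p => -p - 1 / 2
  | II, p => -p - 1 / 2
  | III, p => -p - 1
  | IV, p => p + 1

/-- The new weight on the part of the right edge between the new crossings. -/
def midWeight : SlideType → ℚ
  | I => 0 | II => 0 | III => 1 | IV => -1

end SlideType

namespace VDiagram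

/-- For a strand `b` passing vertically through `B` (below) and `T` (above), upwards if `up` is true
and downwards otherwise: the part of the strand below `B`. -/
def lowEdge (D : VDiagram) (B : D.V) (b up : Bool) : D.V × Bool :=
  if up then D.next.symm (B, b) else (B, b)

/-- The part of the strand between `B` and `T`. -/
def midEdge (D : VDiagram) (B T : D.V) (b up : Bool) : D.V × Bool :=
  if up then (B, b) else (T, b)

/-- The part of the strand above `T`. -/
def highEdge (D : VDiagram) (T : D.V) (b up : Bool) : D.V × Bool :=
  if up then (T, b) else D.next.symm (T, b)

/-- The strand `b` passes through the crossings `B` and `T` consecutively. -/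
def Passes (D : VDiagram) (B T : D.V) (b up : Bool) : Prop :=
  D.next (D.midEdge B T b up) = if up then (T, b) else (B, b)

open Classical in
/-- The integral pure sliding move of type `t`. Before the move the left edge and the right edge
cross each other twice at virtual crossings `B` and `T`, that is, not at all; after the move the
two crossings are real. The condition for the move is that, along the boundary of a `2`-cell,
the prescribed line of the left edge is connected to the prescribed line of the right edge
in such a way that the bottom ends of the edges are joined.
The weights of the two edges before the move are placed outside of the parts below `T` that
are shown in the picture, and `p` is the rotation number from the bottom of the left edge
to the bottom of the right edge along the boundary of the `2`-cell. -/
def Slide (t : SlideType) (D D' : VDiagram) : Prop :=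
  ∃ (B T : D.V) (n : ℕ) (p : ℚ) (w : D.V × Bool → ℤ),
    let b₁ : Bool := t.leftOver
    let b₂ : Bool := !t.leftOver
    let low₁ := D.lowEdge B b₁ t.leftUp
    let low₂ := D.lowEdge B b₂ t.rightUp
    let mid₁ := D.midEdge B T b₁ t.leftUp
    let mid₂ := D.midEdge B T b₂ t.rightUp
    let high₂ := D.highEdge T b₂ t.rightUp
    let g₁ : D.Germ := (low₁, t.leftLine)
    let g₂ : D.Germ := (low₂, t.rightLine)
    B ≠ T ∧ D.kind B = 0 ∧ D.kind T = 0 ∧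
    D.Passes B T b₁ t.leftUp ∧ D.Passes B T b₂ t.rightUp ∧
    D.weight low₁ = 0 ∧ D.weight mid₁ = 0 ∧ D.weight low₂ = 0 ∧ D.weight mid₂ = 0 ∧
    n < Function.minimalPeriod D.succ g₁ ∧ D.succ^[n] g₁ = g₂ ∧
    p = ∑ i ∈ Finset.range n, ((D.along (D.succ^[i] g₁) : ℚ) + D.turn (D.succ^[i] g₁)) ∧
    (∀ s, (w s : ℚ) = D.weight s + (if s = low₂ then t.lowWeight p else 0)
      + (if s = mid₂ then t.midWeight else 0)
      - (if s = high₂ then t.lowWeight p + t.midWeight else 0)) ∧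
    D' = { D with
      kind := Function.update (Function.update D.kind B t.bottomSign) T (-t.bottomSign)
      weight := w }

end VDiagram

/-! ### Matveev-Piergallini moves -/

/-- A tangle with `n` real crossings and three open strands, given by its Gauss code. Strand `j`
enters from outside, passes through `first j` and then through the list `rest j`, and leaves;
each entry `(v, b)` means passing through the crossing `v` over (`b = true`) or
under (`b = false`). `wt (v, b)` is the weight of the edge, or open edge, following this passage;
the open edges at the beginning of the strands have weight zero. -/
structure OTangle (n : ℕ) where
  sign : Fin n → SignType
  first : Fin 3 → Fin n × Bool
  rest : Fin 3 → List (Fin n × Bool)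
  wt : Fin n × Bool → ℤ := fun _ => 0

/-- The last crossing passage of strand `j`. -/
def OTangle.last {n : ℕ} (T : OTangle n) (j : Fin 3) : Fin n × Bool :=
  (T.rest j).getLastD (T.first j)

/-- What remains of a weighted diagram outside of a tangle with three strands. `link` joins the
outgoing ends (of outside crossings and of the three strands of the tangle) to the incoming ends. -/
structure Outside where
  W : Type
  [fin : Finite W]
  kind : W → SignType
  link : (W × Bool) ⊕ Fin 3 ≃ (W × Bool) ⊕ Fin 3
  weight : (W × Bool) ⊕ Fin 3 → ℤ

/-- `D` is obtained by gluing the tangle `T` to the outside `O`, where weights that come to lie on the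
same edge are added; `φ` identifies the crossings. -/
structure IsClosure {n : ℕ} (T : OTangle n) (O : Outside) (D : VDiagram)
    (φ : Fin n ⊕ O.W ≃ D.V) : Prop where
  kind_in : ∀ i, D.kind (φ (Sum.inl i)) = T.sign i
  kind_out : ∀ x, D.kind (φ (Sum.inr x)) = O.kind x
  next_in : ∀ j p q, [p, q] <:+: T.first j :: T.rest j →
    D.next (φ (Sum.inl p.1), p.2) = (φ (Sum.inl q.1), q.2)
  weight_in : ∀ j p q, [p, q] <:+: T.first j :: T.rest j →
    D.weight (φ (Sum.inl p.1), p.2) = T.wt p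
  next_out : ∀ x,
    D.next (Sum.elim (fun s => (φ (Sum.inr s.1), s.2))
      (fun j => (φ (Sum.inl (T.last j).1), (T.last j).2)) x) =
    Sum.elim (fun s => (φ (Sum.inr s.1), s.2))
      (fun j => (φ (Sum.inl (T.first j).1), (T.first j).2)) (O.link x)
  weight_out : ∀ x,
    D.weight (Sum.elim (fun s => (φ (Sum.inr s.1), s.2))
      (fun j => (φ (Sum.inl (T.last j).1), (T.last j).2)) x) =
    O.weight x + Sum.elim (fun _ => 0) (fun j => T.wt (T.last j)) x

/-- The sixteen MP moves. -/
inductive MPType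
  | A1 | A2 | A3 | A4
  | B1 | B2 | B3 | B4
  | C1 | C2 | C3 | C4
  | D1 | D2 | D3 | D4

namespace MPType

/-- Two crossings `0` and `1` of signs `k₀` and `k₁`, joined by an edge which leaves the strand `b₀`
of crossing `0` and enters the strand `b₁` of crossing `1`. All weights are zero. -/
def pair (b₀ b₁ : Bool) (k₀ k₁ : SignType) : OTangle 2 where
  sign := ![k₀, k₁]
  first := ![(0, b₀), (0, !b₀), (1, !b₁)]
  rest := ![[(1, b₁)], [], []]

/-- The tangle with two crossings before the move. -/
def before : MPType → OTangle 2
  | A1 => pair true true 1 1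
  | A2 => pair true true 1 (-1)
  | A3 => pair true true (-1) (-1)
  | A4 => pair true true 1 (-1)
  | B1 => pair false false (-1) (-1)
  | B2 => pair false false (-1) 1
  | B3 => pair false false 1 1
  | B4 => pair false false (-1) 1
  | C1 => pair false true (-1) 1
  | C2 => pair false true (-1) (-1)
  | C3 => pair false true 1 1
  | C4 => pair false true 1 (-1)
  | D1 => pair true false (-1) 1
  | D2 => pair true false 1 1
  | D3 => pair true false (-1) (-1)
  | D4 => pair true false 1 (-1)

/-- Passing over crossing `i`. -/
def o (i : Fin 3) : Fin 3 × Bool := (i, true)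

/-- Passing under crossing `i`. -/
def u (i : Fin 3) : Fin 3 × Bool := (i, false)

/-- Weight `c` on the edge following the passage `p`, weight `-c` on the edge following the passage `q`,
and weight zero otherwise. -/
def wts (p q : Fin 3 × Bool) (c : ℤ) : Fin 3 × Bool → ℤ :=
  fun s => if s = p then c else if s = q then -c else 0

/-- The tangle with three crossings after the move. The moves `A2, A4, B2, B4, C3, D3`, where the
three inner edges form an oriented cycle, are the ones with non-trivial weights. -/
def after : MPType → OTangle 3
  | A1 => { sign := ![1, 1, -1], first := ![o 1, o 0, u 0], rest := ![[], [u 1, o 2], [u 2]] }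
  | A2 => { sign := ![1, 1, -1], first := ![o 0, o 2, u 1], rest := ![[], [u 0, o 1], [u 2]]
            wt := wts (u 0) (o 1) (-1) }
  | A3 => { sign := ![1, -1, -1], first := ![o 1, u 0, o 0], rest := ![[], [u 2], [u 1, o 2]] }
  | A4 => { sign := ![1, -1, -1], first := ![o 2, u 0, o 1], rest := ![[], [u 1], [u 2, o 0]]
            wt := wts (u 0) (u 1) (-1) }
  | B1 => { sign := ![1, -1, -1], first := ![u 2, u 1, o 1], rest := ![[], [o 2, u 0], [o 0]] }
  | B2 => { sign := ![1, -1, -1], first := ![u 1, u 0, o 2], rest := ![[], [o 1, u 2], [o 0]]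
            wt := wts (o 1) (u 2) (-1) }
  | B3 => { sign := ![1, 1, -1], first := ![u 0, o 2, u 2], rest := ![[], [o 1], [o 0, u 1]] }
  | B4 => { sign := ![1, 1, -1], first := ![u 1, o 2, u 0], rest := ![[], [o 0], [o 1, u 2]]
            wt := wts (o 2) (o 0) (-1) }
  | C1 => { sign := ![1, 1, -1], first := ![o 1, o 0, u 0], rest := ![[u 2], [o 2], [u 1]] }
  | C2 => { sign := ![-1, -1, -1], first := ![o 0, o 1, u 0], rest := ![[u 2], [o 2], [u 1]] }
  | C3 => { sign := ![1, 1, -1], first := ![o 0, o 1, u 2], rest := ![[u 1], [o 2], [u 0]]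
            wt := wts (o 1) (o 2) 1 }
  | C4 => { sign := ![1, 1, -1], first := ![o 2, o 0, u 2], rest := ![[u 0], [o 1], [u 1]] }
  | D1 => { sign := ![1, -1, -1], first := ![u 0, u 1, o 0], rest := ![[o 1], [u 2], [o 2]] }
  | D2 => { sign := ![1, 1, 1], first := ![u 0, u 1, o 0], rest := ![[o 2], [u 2], [o 1]] }
  | D3 => { sign := ![1, -1, -1], first := ![u 1, u 2, o 0], rest := ![[o 2], [u 0], [o 1]]
            wt := wts (u 2) (u 0) 1 }
  | D4 => { sign := ![1, -1, -1], first := ![u 2, u 1, o 1], rest := ![[o 0], [u 0], [o 2]] }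

end MPType

namespace VDiagram

/-- The integral MP move of type `m`: the tangle `m.before` is replaced by the tangle `m.after`.
The weights in the two tangles may in addition be changed by arbitrary H-moves at the
crossings of the tangles (`h i` times at crossing `i` before, `h' i` times at crossing `i` after).
In this way one gets all choices of weights for which the rotation numbers of the `2`-cells
agree before and after the move. -/
def MP (m : MPType) (h : Fin 2 → ℤ) (h' : Fin 3 → ℤ) (D D' : VDiagram) : Prop :=
  ∃ (O : Outside) (E E' : VDiagram) (φ : Fin 2 ⊕ O.W ≃ E.V) (φ' : Fin 3 ⊕ O.W ≃ E'.V),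
    IsClosure m.before O E φ ∧ IsClosure m.after O E' φ' ∧
    D = E.gauge (fun v => Sum.elim h (fun _ => 0) (φ.symm v)) ∧
    D' = E'.gauge (fun v => Sum.elim h' (fun _ => 0) (φ'.symm v))

end VDiagram

/-! ### Integral normal o-graphs -/

/-- An integral normal o-graph: a weighted oriented virtual link diagram up to isomorphism and
insertion or removal of virtual crossings. -/
def IntegralOGraph : Type 1 := Quot VDiagram.Equivalent

namespace IntegralOGraph

/-- The integral normal o-graph of a diagram. -/
def mk (D : VDiagram) : IntegralOGraph := Quot.mk _ D

/-- Two integral normal o-graphs are represented by diagrams related by `R`. -/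
def Lift (R : VDiagram → VDiagram → Prop) (Γ Γ' : IntegralOGraph) : Prop :=
  ∃ D D' : VDiagram, mk D = Γ ∧ mk D' = Γ' ∧ R D D'

/-- The weight `x` satisfies `δ x = c_P`, and the polyhedron is standard along its singular set. -/
def IsFramed (Γ : IntegralOGraph) : Prop :=
  ∃ D : VDiagram, mk D = Γ ∧ D.NoFreeCircle ∧ D.Framed

/-- The integral MP move of type `m`. -/
def MPMove (m : MPType) (Γ Γ' : IntegralOGraph) : Prop :=
  ∃ (h : Fin 2 → ℤ) (h' : Fin 3 → ℤ), Lift (VDiagram.MP m h h') Γ Γ'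

/-- The primary integral MP move: the move of type `D2`, in which all crossings are positive, with all
weights in the two tangles equal to zero. -/
def PrimaryMPMove : IntegralOGraph → IntegralOGraph → Prop :=
  Lift (VDiagram.MP MPType.D2 0 0)

/-- The moves to be used: the primary integral MP move, the integral pure sliding moves and the
integral H-move. -/
inductive BasicMove : IntegralOGraph → IntegralOGraph → Prop
  | primary {Γ Γ' : IntegralOGraph} (h : PrimaryMPMove Γ Γ') : BasicMove Γ Γ'
  | slide (t : SlideType) {Γ Γ' : IntegralOGraph} (h : Lift (VDiagram.Slide t) Γ Γ') :
      BasicMove Γ Γ'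
  | hMove {Γ Γ' : IntegralOGraph} (h : Lift VDiagram.HMove Γ Γ') : BasicMove Γ Γ'

/-- A basic move or the inverse of a basic move, between framed integral normal o-graphs. -/
def Step (Γ Γ' : IntegralOGraph) : Prop :=
  Γ.IsFramed ∧ Γ'.IsFramed ∧ (BasicMove Γ Γ' ∨ BasicMove Γ' Γ)

end IntegralOGraph

/-!
The move `D2` is a basic move, and each of the other fifteen moves is reduced to one that is already
known. Slide one of the open edges of the tangle over another open edge, so that there are four
crossings. Three of them form the right-hand side of a known move, and the fourth one belongs to an
annulus around them; replacing them by the left-hand side of the known move leaves three crossings,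
which form the right-hand side of the required move. The weights agree up to H-moves at real
crossings. In this way one obtains `A1`, `B3`, `C3` from `D2`; `C4` from `A1`; `C1` from `B3`; `A2`,
`B4` from `C3`; `B2`, `D1` from `C4`; `A4`, `D4` from `C1`; `D3` from `B2`; `B1` from `D1`; `A3`
from `D4` and `C2` from `D3`.

All diagrams on the way have to be framed. The rotation number of a `2`-cell is the sum of a
function over a cycle of the permutation which follows a line around the boundary of its `2`-cell,
and cycle sums are unchanged if the permutation is replaced by its first-return map to a subset
which meets the cycle and the function by its sums between the returns. Removing a virtual crossing
is such a replacement; so is passing to the lines outside of a tangle, where only the ends joined by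
the lines through the tangle and their rotation numbers matter.
-/

section

open Function Finset

section CycleSum

variable {X Y M : Type*}

/-- The sum of `r` over the cycle of `σ` through `x`; it is zero if `x` is not periodic. -/
noncomputable def cycleSum [AddCommMonoid M] (σ : X → X) (r : X → M) (x : X) : M :=
  birkhoffSum σ r (minimalPeriod σ x) x

theorem cycleSum_apply [AddCommMonoid M] (σ : X → X) (r : X → M) {x : X} (hx : x ∈ periodicPts σ) :
    cycleSum σ r (σ x) = cycleSum σ r x := by
  obtain ⟨n, hn⟩ := Nat.exists_eq_succ_of_ne_zero (minimalPeriod_pos_of_mem_periodicPts hx).ne'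
  have hreturn : σ^[n] (σ x) = x := by
    rw [← iterate_succ_apply, ← hn, iterate_minimalPeriod]
  rw [cycleSum, cycleSum, minimalPeriod_apply hx, hn, birkhoffSum_succ, birkhoffSum_succ', hreturn,
    add_comm]

theorem cycleSum_iterate [AddCommMonoid M] {σ : X → X} (r : X → M) (hσ : ∀ x, x ∈ periodicPts σ)
    (x : X) (n : ℕ) : cycleSum σ r (σ^[n] x) = cycleSum σ r x := by
  induction n with
  | zero => rfl
  | succ n ih => rw [iterate_succ_apply', cycleSum_apply _ _ (hσ _), ih]

theorem cycleSum_add_coboundary [AddCommGroup M] (σ : X → X) (r f : X → M) (x : X) :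
    cycleSum σ (fun x => r x + (f (σ x) - f x)) x = cycleSum σ r x := by
  have htelescope := sum_range_sub (fun i => f (σ^[i] x)) (minimalPeriod σ x)
  simp only [iterate_minimalPeriod, iterate_zero, id_eq, sub_self, iterate_succ_apply']
    at htelescope
  rw [cycleSum, birkhoffSum, sum_add_distrib, htelescope, add_zero, cycleSum, birkhoffSum]

theorem cycleSum_ne_zero_iff [AddCommMonoid M] [PartialOrder M] [IsOrderedAddMonoid M]
    {σ : X → X} {r : X → M} (hr : ∀ x, 0 ≤ r x) {x : X} (hx : x ∈ periodicPts σ) :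
    cycleSum σ r x ≠ 0 ↔ ∃ n, r (σ^[n] x) ≠ 0 := by
  rw [cycleSum, birkhoffSum, Ne, sum_eq_zero_iff_of_nonneg fun i _ => hr _]
  push Not
  constructor
  · rintro ⟨i, -, h⟩
    exact ⟨i, h⟩
  · rintro ⟨n, h⟩
    refine ⟨n % minimalPeriod σ x, ?_, by rwa [iterate_mod_minimalPeriod_eq]⟩
    simpa using Nat.mod_lt _ (minimalPeriod_pos_of_mem_periodicPts hx)

/-- `τ` is the first-return map of `σ` to the image of the injection `ι`, and `time y` is the number
of applications of `σ` after which `ι y` returns. -/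
structure IsFirstReturn (σ : X → X) (τ : Y → Y) (ι : Y → X) (time : Y → ℕ) : Prop where
  injective : Injective ι
  time_pos : ∀ y, 0 < time y
  iterate_time : ∀ y, σ^[time y] (ι y) = ι (τ y)
  iterate_notMem : ∀ y i, 0 < i → i < time y → σ^[i] (ι y) ∉ Set.range ι

namespace IsFirstReturn

variable {σ : X → X} {τ : Y → Y} {ι : Y → X} {time : Y → ℕ}

theorem iterate_birkhoffSum (h : IsFirstReturn σ τ ι time) (y : Y) (k : ℕ) :
    σ^[birkhoffSum τ time k y] (ι y) = ι (τ^[k] y) := by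
  induction k with
  | zero => simp
  | succ k ih =>
    rw [birkhoffSum_succ, add_comm, iterate_add_apply, ih, h.iterate_time, iterate_succ_apply']

theorem birkhoffSum_birkhoffSum [AddCommMonoid M] (h : IsFirstReturn σ τ ι time) (r : X → M)
    (y : Y) (k : ℕ) : birkhoffSum σ r (birkhoffSum τ time k y) (ι y) =
      birkhoffSum τ (fun y => birkhoffSum σ r (time y) (ι y)) k y := by
  induction k with
  | zero => simp
  | succ k ih =>
    rw [birkhoffSum_succ, birkhoffSum_add, ih, h.iterate_birkhoffSum, birkhoffSum_succ]

theorem strictMono_birkhoffSum (h : IsFirstReturn σ τ ι time) (y : Y) :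
    StrictMono fun k => birkhoffSum τ time k y :=
  strictMono_nat_of_lt_succ fun k => by
    rw [birkhoffSum_succ]
    exact Nat.lt_add_of_pos_right (h.time_pos _)

theorem exists_eq_birkhoffSum (h : IsFirstReturn σ τ ι time) {y : Y} {m : ℕ}
    (hm : σ^[m] (ι y) ∈ Set.range ι) : ∃ k, m = birkhoffSum τ time k y := by
  obtain ⟨k, hk, hk'⟩ : ∃ k, birkhoffSum τ time k y ≤ m ∧ m < birkhoffSum τ time (k + 1) y := by
    have hex : ∃ k, m < birkhoffSum τ time k y := ⟨m + 1, (h.strictMono_birkhoffSum y).le_apply⟩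
    obtain ⟨k, hk⟩ : ∃ k, Nat.find hex = k + 1 := Nat.exists_eq_succ_of_ne_zero fun h0 => by
      simpa [h0] using Nat.find_spec hex
    exact ⟨k, not_lt.1 (Nat.find_min hex (by omega)), hk ▸ Nat.find_spec hex⟩
  obtain ⟨d, rfl⟩ := Nat.exists_eq_add_of_le' hk
  rcases Nat.eq_zero_or_pos d with rfl | hd
  · exact ⟨k, zero_add _⟩
  · rw [iterate_add_apply, h.iterate_birkhoffSum] at hm
    rw [birkhoffSum_succ] at hk'
    exact absurd hm (h.iterate_notMem _ d hd (by omega))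

theorem minimalPeriod_eq (h : IsFirstReturn σ τ ι time) {y : Y} (hy : y ∈ periodicPts τ) :
    minimalPeriod σ (ι y) = birkhoffSum τ time (minimalPeriod τ y) y := by
  have hperiodic : IsPeriodicPt σ (birkhoffSum τ time (minimalPeriod τ y) y) (ι y) := by
    rw [IsPeriodicPt, IsFixedPt, h.iterate_birkhoffSum, iterate_minimalPeriod]
  have hpos : 0 < birkhoffSum τ time (minimalPeriod τ y) y := by
    simpa using h.strictMono_birkhoffSum y (minimalPeriod_pos_of_mem_periodicPts hy)
  refine le_antisymm (hperiodic.minimalPeriod_le hpos) ?_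
  have hreturn : σ^[minimalPeriod σ (ι y)] (ι y) = ι y := iterate_minimalPeriod
  obtain ⟨k, hk⟩ := h.exists_eq_birkhoffSum ⟨y, hreturn.symm⟩
  rw [hk, h.iterate_birkhoffSum] at hreturn
  have hk0 : 0 < k := Nat.pos_of_ne_zero fun h0 => by
    simpa [hk, h0] using hperiodic.minimalPeriod_pos hpos
  rw [hk]
  exact (h.strictMono_birkhoffSum y).monotone
    (IsPeriodicPt.minimalPeriod_le hk0 (h.injective hreturn))

theorem cycleSum_eq [AddCommMonoid M] (h : IsFirstReturn σ τ ι time) (r : X → M) {y : Y}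
    (hy : y ∈ periodicPts τ) :
    cycleSum σ r (ι y) = cycleSum τ (fun y => birkhoffSum σ r (time y) (ι y)) y := by
  rw [cycleSum, cycleSum, h.minimalPeriod_eq hy, h.birkhoffSum_birkhoffSum]

theorem map_injective (h : IsFirstReturn σ τ ι time) (hσ : Injective σ) : Injective τ := by
  have eq_of_le : ∀ y y', time y ≤ time y' → τ y = τ y' → y = y' := by
    intro y y' hle hτ
    obtain ⟨d, hd⟩ := Nat.exists_eq_add_of_le hle
    have hreturn := h.iterate_time y'
    rw [← hτ, ← h.iterate_time, hd, iterate_add_apply] at hreturn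
    have hy := hσ.iterate _ hreturn
    rcases Nat.eq_zero_or_pos d with rfl | hd0
    · exact (h.injective hy).symm
    · exact absurd ⟨y, hy.symm⟩ (h.iterate_notMem y' d hd0 (by have := h.time_pos y; omega))
  intro y y' hτ
  rcases le_total (time y) (time y') with hle | hle
  · exact eq_of_le y y' hle hτ
  · exact (eq_of_le y' y hle hτ.symm).symm

end IsFirstReturn

theorem cycleSum_semiconj [AddCommMonoid M] {σ : X → X} {τ : Y → Y} {ι : Y → X}
    (hι : Injective ι) (h : Semiconj ι τ σ) (hτ : ∀ y, y ∈ periodicPts τ) (r : X → M) (y : Y) :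
    cycleSum σ r (ι y) = cycleSum τ (r ∘ ι) y := by
  have hreturn : IsFirstReturn σ τ ι fun _ => 1 :=
    ⟨hι, fun _ => one_pos, fun y => (h y).symm, fun _ i h0 h1 => by omega⟩
  simp only [hreturn.cycleSum_eq r (hτ y), birkhoffSum_one]
  rfl

end CycleSum

namespace VDiagram

/-- Twice the contribution to the rotation number of a corner between lines `l` and `l'`. -/
def turn2 (l l' : Fin 3) : ℤ := if (l = 2 ↔ l' = 2) then 0 else -1

/-- Twice the contribution of a line and of the corner at its end to the rotation number. -/
def rot2 (D : VDiagram) (g : D.Germ) : ℤ := 2 * D.along g + turn2 g.2 (D.succ g).2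

theorem turn_eq (D : VDiagram) (g : D.Germ) : D.turn g = (turn2 g.2 (D.succ g).2 : ℚ) / 2 := by
  unfold turn turn2 Dot
  split_ifs <;> simp_all

theorem along_add_turn (D : VDiagram) (g : D.Germ) :
    (D.along g : ℚ) + D.turn g = (D.rot2 g : ℚ) / 2 := by
  rw [turn_eq, rot2]
  push_cast
  ring

theorem framed_iff (D : VDiagram) : D.Framed ↔ ∀ g, cycleSum D.succ D.rot2 g = -2 := by
  refine forall_congr' fun g => ?_
  have h : cycleSum D.succ D.rot2 g = 2 * D.coboundary g - D.dots g := by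
    rw [cycleSum, coboundary, dots, card_filter]
    push_cast
    rw [mul_sum, ← sum_sub_distrib]
    refine sum_congr rfl fun i _ => ?_
    unfold rot2 turn2 Dot
    split_ifs <;> simp_all; ring
  rw [h, euler]
  constructor
  · intro heuler
    have htwice : (2 * D.coboundary g - D.dots g : ℚ) = -2 := by rw [heuler]; ring
    exact_mod_cast htwice
  · intro hrot
    have htwice : (2 * D.coboundary g - D.dots g : ℚ) = -2 := by exact_mod_cast hrot
    linarith

theorem corner_injective (ε : SignType) :
    Injective fun x : Bool × Fin 3 => corner ε x.1 x.2 := by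
  cases ε <;> decide

/-- The incoming or outgoing end at which the line `g` arrives, with its line. -/
def arrival (D : VDiagram) (g : D.Germ) : D.Germ := (if g.2 = 2 then g.1 else D.next g.1, g.2)

/-- The line with which one leaves a crossing after arriving there. -/
def depart (D : VDiagram) (a : D.Germ) : D.Germ :=
  let c := corner (D.kind a.1.1) a.1.2 a.2
  (if c.2 = 2 then D.next.symm (a.1.1, c.1) else (a.1.1, c.1), c.2)

theorem succ_eq (D : VDiagram) (g : D.Germ) : D.succ g = D.depart (D.arrival g) := rfl

theorem arrival_injective (D : VDiagram) : Injective D.arrival := by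
  rintro ⟨s, l⟩ ⟨s', l'⟩ h
  simp only [arrival, Prod.mk.injEq] at h
  obtain ⟨hend, rfl⟩ := h
  split_ifs at hend <;> simp_all

theorem depart_injective (D : VDiagram) : Injective D.depart := by
  rintro ⟨⟨v, b⟩, l⟩ ⟨⟨v', b'⟩, l'⟩ h
  simp only [depart, Prod.mk.injEq] at h
  obtain ⟨hend, hline⟩ := h
  rw [← hline] at hend
  have hcorner : (v, (corner (D.kind v) b l).1) = (v', (corner (D.kind v') b' l').1) := by
    split_ifs at hend
    · exact D.next.symm.injective hend
    · exact hend
  obtain ⟨rfl, hfst⟩ := Prod.mk.inj hcorner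
  obtain ⟨rfl, rfl⟩ := Prod.mk.inj
    (corner_injective (D.kind v) (a₁ := (b, l)) (a₂ := (b', l')) (Prod.ext hfst hline))
  rfl

theorem succ_injective (D : VDiagram) : Injective D.succ :=
  D.depart_injective.comp D.arrival_injective

theorem mem_periodicPts_succ (D : VDiagram) (g : D.Germ) : g ∈ periodicPts D.succ :=
  haveI := D.fin
  D.succ_injective.mem_periodicPts g

theorem mem_periodicPts_next (D : VDiagram) (s : D.V × Bool) : s ∈ periodicPts D.next :=
  haveI := D.fin
  D.next.injective.mem_periodicPts s

/-- The indicator function of the real crossings. -/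
noncomputable def isReal (D : VDiagram) (s : D.V × Bool) : ℤ := if D.kind s.1 = 0 then 0 else 1

theorem noFreeCircle_iff (D : VDiagram) :
    D.NoFreeCircle ↔ ∀ s, cycleSum D.next D.isReal s ≠ 0 := by
  refine forall_congr' fun s => ?_
  rw [cycleSum_ne_zero_iff _ (D.mem_periodicPts_next s)]
  · simp [isReal]
  · intro s
    unfold isReal
    split_ifs <;> simp

/-- The diagram is framed and has no circle without real crossings. -/
def FramedNormal (D : VDiagram) : Prop := D.NoFreeCircle ∧ D.Framed

/-- `FramedNormal` in terms of cycle sums, except at the components and lines that meet the edges in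
`S`. It serves to pass through diagrams with loops on their way to an inserted virtual crossing. -/
def FramedNormalOff (D : VDiagram) (S : Set (D.V × Bool)) : Prop :=
  (∀ s ∉ S, cycleSum D.next D.isReal s ≠ 0) ∧
    ∀ g : D.Germ, g.1 ∉ S → cycleSum D.succ D.rot2 g = -2

theorem framedNormal_iff_framedNormalOff_empty (D : VDiagram) :
    D.FramedNormal ↔ D.FramedNormalOff ∅ := by
  simp only [FramedNormal, FramedNormalOff, noFreeCircle_iff, framed_iff, Set.mem_empty_iff_false,
    not_false_eq_true, true_imp_iff]

/-- `f` identifies `D` with a union of components of `D'`. -/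
structure IsEmbedding (D D' : VDiagram) (f : D.V → D'.V) : Prop where
  injective : Injective f
  kind : ∀ v, D'.kind (f v) = D.kind v
  next : Semiconj (Prod.map f id) D.next D'.next
  weight : ∀ s, D'.weight (Prod.map f id s) = D.weight s

namespace IsEmbedding

variable {D D' : VDiagram} {f : D.V → D'.V}

theorem next_symm (h : IsEmbedding D D' f) :
    Semiconj (Prod.map f id) D.next.symm D'.next.symm := fun s => by
  rw [Equiv.eq_symm_apply, ← h.next, Equiv.apply_symm_apply]

theorem arrival (h : IsEmbedding D D' f) :
    Semiconj (Prod.map (Prod.map f id) id) D.arrival D'.arrival := by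
  rintro ⟨s, l⟩
  by_cases hl : l = 2
  · simp [VDiagram.arrival, hl]
  · simpa [VDiagram.arrival, hl] using h.next s

theorem depart (h : IsEmbedding D D' f) :
    Semiconj (Prod.map (Prod.map f id) id) D.depart D'.depart := by
  rintro ⟨⟨v, b⟩, l⟩
  simp only [VDiagram.depart, Prod.map_apply, id_eq, h.kind]
  split_ifs with hc
  · exact Prod.ext (h.next_symm _) rfl
  · rfl

theorem succ (h : IsEmbedding D D' f) :
    Semiconj (Prod.map (Prod.map f id) id) D.succ D'.succ :=
  fun g => (h.depart (D.arrival g)).trans (congrArg D'.depart (h.arrival g))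

theorem cycleSum_rot2 (h : IsEmbedding D D' f) (g : D.Germ) :
    cycleSum D'.succ D'.rot2 (Prod.map (Prod.map f id) id g) = cycleSum D.succ D.rot2 g := by
  have hrot : D'.rot2 ∘ Prod.map (Prod.map f id) id = D.rot2 := by
    funext g
    simp only [comp_apply, rot2, along, ← h.succ g, Prod.map_fst, Prod.map_snd, id_eq, h.weight]
  rw [cycleSum_semiconj ((h.injective.prodMap injective_id).prodMap injective_id) h.succ
    D.mem_periodicPts_succ, hrot]

theorem cycleSum_isReal (h : IsEmbedding D D' f) (s : D.V × Bool) :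
    cycleSum D'.next D'.isReal (Prod.map f id s) = cycleSum D.next D.isReal s := by
  have hreal : D'.isReal ∘ Prod.map f id = D.isReal := by
    funext s
    simp only [comp_apply, isReal, Prod.map_fst, h.kind]
  rw [cycleSum_semiconj (h.injective.prodMap injective_id) h.next D.mem_periodicPts_next, hreal]

theorem framedNormalOff_compl_range_iff (h : IsEmbedding D D' f) :
    D'.FramedNormalOff (Set.range (Prod.map f id))ᶜ ↔ D.FramedNormal := by
  rw [framedNormal_iff_framedNormalOff_empty]
  simp only [FramedNormalOff, Set.mem_compl_iff, not_not, Set.forall_mem_range, h.cycleSum_isReal,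
    Set.mem_empty_iff_false, not_false_eq_true, true_imp_iff, Prod.forall (α := D'.V × Bool)]
  refine and_congr_right fun _ => ⟨fun hrot g => ?_, ?_⟩
  · rw [← h.cycleSum_rot2]
    exact hrot _ _ ⟨g.1, rfl⟩
  · rintro hrot _ l ⟨s, rfl⟩
    exact (h.cycleSum_rot2 (s, l)).trans (hrot _)

end IsEmbedding

theorem Iso.exists_isEmbedding {D D' : VDiagram} (h : Iso D D') :
    ∃ φ : D.V ≃ D'.V, IsEmbedding D D' φ := by
  obtain ⟨φ, hkind, hnext, hweight⟩ := h
  exact ⟨φ, φ.injective, hkind, fun s => (hnext s.1 s.2).symm, fun s => hweight s.1 s.2⟩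

theorem Iso.framedNormal_iff {D D' : VDiagram} (h : Iso D D') :
    D.FramedNormal ↔ D'.FramedNormal := by
  obtain ⟨φ, hφ⟩ := h.exists_isEmbedding
  have hrange : (Set.range (Prod.map φ (id : Bool → Bool)))ᶜ = ∅ := by
    rw [(φ.surjective.prodMap surjective_id).range_eq, Set.compl_univ]
  rw [← hφ.framedNormalOff_compl_range_iff, hrange, framedNormal_iff_framedNormalOff_empty]

/-! ### Insertion of virtual crossings -/

/-- Disjoint union with a virtual crossing whose strands are closed up to loops. -/
noncomputable abbrev loops (D : VDiagram) : VDiagram :=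
  haveI := D.fin
  { V := D.V ⊕ Unit
    kind := Sum.elim D.kind (fun _ => 0)
    next := D.addLoops
    weight := fun s => Sum.elim (fun v => D.weight (v, s.2)) (fun _ => 0) s.1 }

open Classical in
/-- Insert the strand `q` after the outgoing end `t`, if `q` is a loop. -/
noncomputable abbrev splice (E : VDiagram) (t q : E.V × Bool) (u : ℤ) : VDiagram :=
  haveI := E.fin
  { V := E.V
    kind := E.kind
    next := (Equiv.swap t q).trans E.next
    weight := Function.update (Function.update E.weight t (E.weight t - u)) q u }

theorem insertVirtual_eq (D : VDiagram) (s₁ : D.V × Bool) (s₂ : (D.V ⊕ Unit) × Bool) (u₁ u₂ : ℤ) :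
    D.insertVirtual s₁ s₂ u₁ u₂ = (D.loops.splice (Sum.inl s₁.1, s₁.2) (Sum.inr (), true) u₁).splice
      s₂ (Sum.inr (), false) u₂ := by
  unfold insertVirtual splice loops
  congr!

theorem isEmbedding_loops (D : VDiagram) : IsEmbedding D D.loops Sum.inl where
  injective := Sum.inl_injective
  kind _ := rfl
  next _ := rfl
  weight _ := rfl

theorem depart_of_kind_eq_zero (D : VDiagram) {a : D.Germ} (h : D.kind a.1.1 = 0) :
    D.depart a = (if a.2 = 2 then D.next.symm a.1 else a.1, a.2) := by
  have hcorner : corner (D.kind a.1.1) a.1.2 a.2 = (a.1.2, a.2) := by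
    rw [h]
    rfl
  simp only [depart, hcorner]

theorem arrival_fst_ne_of_next_eq {E : VDiagram} {q : E.V × Bool} (hq : E.next q = q)
    {g : E.Germ} (hg : g.1 ≠ q) : (E.arrival g).1 ≠ q := by
  unfold arrival
  split_ifs
  · exact hg
  · exact fun h => hg (E.next.injective (h.trans hq.symm))

theorem succ_fst_ne_of_next_eq {E : VDiagram} {q : E.V × Bool} (hq : E.next q = q)
    (hk : E.kind q.1 = 0) {g : E.Germ} (hg : g.1 ≠ q) : (E.succ g).1 ≠ q := by
  have hsymm : ∀ s, E.next.symm s = q → s = q := fun s h => by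
    rwa [Equiv.symm_apply_eq, hq] at h
  have ha := arrival_fst_ne_of_next_eq hq hg
  rw [succ_eq]
  generalize E.arrival g = a at ha
  by_cases hv : a.1.1 = q.1
  · rw [depart_of_kind_eq_zero _ (by rw [hv, hk])]
    dsimp only
    split_ifs
    · exact fun h => ha (hsymm _ h)
    · exact ha
  · unfold depart
    dsimp only
    split_ifs
    · exact fun h => hv (Prod.ext_iff.1 (hsymm _ h)).1
    · exact fun h => hv (Prod.ext_iff.1 h).1

section Splice

variable {E : VDiagram} {t q : E.V × Bool} (u : ℤ)

theorem splice_next_left : (E.splice t q u).next t = E.next q := by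
  simp [splice]

theorem splice_next_right : (E.splice t q u).next q = E.next t := by
  simp [splice]

theorem splice_next_of_ne {s : E.V × Bool} (ht : s ≠ t) (hq : s ≠ q) :
    (E.splice t q u).next s = E.next s := by
  simp [splice, Equiv.swap_apply_of_ne_of_ne, ht, hq]

open Classical in
theorem isFirstReturn_splice_next (hq : E.next q = q) :
    IsFirstReturn (E.splice t q u).next
      (fun s : {s // s ≠ q} => ⟨E.next s, fun h => s.2 (E.next.injective (h.trans hq.symm))⟩)
      Subtype.val (fun s => if s.1 = t then 2 else 1) where
  injective := Subtype.val_injective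
  time_pos s := by split_ifs <;> simp
  iterate_time := by
    rintro ⟨s, hs⟩
    split_ifs with ht
    · obtain rfl : s = t := ht
      exact (congrArg _ ((splice_next_left u).trans hq)).trans (splice_next_right u)
    · exact splice_next_of_ne u ht hs
  iterate_notMem := by
    rintro ⟨s, hs⟩ i hi hi'
    split_ifs at hi' with ht
    · obtain rfl : i = 1 := by omega
      obtain rfl : s = t := ht
      rintro ⟨z, hz⟩
      rw [iterate_one, splice_next_left, hq] at hz
      exact z.2 hz
    · omega

theorem splice_cycleSum_isReal (hq : E.next q = q) (hk : E.kind q.1 = 0) {s : E.V × Bool}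
    (hs : s ≠ q) :
    cycleSum (E.splice t q u).next (E.splice t q u).isReal s = cycleSum E.next E.isReal s := by
  have hreturn := isFirstReturn_splice_next (t := t) u hq
  have hper := fun s => haveI := E.fin
    (hreturn.map_injective (E.splice t q u).next.injective).mem_periodicPts s
  rw [hreturn.cycleSum_eq (E.splice t q u).isReal (hper ⟨s, hs⟩)]
  refine Eq.trans ?_ (cycleSum_semiconj Subtype.val_injective (fun _ => rfl) hper E.isReal
    ⟨s, hs⟩).symm
  congr 1
  funext ⟨s, hs⟩
  dsimp only
  split_ifs with ht
  · subst ht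
    have hreal : (E.splice s q u).isReal q = 0 := if_pos hk
    rw [birkhoffSum_succ, birkhoffSum_one, iterate_one, splice_next_left, hq, hreal, add_zero]
    rfl
  · rw [birkhoffSum_one]
    rfl

open Classical in
/-- The part of the line `g` after insertion of the strand `q` into the edge `t` which comes first
on the boundary of the `2`-cell. -/
noncomputable def firstPart {S : Type} (t q : S) (g : S × Fin 3) : S × Fin 3 :=
  if g = (t, 2) then (q, 2) else g

open Classical in
/-- The part of the line `g` after insertion of the strand `q` into the edge `t` which comes last on
the boundary of the `2`-cell. -/
noncomputable def lastPart {S : Type} (t q : S) (g : S × Fin 3) : S × Fin 3 :=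
  if g.1 = t ∧ g.2 ≠ 2 then (q, g.2) else g

theorem firstPart_snd (g : E.Germ) : (firstPart t q g).2 = g.2 := by
  unfold firstPart
  split_ifs with h
  · rw [h]
  · rfl

theorem lastPart_snd (g : E.Germ) : (lastPart t q g).2 = g.2 := by
  unfold lastPart
  split_ifs <;> rfl

theorem firstPart_of_ne {g : E.Germ} (h : g.1 ≠ t) : firstPart t q g = g :=
  if_neg fun hg => h (congrArg Prod.fst hg)

theorem lastPart_of_ne {g : E.Germ} (h : g.1 ≠ t) : lastPart t q g = g :=
  if_neg fun hg => h hg.1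

theorem firstPart_injOn : Set.InjOn (firstPart t q) {g : E.Germ | g.1 ≠ q} := by
  intro a ha b hb h
  unfold firstPart at h
  split_ifs at h with hat hbt hbt
  · rw [hat, hbt]
  · exact absurd (congrArg Prod.fst h).symm hb
  · exact absurd (congrArg Prod.fst h) ha
  · exact h

theorem splice_arrival_lastPart {g : E.Germ} (hg : g.1 ≠ q) :
    (E.splice t q u).arrival (lastPart t q g) = E.arrival g := by
  obtain ⟨s, l⟩ := g
  by_cases hl : l = 2
  · simp [arrival, lastPart, hl]
  by_cases ht : s = t
  · simp [arrival, lastPart, hl, ht]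
  · rw [lastPart_of_ne ht]
    simp only [arrival, hl, if_false, splice_next_of_ne u ht hg]

theorem splice_next_symm_of_ne (hq : E.next q = q) {s : E.V × Bool} (ht : s ≠ E.next t)
    (hs : s ≠ q) : (E.splice t q u).next.symm s = E.next.symm s := by
  rw [Equiv.symm_apply_eq, splice_next_of_ne, Equiv.apply_symm_apply]
  · rintro rfl
    exact ht (E.next.apply_symm_apply s).symm
  · intro h
    exact hs (by rw [← hq, ← h, Equiv.apply_symm_apply])

theorem splice_depart (hq : E.next q = q) {a : E.Germ} (ha : (E.depart a).1 ≠ q) :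
    (E.splice t q u).depart a = firstPart t q (E.depart a) := by
  set c := corner (E.kind a.1.1) a.1.2 a.2
  by_cases hc : c.2 = 2
  · have hdepart : E.depart a = (E.next.symm (a.1.1, c.1), 2) := Prod.ext (if_pos hc) hc
    have hdepart' : (E.splice t q u).depart a = ((E.splice t q u).next.symm (a.1.1, c.1), 2) :=
      Prod.ext (if_pos hc) hc
    rw [hdepart] at ha
    rw [hdepart, hdepart']
    by_cases ht : E.next.symm (a.1.1, c.1) = t
    · have hsymm : (E.splice t q u).next.symm (a.1.1, c.1) = q := by
        rw [Equiv.symm_apply_eq, splice_next_right, ← ht, Equiv.apply_symm_apply]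
      rw [ht, hsymm, firstPart, if_pos rfl]
    · have hne : (a.1.1, c.1) ≠ q := fun h => ha (by rw [h, Equiv.symm_apply_eq, hq])
      rw [splice_next_symm_of_ne u hq (fun h => ht ((Equiv.symm_apply_eq _).2 h)) hne,
        firstPart_of_ne ht]
  · have hdepart : E.depart a = ((a.1.1, c.1), c.2) := Prod.ext (if_neg hc) rfl
    have hdepart' : (E.splice t q u).depart a = ((a.1.1, c.1), c.2) := Prod.ext (if_neg hc) rfl
    rw [hdepart, hdepart', firstPart, if_neg fun h => hc (congrArg Prod.snd h)]

theorem splice_succ_lastPart (hq : E.next q = q) (hk : E.kind q.1 = 0) {g : E.Germ}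
    (hg : g.1 ≠ q) : (E.splice t q u).succ (lastPart t q g) = firstPart t q (E.succ g) := by
  rw [succ_eq, splice_arrival_lastPart u hg, splice_depart u hq, succ_eq]
  exact succ_fst_ne_of_next_eq hq hk hg

theorem splice_succ_firstPart (hq : E.next q = q) (hk : E.kind q.1 = 0) {g : E.Germ}
    (hg : g.1 = t) : (E.splice t q u).succ (firstPart t q g) = lastPart t q g := by
  obtain ⟨s, l⟩ := g
  obtain rfl : s = t := hg
  have harrival : (E.splice s q u).arrival (firstPart s q (s, l)) = (q, l) := by
    by_cases hl : l = 2 <;> simp [arrival, firstPart, hl, hq]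
  rw [succ_eq, harrival, depart_of_kind_eq_zero _ hk]
  by_cases hl : l = 2
  · have hsymm : (E.splice s q u).next.symm q = s := by
      rw [Equiv.symm_apply_eq, splice_next_left, hq]
    simp only [hl, lastPart, if_true, hsymm, ne_eq, not_true_eq_false, and_false, if_false]
  · simp [lastPart, hl]

theorem splice_rot2_firstPart_add_rot2_lastPart (hq : E.next q = q) (hk : E.kind q.1 = 0)
    (htq : t ≠ q) {g : E.Germ} (hg : g.1 = t) :
    (E.splice t q u).rot2 (firstPart t q g) + (E.splice t q u).rot2 (lastPart t q g) =
      E.rot2 g := by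
  unfold rot2
  rw [splice_succ_firstPart u hq hk hg, splice_succ_lastPart u hq hk (hg ▸ htq), firstPart_snd,
    firstPart_snd, lastPart_snd]
  obtain ⟨s, l⟩ := g
  obtain rfl : s = t := hg
  by_cases hl : l = 2
  · simp only [turn2, along, firstPart, lastPart, hl, if_true, ne_eq, not_true_eq_false, and_false,
      if_false, update_self, htq, update_of_ne, not_false_eq_true]
    ring
  · simp only [turn2, along, firstPart, lastPart, hl, if_true, if_false, Prod.mk.injEq, and_false,
      ne_eq, not_false_eq_true, and_self, update_self, htq, update_of_ne]
    ring

theorem splice_rot2_of_ne (hq : E.next q = q) (hk : E.kind q.1 = 0) {g : E.Germ} (hg : g.1 ≠ q)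
    (ht : g.1 ≠ t) : (E.splice t q u).rot2 g = E.rot2 g := by
  have hsucc : (E.splice t q u).succ g = firstPart t q (E.succ g) := by
    rw [← splice_succ_lastPart u hq hk hg, lastPart_of_ne ht]
  simp only [rot2, along, hsucc, firstPart_snd, ht, hg, ne_eq, not_false_eq_true, update_of_ne]

open Classical in
theorem isFirstReturn_splice_succ (hq : E.next q = q) (hk : E.kind q.1 = 0) (htq : t ≠ q) :
    IsFirstReturn (E.splice t q u).succ
      (fun g : {g : E.Germ // g.1 ≠ q} => ⟨E.succ g, succ_fst_ne_of_next_eq hq hk g.2⟩)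
      (fun g => firstPart t q g.1) (fun g => if g.1.1 = t then 2 else 1) where
  injective a b h := Subtype.ext (firstPart_injOn a.2 b.2 h)
  time_pos g := by split_ifs <;> simp
  iterate_time := by
    rintro ⟨g, hg⟩
    split_ifs with ht
    · rw [iterate_succ_apply, iterate_one, splice_succ_firstPart u hq hk ht,
        splice_succ_lastPart u hq hk hg]
    · rw [iterate_one, firstPart_of_ne ht, ← splice_succ_lastPart u hq hk hg, lastPart_of_ne ht]
  iterate_notMem := by
    rintro ⟨⟨s, l⟩, hg⟩ i hi hi'
    split_ifs at hi' with ht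
    · obtain rfl : i = 1 := by omega
      obtain rfl : s = t := ht
      rintro ⟨z, hz⟩
      replace hz : firstPart s q z.1 = lastPart s q (s, l) :=
        hz.trans (splice_succ_firstPart u hq hk rfl)
      have hlevel : z.1.2 = l := by
        simpa only [firstPart_snd, lastPart_snd] using congrArg Prod.snd hz
      unfold firstPart lastPart at hz
      split_ifs at hz with hz2 hl hl
      · exact hl.2 (hlevel ▸ congrArg Prod.snd hz2)
      · exact htq (congrArg Prod.fst hz).symm
      · exact z.2 (congrArg Prod.fst hz)
      · rw [hz] at hz2
        exact hl ⟨rfl, fun h => hz2 (Prod.ext rfl h)⟩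
    · omega

theorem splice_cycleSum_rot2_firstPart (hq : E.next q = q) (hk : E.kind q.1 = 0) (htq : t ≠ q)
    {g : E.Germ} (hg : g.1 ≠ q) :
    cycleSum (E.splice t q u).succ (E.splice t q u).rot2 (firstPart t q g) =
      cycleSum E.succ E.rot2 g := by
  have hreturn := isFirstReturn_splice_succ u hq hk htq
  have hper := fun g => haveI := E.fin
    (hreturn.map_injective (E.splice t q u).succ_injective).mem_periodicPts g
  refine (hreturn.cycleSum_eq (E.splice t q u).rot2 (hper ⟨g, hg⟩)).trans ?_
  refine Eq.trans ?_ (cycleSum_semiconj Subtype.val_injective (fun _ => rfl) hper E.rot2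
    ⟨g, hg⟩).symm
  congr 1
  funext ⟨g, hg⟩
  dsimp only
  split_ifs with ht
  · rw [birkhoffSum_succ, birkhoffSum_one, iterate_one, splice_succ_firstPart u hq hk ht]
    exact splice_rot2_firstPart_add_rot2_lastPart u hq hk htq ht
  · rw [birkhoffSum_one, firstPart_of_ne ht]
    exact splice_rot2_of_ne u hq hk hg ht

theorem splice_cycleSum_rot2_lastPart (hq : E.next q = q) (hk : E.kind q.1 = 0) (htq : t ≠ q)
    {g : E.Germ} (hg : g.1 ≠ q) :
    cycleSum (E.splice t q u).succ (E.splice t q u).rot2 (lastPart t q g) =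
      cycleSum E.succ E.rot2 g := by
  rw [← splice_cycleSum_rot2_firstPart u hq hk htq hg]
  by_cases ht : g.1 = t
  · rw [← splice_succ_firstPart u hq hk ht, cycleSum_apply _ _ (mem_periodicPts_succ _ _)]
  · rw [firstPart_of_ne ht, lastPart_of_ne ht]

theorem splice_cycleSum_rot2 (hq : E.next q = q) (hk : E.kind q.1 = 0) (htq : t ≠ q)
    {g : E.Germ} (hg : g.1 ≠ q) :
    cycleSum (E.splice t q u).succ (E.splice t q u).rot2 g = cycleSum E.succ E.rot2 g := by
  by_cases h : g.2 = 2
  · rw [← splice_cycleSum_rot2_lastPart u hq hk htq hg, lastPart, if_neg fun h' => h'.2 h]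
  · rw [← splice_cycleSum_rot2_firstPart u hq hk htq hg, firstPart,
      if_neg fun h' => h (congrArg Prod.snd h')]

theorem splice_cycleSum_rot2_right (hq : E.next q = q) (hk : E.kind q.1 = 0) (htq : t ≠ q)
    (l : Fin 3) :
    cycleSum (E.splice t q u).succ (E.splice t q u).rot2 (q, l) =
      cycleSum E.succ E.rot2 (t, l) := by
  by_cases hl : l = 2
  · rw [← splice_cycleSum_rot2_firstPart u hq hk htq (g := (t, l)) htq, firstPart, hl, if_pos rfl]
  · rw [← splice_cycleSum_rot2_lastPart u hq hk htq (g := (t, l)) htq, lastPart,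
      if_pos ⟨rfl, hl⟩]

theorem splice_framedNormalOff_iff (hq : E.next q = q) (hk : E.kind q.1 = 0)
    {S : Set (E.V × Bool)} (ht : t ∉ insert q S) :
    (E.splice t q u).FramedNormalOff S ↔ E.FramedNormalOff (insert q S) := by
  have htq : t ≠ q := fun h => ht (Or.inl h)
  constructor
  · rintro ⟨hreal, hrot⟩
    refine ⟨fun s hs => ?_, fun g hg => ?_⟩
    · rw [← splice_cycleSum_isReal u hq hk fun h => hs (Or.inl h)]
      exact hreal s fun h => hs (Or.inr h)
    · rw [← splice_cycleSum_rot2 u hq hk htq fun h => hg (Or.inl h)]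
      exact hrot g fun h => hg (Or.inr h)
  · rintro ⟨hreal, hrot⟩
    refine ⟨fun s hs => ?_, fun ⟨s, l⟩ hg => ?_⟩
    · by_cases hsq : s = q
      · have hnext : (E.splice t q u).next t = s := by rw [splice_next_left, hq, hsq]
        rw [← hnext, cycleSum_apply _ _ (mem_periodicPts_next _ _),
          splice_cycleSum_isReal u hq hk htq]
        exact hreal t ht
      · rw [splice_cycleSum_isReal u hq hk hsq]
        exact hreal s fun h => h.elim hsq hs
    · by_cases hsq : s = q
      · rw [hsq, splice_cycleSum_rot2_right u hq hk htq]
        exact hrot _ ht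
      · rw [splice_cycleSum_rot2 u hq hk htq hsq]
        exact hrot _ fun h => h.elim hsq hg

end Splice

theorem insertVirtual_framedNormal_iff (D : VDiagram) (s₁ : D.V × Bool) (s₂ : (D.V ⊕ Unit) × Bool)
    (u₁ u₂ : ℤ) (h : s₂ ≠ (Sum.inr (), false)) :
    (D.insertVirtual s₁ s₂ u₁ u₂).FramedNormal ↔ D.FramedNormal := by
  have hcompl : (Set.range (Prod.map Sum.inl id : D.V × Bool → (D.V ⊕ Unit) × Bool))ᶜ =
      {(Sum.inr (), true), (Sum.inr (), false)} := by
    ext ⟨v | ⟨⟩, b⟩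
    · simp
    · cases b <;> simp
  rw [insertVirtual_eq, framedNormal_iff_framedNormalOff_empty, splice_framedNormalOff_iff,
    splice_framedNormalOff_iff, ← D.isEmbedding_loops.framedNormalOff_compl_range_iff, hcompl]
  · simp
  · rfl
  · rfl
  · simp
  · rw [splice_next_of_ne _ (by simp) (by simp)]
    rfl
  · rfl
  · simpa using h

theorem Equivalent.framedNormal_iff {D D' : VDiagram} (h : Equivalent D D') :
    D.FramedNormal ↔ D'.FramedNormal := by
  cases h with
  | iso h => exact h.framedNormal_iff
  | insert s₁ s₂ u₁ u₂ h => exact (insertVirtual_framedNormal_iff _ _ _ _ _ h).symm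

/-! ### Invariance of framings under H-moves -/

/-- The crossing at which the line `g` starts, following the boundary orientation. -/
def origin (D : VDiagram) (g : D.Germ) : D.V := (if g.2 = 2 then D.next g.1 else g.1).1

theorem origin_depart (D : VDiagram) (a : D.Germ) : D.origin (D.depart a) = a.1.1 := by
  unfold origin depart
  split_ifs <;> simp_all

theorem gauge_rot2 (D : VDiagram) (f : D.V → ℤ) (g : D.Germ) : (D.gauge f).rot2 g =
    D.rot2 g + (2 * f (D.origin (D.succ g)) - 2 * f (D.origin g)) := by
  have hsucc : (D.gauge f).succ g = D.succ g := rfl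
  rw [succ_eq D g, origin_depart]
  unfold rot2
  rw [hsucc]
  simp only [along, arrival, gauge, origin]
  split_ifs <;> ring

theorem gauge_framed_iff (D : VDiagram) (f : D.V → ℤ) : (D.gauge f).Framed ↔ D.Framed := by
  rw [framed_iff, framed_iff]
  refine forall_congr' fun (g : D.Germ) => ?_
  have hsum : cycleSum D.succ (D.gauge f).rot2 g = cycleSum D.succ D.rot2 g := by
    rw [← cycleSum_add_coboundary D.succ D.rot2 fun g => 2 * f (D.origin g)]
    exact congrArg (cycleSum D.succ · g) (funext (D.gauge_rot2 f))
  rw [← hsum]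
  rfl

theorem gauge_framedNormal_iff (D : VDiagram) (f : D.V → ℤ) :
    (D.gauge f).FramedNormal ↔ D.FramedNormal := by
  rw [FramedNormal, FramedNormal, gauge_framed_iff]
  rfl

end VDiagram

namespace IntegralOGraph

open VDiagram

theorem isFramed_mk_iff (D : VDiagram) : (mk D).IsFramed ↔ D.FramedNormal := by
  constructor
  · rintro ⟨D', hmk, hD'⟩
    have hequiv : Relation.EqvGen Equivalent D' D := Quot.eqvGen_exact hmk
    have hiff : D'.FramedNormal ↔ D.FramedNormal := by
      clear hmk hD'
      induction hequiv with
      | rel _ _ h => exact h.framedNormal_iff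
      | refl => rfl
      | symm _ _ _ ih => exact ih.symm
      | trans _ _ _ _ _ ih ih' => exact ih.trans ih'
    exact hiff.1 hD'
  · exact fun h => ⟨D, rfl, h⟩

theorem mk_eq_of_iso {D D' : VDiagram} (h : Iso D D') : mk D = mk D' := Quot.sound (.iso h)

end IntegralOGraph

namespace VDiagram

/-- The edge of `D` starting at `x`, or its first part, after adding one more crossing. -/
def oldEdge {V : Type} (x : V × Bool) : (V ⊕ Unit) × Bool := (Sum.inl x.1, x.2)

/-- The edge starting at strand `b` of the additional crossing. -/
def newEdge {V : Type} (b : Bool) : (V ⊕ Unit) × Bool := (Sum.inr (), b)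

section Edges

variable {V : Type} (x y : V × Bool) (b b' : Bool)

@[simp]
theorem oldEdge_fst : (oldEdge x).1 = Sum.inl x.1 := rfl

@[simp]
theorem oldEdge_snd : (oldEdge x).2 = x.2 := rfl

@[simp]
theorem oldEdge_inj : oldEdge x = oldEdge y ↔ x = y := by
  simp [oldEdge, Prod.ext_iff]

@[simp]
theorem newEdge_inj : (newEdge b : (V ⊕ Unit) × Bool) = newEdge b' ↔ b = b' := by
  simp [newEdge]

@[simp]
theorem oldEdge_ne_newEdge : oldEdge x ≠ newEdge b := by
  simp [oldEdge, newEdge]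

@[simp]
theorem newEdge_ne_oldEdge : newEdge b ≠ oldEdge x :=
  (oldEdge_ne_newEdge x b).symm

end Edges

/-- `D'` arises from `D` by inserting a virtual crossing `ψ (Sum.inr ())`, with strand `b` inserted
into the edge `s b`; if both strands are inserted into the same edge, strand `c` comes first. -/
structure Refines (D D' : VDiagram) (ψ : D.V ⊕ Unit ≃ D'.V) (s : Bool → D.V × Bool) (c : Bool) :
    Prop where
  kind_inl : ∀ x, D'.kind (ψ (Sum.inl x)) = D.kind x
  kind_inr : D'.kind (ψ (Sum.inr ())) = 0
  undivided : ∀ x, x ≠ s true → x ≠ s false →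
    D'.next (Prod.map ψ id (oldEdge x)) = Prod.map ψ id (oldEdge (D.next x)) ∧
    D'.weight (Prod.map ψ id (oldEdge x)) = D.weight x
  divided_once : s true ≠ s false → ∀ b,
    D'.next (Prod.map ψ id (oldEdge (s b))) = Prod.map ψ id (newEdge b) ∧
    D'.next (Prod.map ψ id (newEdge b)) = Prod.map ψ id (oldEdge (D.next (s b))) ∧
    D'.weight (Prod.map ψ id (oldEdge (s b))) + D'.weight (Prod.map ψ id (newEdge b)) =
      D.weight (s b)
  divided_twice : s true = s false →
    D'.next (Prod.map ψ id (oldEdge (s c))) = Prod.map ψ id (newEdge c) ∧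
    D'.next (Prod.map ψ id (newEdge c)) = Prod.map ψ id (newEdge !c) ∧
    D'.next (Prod.map ψ id (newEdge !c)) = Prod.map ψ id (oldEdge (D.next (s c))) ∧
    D'.weight (Prod.map ψ id (oldEdge (s c))) + D'.weight (Prod.map ψ id (newEdge true)) +
      D'.weight (Prod.map ψ id (newEdge false)) = D.weight (s c)

section Insertion

variable {D D' : VDiagram} {ψ : D.V ⊕ Unit ≃ D'.V} {s : Bool → D.V × Bool} {c : Bool}

theorem mk_eq_of_splice (ψ : D.V ⊕ Unit ≃ D'.V) (s₁ : D.V × Bool) (s₂ : (D.V ⊕ Unit) × Bool)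
    (u₁ u₂ : ℤ) (hs₂ : s₂ ≠ newEdge false)
    (kind_inl : ∀ x, D'.kind (ψ (Sum.inl x)) = D.kind x) (kind_inr : D'.kind (ψ (Sum.inr ())) = 0)
    (edge_old : ∀ x : D.V × Bool,
      let E := (D.loops.splice (oldEdge s₁) (newEdge true) u₁).splice s₂ (newEdge false) u₂
      D'.next (Prod.map ψ id (oldEdge x)) = Prod.map ψ id (E.next (oldEdge x)) ∧
      D'.weight (Prod.map ψ id (oldEdge x)) = E.weight (oldEdge x))
    (edge_new : ∀ b,
      let E := (D.loops.splice (oldEdge s₁) (newEdge true) u₁).splice s₂ (newEdge false) u₂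
      D'.next (Prod.map ψ id (newEdge b)) = Prod.map ψ id (E.next (newEdge b)) ∧
      D'.weight (Prod.map ψ id (newEdge b)) = E.weight (newEdge b)) :
    IntegralOGraph.mk D = IntegralOGraph.mk D' := by
  refine (Quot.sound (Equivalent.insert D s₁ s₂ u₁ u₂ hs₂)).trans
    (IntegralOGraph.mk_eq_of_iso ?_)
  rw [insertVirtual_eq]
  refine ⟨ψ, Sum.rec kind_inl fun _ => kind_inr, ?_, ?_⟩
  · rintro (x | ⟨⟩) b
    exacts [(edge_old (x, b)).1, (edge_new b).1]
  · rintro (x | ⟨⟩) b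
    exacts [(edge_old (x, b)).2, (edge_new b).2]

@[simp]
theorem addLoops_oldEdge (x : D.V × Bool) : D.addLoops (oldEdge x) = oldEdge (D.next x) := rfl

@[simp]
theorem addLoops_newEdge (b : Bool) : D.addLoops (newEdge b) = newEdge b := rfl

theorem Refines.mk_eq_of_eq_false (h : Refines D D' ψ s false) (hs : s true = s false) :
    IntegralOGraph.mk D = IntegralOGraph.mk D' := by
  obtain ⟨hfirst, hsecond, hthird, hweight⟩ := h.divided_twice hs
  refine mk_eq_of_splice ψ (s false) (oldEdge (s false))
    (D'.weight (Prod.map ψ id (newEdge true))) (D'.weight (Prod.map ψ id (newEdge false))) (by simp)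
    h.kind_inl h.kind_inr (fun x => ?_) (Bool.forall_bool.2 ⟨?_, ?_⟩)
  · by_cases hx : x = s false
    · subst hx
      exact ⟨by simpa [Equiv.swap_apply_def] using hfirst,
        by simpa [eq_sub_iff_add_eq, add_right_comm] using hweight⟩
    · simp [Equiv.swap_apply_def, hx, h.undivided x (hs ▸ hx) hx]
  · exact ⟨by simpa using hsecond, by simp⟩
  · exact ⟨by simpa [Equiv.swap_apply_def] using hthird, by simp⟩

theorem Refines.mk_eq_of_eq_true (h : Refines D D' ψ s true) (hs : s true = s false) :
    IntegralOGraph.mk D = IntegralOGraph.mk D' := by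
  obtain ⟨hfirst, hsecond, hthird, hweight⟩ := h.divided_twice hs
  refine mk_eq_of_splice ψ (s true) (newEdge true)
    (D'.weight (Prod.map ψ id (newEdge true)) + D'.weight (Prod.map ψ id (newEdge false)))
    (D'.weight (Prod.map ψ id (newEdge false))) (by simp)
    h.kind_inl h.kind_inr (fun x => ?_) (Bool.forall_bool.2 ⟨?_, ?_⟩)
  · by_cases hx : x = s true
    · subst hx
      exact ⟨by simpa [Equiv.swap_apply_def] using hfirst, by simp [← hweight, add_assoc]⟩
    · simp [Equiv.swap_apply_def, hx, h.undivided x hx (hs ▸ hx)]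
  · exact ⟨by simpa using hthird, by simp⟩
  · exact ⟨by simpa [Equiv.swap_apply_def] using hsecond, by simp⟩

theorem Refines.mk_eq_of_ne (h : Refines D D' ψ s c) (hs : s true ≠ s false) :
    IntegralOGraph.mk D = IntegralOGraph.mk D' := by
  obtain ⟨hover, hover', hweight⟩ := h.divided_once hs true
  obtain ⟨hunder, hunder', hweight'⟩ := h.divided_once hs false
  refine mk_eq_of_splice ψ (s true) (oldEdge (s false))
    (D'.weight (Prod.map ψ id (newEdge true))) (D'.weight (Prod.map ψ id (newEdge false))) (by simp)
    h.kind_inl h.kind_inr (fun x => ?_) (Bool.forall_bool.2 ⟨?_, ?_⟩)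
  · by_cases hx : x = s true
    · subst hx
      simp [Equiv.swap_apply_def, update_apply, hs, hover, ← hweight]
    · by_cases hx' : x = s false
      · subst hx'
        simp [Equiv.swap_apply_def, hx, hunder, ← hweight']
      · simp [Equiv.swap_apply_def, update_apply, hx, hx', h.undivided x hx hx']
  · simp [Equiv.swap_apply_def, hs.symm, hunder']
  · simp [Equiv.swap_apply_def, update_apply, hover']

theorem Refines.mk_eq (h : Refines D D' ψ s c) : IntegralOGraph.mk D = IntegralOGraph.mk D' := by
  by_cases hs : s true = s false
  · cases c
    · exact h.mk_eq_of_eq_false hs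
    · exact h.mk_eq_of_eq_true hs
  · exact h.mk_eq_of_ne hs

/-- The same diagram with other weights. -/
abbrev withWeight (D : VDiagram) (w : D.V × Bool → ℤ) : VDiagram := { D with weight := w }

open Classical in
/-- Move the weight `u` along the strand `q`, from the incoming edge to the outgoing edge. -/
noncomputable def shift (D : VDiagram) (q : D.V × Bool) (u : ℤ) (w : D.V × Bool → ℤ) :
    D.V × Bool → ℤ :=
  fun x => w x + (if x = q then u else 0) - if D.next x = q then u else 0

open Classical in
/-- The weights which a diagram inherits when a virtual crossing is removed. -/
noncomputable def merge (ψ : D.V ⊕ Unit ≃ D'.V) (s : Bool → D.V × Bool) (w : D'.V × Bool → ℤ)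
    (x : D.V × Bool) : ℤ :=
  w (Prod.map ψ id (oldEdge x)) + ∑ b, if x = s b then w (Prod.map ψ id (newEdge b)) else 0

theorem Refines.withWeight (h : Refines D D' ψ s c) (w : D'.V × Bool → ℤ) :
    Refines (D.withWeight (merge ψ s w)) (D'.withWeight w) ψ s c where
  kind_inl := h.kind_inl
  kind_inr := h.kind_inr
  undivided x htrue hfalse := ⟨(h.undivided x htrue hfalse).1, by simp [merge, htrue, hfalse]⟩
  divided_once hs b := by
    refine ⟨(h.divided_once hs b).1, (h.divided_once hs b).2.1, ?_⟩
    cases b <;> simp [merge, hs, hs.symm]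
  divided_twice hs := by
    obtain ⟨hfirst, hsecond, hthird, -⟩ := h.divided_twice hs
    refine ⟨hfirst, hsecond, hthird, ?_⟩
    cases c <;> simp [merge, hs, add_assoc]

theorem Refines.merge_shift (h : Refines D D' ψ s c) (w : D'.V × Bool → ℤ) (b : Bool) (u : ℤ) :
    merge ψ s (D'.shift (Prod.map ψ id (newEdge b)) u w) = merge ψ s w := by
  have hinj : Injective (Prod.map ψ (id : Bool → Bool)) := ψ.injective.prodMap injective_id
  funext x
  by_cases hs : s true = s false
  · obtain ⟨hfirst, hsecond, hthird, -⟩ := h.divided_twice hs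
    by_cases hx : x = s false
    · subst hx
      cases c <;> cases b <;>
        simp_all [merge, shift, hinj.eq_iff] <;> ring
    · simp [merge, shift, hinj.eq_iff, hs, hx, h.undivided x (hs ▸ hx) hx]
  · by_cases hx : x = s true
    · subst hx
      cases b <;> simp [merge, shift, hinj.eq_iff, hs, h.divided_once hs true]
    · by_cases hx' : x = s false
      · subst hx'
        cases b <;> simp [merge, shift, hinj.eq_iff, hx, h.divided_once hs false]
      · simp [merge, shift, hinj.eq_iff, hx, hx', h.undivided x hx hx']

theorem Refines.shift_mk_eq (h : Refines D D' ψ s c) (w : D'.V × Bool → ℤ) (b : Bool) (u : ℤ) :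
    IntegralOGraph.mk (D'.withWeight (D'.shift (Prod.map ψ id (newEdge b)) u w)) =
      IntegralOGraph.mk (D'.withWeight w) := by
  rw [← (h.withWeight w).mk_eq, ← (h.withWeight (D'.shift _ u w)).mk_eq, h.merge_shift]

end Insertion

end VDiagram

/-! ### Tangles with three open strands -/

/-- Three strands, each given by the sequence of points of `P` through which it passes. -/
structure Code (P : Type) where
  first : Fin 3 → P
  rest : Fin 3 → List P

namespace Code

variable {P : Type}

/-- The last point of a strand. -/
def last (C : Code P) (j : Fin 3) : P := (C.rest j).getLastD (C.first j)

variable [DecidableEq P]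

/-- The entry of a list that follows the first occurrence of `p`. -/
def after (p : P) : List P → Option P
  | a :: b :: l => if a = p then some b else after p (b :: l)
  | _ => none

theorem infix_of_after {p q : P} : ∀ {l : List P}, after p l = some q → [p, q] <:+: l
  | [], h | [_], h => by simp [after] at h
  | a :: b :: l, h => by
    unfold after at h
    split_ifs at h with hap
    · obtain rfl : b = q := by simpa using h
      exact ⟨[], l, by simp [hap]⟩
    · exact (infix_of_after h).trans (List.suffix_cons a _).isInfix

/-- The point after `p`, or the strand which ends at `p`. -/
def next (C : Code P) (p : P) : P ⊕ Fin 3 :=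
  match [0, 1, 2].findSome? fun j => after p (C.first j :: C.rest j) with
  | some q => .inl q
  | none => .inr (if p = C.last 0 then 0 else if p = C.last 1 then 1 else 2)

/-- The point before `q`, or the strand which starts at `q`. -/
def back (C : Code P) (q : P) : P ⊕ Fin 3 :=
  match [0, 1, 2].findSome? fun j => after q (C.first j :: C.rest j).reverse with
  | some p => .inl p
  | none => .inr (if q = C.first 0 then 0 else if q = C.first 1 then 1 else 2)

theorem infix_of_next {C : Code P} {p q : P} (h : C.next p = .inl q) :
    ∃ j, [p, q] <:+: C.first j :: C.rest j := by
  unfold next at h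
  split at h
  · next hafter =>
    obtain ⟨j, -, hj⟩ := List.exists_of_findSome?_eq_some hafter
    cases h
    exact ⟨j, infix_of_after hj⟩
  · cases h

/-- Every point lies exactly once on the three strands. -/
structure Valid (C : Code P) : Prop where
  next_eq_inl_iff : ∀ p q, C.next p = .inl q ↔ C.back q = .inl p
  next_eq_inr_iff : ∀ p j, C.next p = .inr j ↔ p = C.last j
  back_eq_inr_iff : ∀ q j, C.back q = .inr j ↔ q = C.first j

instance [Fintype P] (C : Code P) : Decidable C.Valid :=
  decidable_of_iff ((∀ p q, C.next p = .inl q ↔ C.back q = .inl p) ∧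
      (∀ p j, C.next p = .inr j ↔ p = C.last j) ∧ ∀ q j, C.back q = .inr j ↔ q = C.first j)
    ⟨fun h => ⟨h.1, h.2.1, h.2.2⟩, fun h => ⟨h.1, h.2, h.3⟩⟩

section Join

variable {X : Type} {C : Code P}

/-- The incoming ends of the outside and of the strands. -/
def inn (C : Code P) : X ⊕ Fin 3 → P ⊕ X := Sum.elim .inr fun j => .inl (C.first j)

/-- The outgoing ends of the outside and of the strands. -/
def out (C : Code P) : X ⊕ Fin 3 → P ⊕ X := Sum.elim .inr fun j => .inl (C.last j)

theorem Valid.next_last (hC : C.Valid) (j : Fin 3) : C.next (C.last j) = .inr j :=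
  (hC.next_eq_inr_iff _ j).2 rfl

theorem Valid.back_first (hC : C.Valid) (j : Fin 3) : C.back (C.first j) = .inr j :=
  (hC.back_eq_inr_iff _ j).2 rfl

theorem Valid.out_injective (hC : C.Valid) : Injective (C.out : X ⊕ Fin 3 → P ⊕ X) := by
  rintro (x | j) (x' | j') h
  · exact congrArg _ (Sum.inr_injective h)
  · cases h
  · cases h
  · have hnext := congrArg C.next (Sum.inl_injective h : C.last j = C.last j')
    rw [hC.next_last, hC.next_last] at hnext
    exact congrArg _ (Sum.inr_injective hnext)

theorem Valid.eq_out_or_next (hC : C.Valid) (s : P ⊕ X) :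
    (∃ y, s = C.out y) ∨ ∃ p q, s = .inl p ∧ C.next p = .inl q := by
  rcases s with p | x
  · rcases hp : C.next p with q | j
    · exact .inr ⟨p, q, rfl, hp⟩
    · exact .inl ⟨.inr j, congrArg _ ((hC.next_eq_inr_iff p j).1 hp)⟩
  · exact .inl ⟨.inl x, rfl⟩

theorem Valid.eq_inn_or_back (hC : C.Valid) (s : P ⊕ X) :
    (∃ y, s = C.inn y) ∨ ∃ p q, s = .inl q ∧ C.back q = .inl p := by
  rcases s with q | x
  · rcases hq : C.back q with p | j
    · exact .inr ⟨p, q, rfl, hq⟩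
    · exact .inl ⟨.inr j, congrArg _ ((hC.back_eq_inr_iff q j).1 hq)⟩
  · exact .inl ⟨.inl x, rfl⟩

/-- The successor map after the ends of the strands have been joined by `link`. -/
def joinNext (C : Code P) (link : X ⊕ Fin 3 → X ⊕ Fin 3) : P ⊕ X → P ⊕ X :=
  Sum.elim (fun p => Sum.elim .inl (fun j => C.inn (link (.inr j))) (C.next p))
    fun x => C.inn (link (.inl x))

/-- The predecessor map after the beginnings of the strands have been joined by `link`. -/
def joinBack (C : Code P) (link : X ⊕ Fin 3 → X ⊕ Fin 3) : P ⊕ X → P ⊕ X :=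
  Sum.elim (fun q => Sum.elim .inl (fun j => C.out (link (.inr j))) (C.back q))
    fun x => C.out (link (.inl x))

variable (link : X ⊕ Fin 3 → X ⊕ Fin 3)

theorem joinNext_out (hC : C.Valid) (y : X ⊕ Fin 3) :
    C.joinNext link (C.out y) = C.inn (link y) := by
  rcases y with x | j
  · rfl
  · simp only [joinNext, out, Sum.elim_inr, Sum.elim_inl, hC.next_last]

theorem joinBack_inn (hC : C.Valid) (y : X ⊕ Fin 3) :
    C.joinBack link (C.inn y) = C.out (link y) := by
  rcases y with x | j
  · rfl
  · simp only [joinBack, inn, Sum.elim_inr, Sum.elim_inl, hC.back_first]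

theorem joinNext_inl {p q : P} (h : C.next p = .inl q) : C.joinNext link (.inl p) = .inl q := by
  simp only [joinNext, Sum.elim_inl, h]

theorem joinBack_inl {p q : P} (h : C.back q = .inl p) : C.joinBack link (.inl q) = .inl p := by
  simp only [joinBack, Sum.elim_inl, h]

/-- The successor permutation after the ends of the strands have been joined by `link`. -/
def join (C : Code P) (hC : C.Valid) (link : X ⊕ Fin 3 ≃ X ⊕ Fin 3) : P ⊕ X ≃ P ⊕ X where
  toFun := C.joinNext link
  invFun := C.joinBack link.symm
  left_inv s := by
    obtain ⟨y, rfl⟩ | ⟨p, q, rfl, hpq⟩ := hC.eq_out_or_next s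
    · rw [joinNext_out _ hC, joinBack_inn _ hC, Equiv.symm_apply_apply]
    · rw [joinNext_inl _ hpq, joinBack_inl _ ((hC.next_eq_inl_iff p q).1 hpq)]
  right_inv s := by
    obtain ⟨y, rfl⟩ | ⟨p, q, rfl, hpq⟩ := hC.eq_inn_or_back s
    · rw [joinBack_inn _ hC, joinNext_out _ hC, Equiv.apply_symm_apply]
    · rw [joinBack_inl _ hpq, joinNext_inl _ ((hC.next_eq_inl_iff p q).2 hpq)]

/-- The weights after the strands have been joined by `link`: `wt` is the weight after a point,
`win` that before the beginning of a strand, and `w` that of the outside. -/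
def joinWt (C : Code P) (link : X ⊕ Fin 3 ≃ X ⊕ Fin 3) (wt : P → ℤ) (win : Fin 3 → ℤ)
    (w : X ⊕ Fin 3 → ℤ) : P ⊕ X → ℤ :=
  Sum.elim (fun p => wt p + Sum.elim (fun _ => 0)
      (fun j => w (.inr j) + Sum.elim (fun _ => 0) win (link (.inr j))) (C.next p))
    fun x => w (.inl x) + Sum.elim (fun _ => 0) win (link (.inl x))

end Join

section JoinLemmas

variable {X : Type} {C : Code P} (hC : C.Valid) (link : X ⊕ Fin 3 ≃ X ⊕ Fin 3)

theorem join_out (y : X ⊕ Fin 3) : C.join hC link (C.out y) = C.inn (link y) :=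
  joinNext_out link hC y

theorem join_inl {p q : P} (h : C.next p = .inl q) : C.join hC link (.inl p) = .inl q :=
  joinNext_inl link h

theorem join_symm_inn (y : X ⊕ Fin 3) :
    (C.join hC link).symm (C.inn y) = C.out (link.symm y) :=
  joinBack_inn link.symm hC y

theorem join_symm_inl {p q : P} (h : C.back q = .inl p) :
    (C.join hC link).symm (.inl q) = .inl p :=
  joinBack_inl link.symm h

variable (wt : P → ℤ) (win : Fin 3 → ℤ) (w : X ⊕ Fin 3 → ℤ)

include hC in
theorem joinWt_out (y : X ⊕ Fin 3) : C.joinWt link wt win w (C.out y) =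
    w y + Sum.elim (fun _ => 0) (fun j => wt (C.last j)) y +
      Sum.elim (fun _ => 0) win (link y) := by
  rcases y with x | j
  · simp [out, joinWt]
  · simp only [out, joinWt, Sum.elim_inr, Sum.elim_inl, hC.next_last]
    ring

theorem joinWt_inl {p q : P} (h : C.next p = .inl q) :
    C.joinWt link wt win w (.inl p) = wt p := by
  simp [joinWt, h]

end JoinLemmas

end Code

/-- A passage through one of `n` crossings, over (`true`) or under (`false`). -/
abbrev Passage (n : ℕ) : Type := Fin n × Bool

/-- A weighted tangle with three open strands. `win j` is the weight of the open edge at the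
beginning of strand `j`, and `wt p` is the weight of the edge after the passage `p`. -/
structure Tangle (n : ℕ) extends Code (Passage n) where
  sign : Fin n → SignType
  wt : Passage n → ℤ
  win : Fin 3 → ℤ

namespace Tangle

variable {n : ℕ}

section Closure

/-- The diagram obtained by gluing a tangle to an outside. -/
def closure (T : Tangle n) (h : T.Valid) (O : Outside) : VDiagram :=
  haveI := O.fin
  { V := Fin n ⊕ O.W
    kind := Sum.elim T.sign O.kind
    next := (Equiv.sumProdDistrib (Fin n) O.W Bool).trans
      ((T.join h O.link).trans (Equiv.sumProdDistrib (Fin n) O.W Bool).symm)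
    weight := fun s =>
      T.joinWt O.link T.wt T.win O.weight (Equiv.sumProdDistrib (Fin n) O.W Bool s) }

variable (T : Tangle n) (h : T.Valid) (O : Outside)

/-- The crossings of the closure. -/
def vert : Fin n ⊕ O.W ≃ (T.closure h O).V := Equiv.refl _

/-- The ends at the crossings of the closure. -/
def port : Passage n ⊕ (O.W × Bool) ≃ (T.closure h O).V × Bool :=
  (Equiv.sumProdDistrib (Fin n) O.W Bool).symm

theorem next_port (s : Passage n ⊕ (O.W × Bool)) :
    (T.closure h O).next (T.port h O s) = T.port h O (T.join h O.link s) := by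
  rcases s with s | s <;> rfl

theorem symm_port (s : Passage n ⊕ (O.W × Bool)) :
    (T.closure h O).next.symm (T.port h O s) = T.port h O ((T.join h O.link).symm s) := by
  rw [Equiv.symm_apply_eq, next_port, Equiv.apply_symm_apply]

theorem weight_port (s : Passage n ⊕ (O.W × Bool)) :
    (T.closure h O).weight (T.port h O s) = T.joinWt O.link T.wt T.win O.weight s := by
  rcases s with s | s <;> rfl

end Closure

/-! ### Lines inside a tangle -/

/-- A line along an edge of a closure which meets the tangle: `Sum.inl p` is the edge after the
passage `p`, and `Sum.inr j` is the edge at the beginning of strand `j`. -/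
abbrev Line (n : ℕ) : Type := (Passage n ⊕ Fin 3) × Fin 3

section Trace

variable (T : Tangle n)

/-- The line on which one leaves the crossing after arriving at an end. -/
def step (a : Passage n × Fin 3) : Line n :=
  let c := VDiagram.corner (T.sign a.1.1) a.1.2 a.2
  (if c.2 = 2 then T.back (a.1.1, c.1) else .inl (a.1.1, c.1), c.2)

/-- The end of the tangle at which a line arrives. -/
def arrive (g : Line n) : Option (Passage n × Fin 3) :=
  match g.1 with
  | .inl p => if g.2 = 2 then some (p, 2) else
      match T.next p with
      | .inl q => some (q, g.2)
      | .inr _ => none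
  | .inr j => if g.2 = 2 then none else some (T.first j, g.2)

/-- Twice the contribution of the weights of the tangle along a line. -/
def val (g : Line n) : ℤ :=
  2 * if g.2 = 2 then -Sum.elim T.wt T.win g.1 else Sum.elim T.wt T.win g.1

/-- Follow the boundary of a `2`-cell until it leaves the tangle or reaches a line in `halt`. The
result is the last line and twice the rotation number before it. The natural number bounds the
number of steps. -/
def trace (halt : Line n → Bool) : ℕ → Passage n × Fin 3 → Option (Line n × ℤ)
  | 0, _ => none
  | k + 1, a =>
    if halt (T.step a) then some (T.step a, VDiagram.turn2 a.2 (T.step a).2) else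
      match T.arrive (T.step a) with
      | none => some (T.step a, VDiagram.turn2 a.2 (T.step a).2)
      | some a' => (trace halt k a').map fun r =>
          (r.1, VDiagram.turn2 a.2 (T.step a).2 + T.val (T.step a) + r.2)

/-- The strand at whose end a line leaves the tangle, and the number of the line. -/
def label (g : Line n) : Fin 3 × Fin 3 :=
  (match g.1 with
    | .inl p => match T.next p with
      | .inl _ => 0
      | .inr j => j
    | .inr j => j, g.2)

/-- The line along which one leaves the tangle, given by a strand and the number of the line. -/
def exit (x : Fin 3 × Fin 3) : Line n := (if x.2 = 2 then .inr x.1 else .inl (T.last x.1), x.2)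

/-- The line along which one enters the tangle, given by a strand and the number of the line. -/
def entry (x : Fin 3 × Fin 3) : Line n := (if x.2 = 2 then .inl (T.last x.1) else .inr x.1, x.2)

/-- The end of the tangle at which one arrives along `entry x`. -/
def entryEnd (x : Fin 3 × Fin 3) : Passage n × Fin 3 :=
  (if x.2 = 2 then T.last x.1 else T.first x.1, x.2)

variable {T}

theorem exists_next_of_arrive_step (h : T.Valid) {a a' : Passage n × Fin 3}
    (ha : T.arrive (T.step a) = some a') :
    ∃ p q, (T.step a).1 = .inl p ∧ T.next p = .inl q := by
  by_cases hc : (VDiagram.corner (T.sign a.1.1) a.1.2 a.2).2 = 2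
  · rcases hback : T.back (a.1.1, (VDiagram.corner (T.sign a.1.1) a.1.2 a.2).1) with p | j
    · exact ⟨p, _, by simp only [step, hc, if_true, hback], (h.next_eq_inl_iff _ _).2 hback⟩
    · simp [step, arrive, hc, hback] at ha
  · rcases hnext : T.next (a.1.1, (VDiagram.corner (T.sign a.1.1) a.1.2 a.2).1) with q | j
    · exact ⟨_, q, by simp only [step, hc, if_false], hnext⟩
    · simp [step, arrive, hc, hnext] at ha

theorem eq_exit_of_arrive_eq_none (h : T.Valid) {g : Line n} (hg : T.arrive g = none) :
    g = T.exit (T.label g) := by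
  obtain ⟨p | j, l⟩ := g
  · simp only [arrive] at hg
    split_ifs at hg with hl
    split at hg
    · cases hg
    · next j hj =>
      obtain rfl := (h.next_eq_inr_iff p j).1 hj
      simp [label, exit, hl, h.next_last]
  · obtain rfl : l = 2 := by simpa [arrive] using hg
    rfl

theorem halt_or_eq_exit_of_trace (h : T.Valid) {halt : Line n → Bool} {k : ℕ} :
    ∀ {a : Passage n × Fin 3} {g : Line n} {s : ℤ}, T.trace halt k a = some (g, s) →
      halt g = true ∨ g = T.exit (T.label g) := by
  induction k with
  | zero => simp [trace]
  | succ k ih =>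
    intro a g s hs
    unfold trace at hs
    split_ifs at hs with hhalt
    · cases hs
      exact .inl hhalt
    · split at hs
      · next harrive =>
        cases hs
        exact .inr (eq_exit_of_arrive_eq_none h harrive)
      · simp only [Option.map_eq_some_iff] at hs
        obtain ⟨r, hr, hrs⟩ := hs
        cases hrs
        exact ih hr

end Trace

end Tangle

namespace VDiagram

/-- After `m` steps along the boundary of a `2`-cell one comes from `z` to `z'`, the lines strictly
in between satisfy `P`, and twice the rotation number of the lines before `z'` is `r`. -/
structure IsPath (D : VDiagram) (P : D.Germ → Prop) (z z' : D.Germ) (m : ℕ) (r : ℤ) : Prop where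
  pos : 0 < m
  iterate_eq : D.succ^[m] z = z'
  inner : ∀ i, 0 < i → i < m → P (D.succ^[i] z)
  birkhoffSum_eq : birkhoffSum D.succ D.rot2 m z = r

namespace IsPath

variable {D : VDiagram} {P : D.Germ → Prop} {z z' : D.Germ} {m : ℕ} {r : ℤ}

theorem single (D : VDiagram) (P : D.Germ → Prop) (z : D.Germ) :
    D.IsPath P z (D.succ z) 1 (D.rot2 z) :=
  ⟨one_pos, rfl, fun i _ _ => by omega, birkhoffSum_one ..⟩

theorem cons (hP : P (D.succ z)) (h : D.IsPath P (D.succ z) z' m r) :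
    D.IsPath P z z' (m + 1) (D.rot2 z + r) where
  pos := m.succ_pos
  iterate_eq := h.iterate_eq
  inner i hi him := by
    obtain ⟨i, rfl⟩ := Nat.exists_eq_succ_of_ne_zero hi.ne'
    rcases Nat.eq_zero_or_pos i with rfl | hi
    · exact hP
    · exact h.inner i hi (by omega)
  birkhoffSum_eq := by rw [birkhoffSum_succ', h.birkhoffSum_eq]

theorem cycleSum_eq (h : D.IsPath (· ≠ z) z z m r) : cycleSum D.succ D.rot2 z = r := by
  have hperiod : minimalPeriod D.succ z = m := by
    refine le_antisymm (IsPeriodicPt.minimalPeriod_le h.pos h.iterate_eq) (not_lt.1 fun hlt => ?_)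
    exact h.inner _ (minimalPeriod_pos_of_mem_periodicPts (mem_periodicPts_succ _ _)) hlt
      iterate_minimalPeriod
  rw [cycleSum, hperiod, h.birkhoffSum_eq]

end IsPath

end VDiagram

namespace Tangle

variable {n : ℕ} {T : Tangle n} (h : T.Valid) (O : Outside)

/-- The edges of the closure which meet the tangle. -/
def edge : Passage n ⊕ Fin 3 → (T.closure h O).V × Bool :=
  Sum.elim (fun p => T.port h O (.inl p)) fun j => T.port h O (T.out (O.link.symm (.inr j)))

theorem edge_inl (p : Passage n) : edge h O (.inl p) = T.port h O (.inl p) := rfl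

theorem edge_inr (j : Fin 3) :
    edge h O (.inr j) = T.port h O (T.out (O.link.symm (.inr j))) := rfl

/-- The lines of the closure along edges which meet the tangle. -/
def line (g : Line n) : (T.closure h O).Germ := (edge h O g.1, g.2)

theorem next_edge_inr (j : Fin 3) :
    (T.closure h O).next (edge h O (.inr j)) = T.port h O (.inl (T.first j)) := by
  simp only [edge, Sum.elim_inr, next_port, Code.join_out, Equiv.apply_symm_apply]
  rfl

theorem symm_port_inl (p : Passage n) :
    (T.closure h O).next.symm (T.port h O (.inl p)) = edge h O (T.back p) := by
  rcases hback : T.back p with q | j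
  · rw [symm_port, Code.join_symm_inl h _ hback]
    rfl
  · rw [Equiv.symm_apply_eq, next_edge_inr, (h.back_eq_inr_iff p j).1 hback]

theorem arrival_line {g : Line n} {a : Passage n × Fin 3} (ha : T.arrive g = some a) :
    (T.closure h O).arrival (line h O g) = (T.port h O (.inl a.1), a.2) := by
  obtain ⟨e | j, l⟩ := g
  · simp only [arrive] at ha
    split_ifs at ha with hl
    · cases ha
      simp [VDiagram.arrival, line, hl, edge]
    · split at ha
      · next q hq =>
        cases ha
        simp [VDiagram.arrival, line, hl, edge, next_port, Code.join_inl h _ hq]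
      · cases ha
  · simp only [arrive] at ha
    split_ifs at ha with hl
    cases ha
    simp [VDiagram.arrival, line, hl, next_edge_inr]

theorem depart_port_inl (a : Passage n × Fin 3) :
    (T.closure h O).depart (T.port h O (.inl a.1), a.2) = line h O (T.step a) := by
  let c := VDiagram.corner (T.sign a.1.1) a.1.2 a.2
  refine Prod.ext ?_ rfl
  change (if c.2 = 2 then (T.closure h O).next.symm (T.port h O (.inl (a.1.1, c.1)))
      else edge h O (.inl (a.1.1, c.1))) =
    edge h O (if c.2 = 2 then T.back (a.1.1, c.1) else .inl (a.1.1, c.1))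
  rw [symm_port_inl, apply_ite (edge h O)]

theorem two_mul_along_line {p q : Passage n} (hp : T.next p = .inl q) (l : Fin 3) :
    2 * (T.closure h O).along (line h O (.inl p, l)) = T.val (.inl p, l) := by
  simp only [VDiagram.along, line, edge, Sum.elim_inl, weight_port, Code.joinWt_inl _ _ _ _ hp,
    val]

theorem exists_isPath_of_trace {halt : Line n → Bool} {P : (T.closure h O).Germ → Prop}
    (hP : ∀ p q l, T.next p = .inl q → halt (.inl p, l) = false → P (line h O (.inl p, l)))
    {k : ℕ} : ∀ {a : Passage n × Fin 3} {g : Line n} {s : ℤ}, T.trace halt k a = some (g, s) →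
      ∀ z : (T.closure h O).Germ, (T.closure h O).arrival z = (T.port h O (.inl a.1), a.2) →
        ∃ m, (T.closure h O).IsPath P z (line h O g) m (2 * (T.closure h O).along z + s) := by
  induction k with
  | zero => simp [trace]
  | succ k ih =>
    intro a g s hs z hz
    have hsucc : (T.closure h O).succ z = line h O (T.step a) := by
      rw [VDiagram.succ_eq, hz, depart_port_inl]
    have hrot : (T.closure h O).rot2 z =
        2 * (T.closure h O).along z + VDiagram.turn2 a.2 (T.step a).2 := by
      rw [VDiagram.rot2, hsucc, show z.2 = a.2 from congrArg Prod.snd hz]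
      rfl
    have hsingle := VDiagram.IsPath.single _ P z
    rw [hsucc, hrot] at hsingle
    unfold trace at hs
    split_ifs at hs with hhalt
    · cases hs
      exact ⟨1, hsingle⟩
    · split at hs
      · cases hs
        exact ⟨1, hsingle⟩
      · next a' harrive =>
        simp only [Option.map_eq_some_iff] at hs
        obtain ⟨r, hr, hrs⟩ := hs
        cases hrs
        obtain ⟨m, hm⟩ := ih hr (line h O (T.step a)) (arrival_line h O harrive)
        obtain ⟨p, q, hp, hpq⟩ := exists_next_of_arrive_step h harrive
        have hstep : T.step a = (.inl p, (T.step a).2) := Prod.ext hp rfl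
        rw [← hsucc] at hm
        have hcons := hm.cons (by
          rw [hsucc, hstep]
          exact hP p q _ hpq (by rw [← hstep]; simpa using hhalt))
        refine ⟨m + 1, ?_⟩
        convert hcons using 1
        rw [hrot, hsucc, hstep, two_mul_along_line h O hpq]
        ring

end Tangle

namespace Outside

/-- An end of an outside: an end at one of its crossings, or an end of a strand of the tangle. -/
abbrev End (O : Outside) : Type := (O.W × Bool) ⊕ Fin 3

/-- A line along an edge of a closure that starts at an outgoing end of the outside or of a
strand. -/
abbrev Line (O : Outside) : Type := O.End × Fin 3

variable (O : Outside)

/-- The end at which a line arrives. -/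
def arrive (y : O.Line) : O.End := if y.2 = 2 then y.1 else O.link y.1

/-- The line number `l` that starts at the end `z`. -/
def depart (z : O.End) (l : Fin 3) : O.Line := (if l = 2 then O.link.symm z else z, l)

/-- The end from which a line starts. -/
def start (y : O.Line) : O.End := if y.2 = 2 then O.link y.1 else y.1

theorem start_depart (z : O.End) (l : Fin 3) : O.start (O.depart z l) = z := by
  unfold start depart
  by_cases hl : l = 2 <;> simp [hl]

/-- The contribution of the weight of the outside along a line. -/
def along (y : O.Line) : ℤ := if y.2 = 2 then -O.weight y.1 else O.weight y.1

variable (F : Fin 3 × Fin 3 → (Fin 3 × Fin 3) × ℤ)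

/-- The first return map to the lines of the outside, where `F` describes the passage through the
tangle: the strand and the line along which one leaves it, and twice the rotation number. -/
def succ (y : O.Line) : O.Line :=
  match O.arrive y with
  | .inl x =>
    let c := VDiagram.corner (O.kind x.1) x.2 y.2
    O.depart (.inl (x.1, c.1)) c.2
  | .inr j => O.depart (.inr (F (j, y.2)).1.1) (F (j, y.2)).1.2

/-- Twice the rotation number until the return to the outside of the tangle. -/
def rot2 (y : O.Line) : ℤ :=
  2 * O.along y +
    match O.arrive y with
    | .inl x => VDiagram.turn2 y.2 (VDiagram.corner (O.kind x.1) x.2 y.2).2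
    | .inr j => (F (j, y.2)).2

end Outside

/-! ### Transfer of framings between tangles -/

namespace Tangle

variable {n : ℕ}

section Outer

variable {T : Tangle n} (h : T.Valid) (O : Outside)

/-- A line of the closure along an edge which is not an inner edge of the tangle. -/
def outer (y : O.Line) : (T.closure h O).Germ := (T.port h O (T.out y.1), y.2)

theorem outer_injective : Injective (outer h O) := by
  rintro ⟨y, l⟩ ⟨y', l'⟩ hyy'
  obtain ⟨hport, hl⟩ := Prod.mk.inj hyy'
  exact Prod.ext (h.out_injective ((T.port h O).injective hport)) hl

theorem line_notMem_range_outer {p q : Passage n} (hp : T.next p = .inl q) (l : Fin 3) :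
    line h O (.inl p, l) ∉ Set.range (outer h O) := by
  rintro ⟨⟨x | j, l'⟩, hy⟩
  · cases (T.port h O).injective (congrArg Prod.fst hy)
  · have hlast : T.last j = p :=
      Sum.inl_injective ((T.port h O).injective (congrArg Prod.fst hy))
    rw [← hlast, h.next_last] at hp
    cases hp

theorem line_exit (x : Fin 3 × Fin 3) :
    line h O (T.exit x) = outer h O (O.depart (.inr x.1) x.2) := by
  unfold line exit outer Outside.depart
  split_ifs <;> rfl

theorem depart_port_inr (x : O.W × Bool) (l : Fin 3) :
    (T.closure h O).depart (T.port h O (.inr x), l) =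
      outer h O (O.depart (.inl (x.1, (VDiagram.corner (O.kind x.1) x.2 l).1))
        (VDiagram.corner (O.kind x.1) x.2 l).2) := by
  let c := VDiagram.corner (O.kind x.1) x.2 l
  refine Prod.ext ?_ rfl
  change (if c.2 = 2 then (T.closure h O).next.symm (T.port h O (T.inn (.inl (x.1, c.1))))
      else T.port h O (T.out (.inl (x.1, c.1)))) =
    T.port h O (T.out (if c.2 = 2 then O.link.symm (.inl (x.1, c.1)) else .inl (x.1, c.1)))
  rw [symm_port, Code.join_symm_inn, apply_ite T.out, apply_ite (T.port h O)]

theorem arrival_outer (y : O.Line) :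
    (T.closure h O).arrival (outer h O y) = match O.arrive y with
      | .inl x => (T.port h O (.inr x), y.2)
      | .inr j => (T.port h O (.inl (T.entryEnd (j, y.2)).1), y.2) := by
  obtain ⟨y, l⟩ := y
  simp only [VDiagram.arrival, outer, Outside.arrive, entryEnd]
  by_cases hl : l = 2
  · simp only [hl, if_true]
    rcases y with x | j <;> rfl
  · simp only [hl, if_false, next_port, Code.join_out]
    rcases O.link y with x | j <;> rfl

/-- Twice the contribution of the weight of the tangle at the beginning of a line. -/
def potential (T : Tangle n) (O : Outside) (y : O.Line) : ℤ :=
  Sum.elim (fun _ => 0) (fun j => T.val (T.exit (j, y.2))) (O.start y)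

theorem two_mul_along_outer (y : O.Line) :
    2 * (T.closure h O).along (outer h O y) = 2 * O.along y + T.potential O y +
      Sum.elim (fun _ => 0) (fun j => T.val (T.entry (j, y.2))) (O.arrive y) := by
  obtain ⟨y, l⟩ := y
  simp only [VDiagram.along, outer, weight_port, Code.joinWt_out h, potential, Outside.along,
    Outside.start, Outside.arrive]
  by_cases hl : l = 2
  all_goals
    simp only [hl, if_true, if_false, val, exit, entry]
    rcases y with x | j <;> rcases O.link _ with x' | j' <;> simp <;> ring

end Outer

/-- How one leaves the tangle after entering it along a line, and twice the rotation number in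
between, including both open edges. It is `none` if more than `32` steps are needed. -/
def through (T : Tangle n) (x : Fin 3 × Fin 3) : Option ((Fin 3 × Fin 3) × ℤ) :=
  (T.trace (fun _ => false) 32 (T.entryEnd x)).map fun r =>
    (T.label r.1, T.val (T.entry x) + r.2 + T.val r.1)

section FirstReturn

variable {T : Tangle n} {F : Fin 3 × Fin 3 → (Fin 3 × Fin 3) × ℤ} (h : T.Valid) (O : Outside)

theorem exists_isPath_outer_of_arrive_eq_inl {y : O.Line} {x : O.W × Bool}
    (hy : O.arrive y = .inl x) :
    ∃ m, (T.closure h O).IsPath (· ∉ Set.range (outer h O)) (outer h O y)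
      (outer h O (O.succ F y)) m
      (O.rot2 F y + (-T.potential O (O.succ F y) - -T.potential O y)) := by
  have harrival := arrival_outer h O y
  have halong := two_mul_along_outer h O y
  rw [hy] at harrival halong
  have hsucc : (T.closure h O).succ (outer h O y) = outer h O (O.succ F y) := by
    rw [VDiagram.succ_eq, harrival, depart_port_inr, Outside.succ, hy]
  have hpath := VDiagram.IsPath.single _ (· ∉ Set.range (outer h O)) (outer h O y)
  rw [VDiagram.rot2, hsucc, halong] at hpath
  refine ⟨1, ?_⟩
  convert hpath using 1
  simp only [Outside.succ, Outside.rot2, hy, potential, Outside.start_depart, Sum.elim_inl]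
  simp only [outer, Outside.depart]
  ring

theorem exists_isPath_outer_of_arrive_eq_inr (hF : ∀ x, T.through x = some (F x)) {y : O.Line}
    {j : Fin 3} (hy : O.arrive y = .inr j) :
    ∃ m, (T.closure h O).IsPath (· ∉ Set.range (outer h O)) (outer h O y)
      (outer h O (O.succ F y)) m
      (O.rot2 F y + (-T.potential O (O.succ F y) - -T.potential O y)) := by
  have harrival := arrival_outer h O y
  have halong := two_mul_along_outer h O y
  rw [hy] at harrival halong
  have hthrough := hF (j, y.2)
  simp only [through, Option.map_eq_some_iff] at hthrough
  obtain ⟨⟨g, s⟩, htrace, hgs⟩ := hthrough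
  have hexit : g = T.exit (F (j, y.2)).1 := by
    rw [← hgs]
    exact (halt_or_eq_exit_of_trace h htrace).resolve_left Bool.false_ne_true
  obtain ⟨m, hpath⟩ := exists_isPath_of_trace h O
    (P := (· ∉ Set.range (outer h O))) (fun p q l hpq _ => line_notMem_range_outer h O hpq l)
    htrace _ harrival
  refine ⟨m, ?_⟩
  convert hpath using 1
  · rw [hexit, line_exit, Outside.succ, hy]
  · have hval : T.val (T.exit ((F (j, y.2)).1.1, (F (j, y.2)).1.2)) = T.val g := by rw [hexit]
    rw [halong]
    simp only [Outside.succ, Outside.rot2, hy, potential, Outside.start_depart, Sum.elim_inr]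
    simp only [Outside.depart, hval]
    rw [← hgs]
    ring

theorem exists_isPath_outer (hF : ∀ x, T.through x = some (F x)) (y : O.Line) :
    ∃ m, (T.closure h O).IsPath (· ∉ Set.range (outer h O)) (outer h O y)
      (outer h O (O.succ F y)) m
      (O.rot2 F y + (-T.potential O (O.succ F y) - -T.potential O y)) := by
  rcases hy : O.arrive y with x | j
  · exact exists_isPath_outer_of_arrive_eq_inl h O hy
  · exact exists_isPath_outer_of_arrive_eq_inr h O hF hy

theorem cycleSum_outer (hF : ∀ x, T.through x = some (F x)) (y : O.Line) :
    cycleSum (T.closure h O).succ (T.closure h O).rot2 (outer h O y) =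
      cycleSum (O.succ F) (O.rot2 F) y := by
  have := O.fin
  choose time hpath using exists_isPath_outer h O hF
  have hreturn : IsFirstReturn (T.closure h O).succ (O.succ F) (outer h O) time :=
    ⟨outer_injective h O, fun y => (hpath y).pos, fun y => (hpath y).iterate_eq,
      fun y => (hpath y).inner⟩
  have hinjective := hreturn.map_injective (T.closure h O).succ_injective
  rw [hreturn.cycleSum_eq _ (hinjective.mem_periodicPts y)]
  simp only [(hpath _).birkhoffSum_eq]
  exact cycleSum_add_coboundary (O.succ F) (O.rot2 F) (fun y => -T.potential O y) y

end FirstReturn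

/-- Follow the line along an inner edge until one returns or leaves the tangle. -/
def loop (T : Tangle n) (p : Passage n) (l : Fin 3) : Option (Line n × ℤ) :=
  (T.arrive (.inl p, l)).bind (T.trace (fun g => g = (.inl p, l)) 32)

/-- The rotation number along each `2`-cell contained in the tangle is `-1`. -/
abbrev LoopsFramed (T : Tangle n) : Prop := ∀ p l, (T.next p).isLeft → (T.loop p l).isSome ∧
  ∀ r ∈ T.loop p l, r.1 = (.inl p, l) → T.val r.1 + r.2 = -2

theorem cycleSum_line {T : Tangle n} (h : T.Valid) (O : Outside) (hloops : T.LoopsFramed)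
    (houter : ∀ y, cycleSum (T.closure h O).succ (T.closure h O).rot2 (outer h O y) = -2)
    {p q : Passage n} (hpq : T.next p = .inl q) (l : Fin 3) :
    cycleSum (T.closure h O).succ (T.closure h O).rot2 (line h O (.inl p, l)) = -2 := by
  obtain ⟨hsome, hframed⟩ := hloops p l (by rw [hpq]; rfl)
  obtain ⟨⟨g, s⟩, hr⟩ := Option.isSome_iff_exists.1 hsome
  have hframed := hframed _ hr
  obtain ⟨a, harrive, htrace⟩ := Option.bind_eq_some_iff.1 hr
  have harrival := arrival_line h O harrive
  by_cases hg : g = (.inl p, l)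
  · obtain ⟨m, hpath⟩ := exists_isPath_of_trace h O (P := (· ≠ line h O (.inl p, l)))
      (fun p' q' l' _ hhalt heq => by
        obtain ⟨hport, hl⟩ := Prod.mk.inj heq
        have hp : p' = p := Sum.inl_injective ((T.port h O).injective hport)
        simp [hp, show l' = l from hl] at hhalt) htrace _ harrival
    rw [hg] at hpath
    rw [hpath.cycleSum_eq, two_mul_along_line h O hpq, ← hg]
    exact hframed hg
  · have hexit : g = T.exit (T.label g) :=
      (halt_or_eq_exit_of_trace h htrace).resolve_left (by simpa using hg)
    obtain ⟨m, hpath⟩ := exists_isPath_of_trace h O (P := fun _ => True)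
      (fun _ _ _ _ _ => trivial) htrace _ harrival
    rw [← cycleSum_iterate _ (fun _ => VDiagram.mem_periodicPts_succ _ _) _ m, hpath.iterate_eq,
      hexit, line_exit, houter]

/-- A condition under which the replacement of the tangle `T` by `T'` preserves framings: the
lines pass through the two tangles in the same way and with the same rotation numbers, and the
`2`-cells contained in `T'` are framed. -/
structure Similar {n' : ℕ} (T : Tangle n) (T' : Tangle n') : Prop where
  isSome_through : ∀ x, (T.through x).isSome
  through_eq : ∀ x, T.through x = T'.through x
  loopsFramed : T'.LoopsFramed
  sign_ne_zero : ∀ i, T'.sign i ≠ 0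

namespace Similar

variable {n' : ℕ} {T : Tangle n} {T' : Tangle n'}

instance : Decidable (T.Similar T') :=
  decidable_of_iff ((∀ x, (T.through x).isSome) ∧ (∀ x, T.through x = T'.through x) ∧
      T'.LoopsFramed ∧ ∀ i, T'.sign i ≠ 0)
    ⟨fun h => ⟨h.1, h.2.1, h.2.2.1, h.2.2.2⟩, fun h => ⟨h.1, h.2, h.3, h.4⟩⟩

variable (hs : T.Similar T') (h : T.Valid) (h' : T'.Valid) {O : Outside}

include hs

theorem framed (hT : (T.closure h O).Framed) : (T'.closure h' O).Framed := by
  rw [VDiagram.framed_iff] at hT ⊢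
  have hF x : T.through x = some ((T.through x).get (hs.isSome_through x)) := by simp
  have hF' x : T'.through x = some ((T.through x).get (hs.isSome_through x)) :=
    (hs.through_eq x).symm.trans (hF x)
  have houter y :
      cycleSum (T'.closure h' O).succ (T'.closure h' O).rot2 (outer h' O y) = -2 := by
    rw [cycleSum_outer h' O hF' y, ← cycleSum_outer h O hF y, hT]
  rintro ⟨s, l⟩
  obtain ⟨s, rfl⟩ := (T'.port h' O).surjective s
  obtain ⟨y, rfl⟩ | ⟨p, q, rfl, hpq⟩ := h'.eq_out_or_next s
  · exact houter (y, l)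
  · exact cycleSum_line h' O hs.loopsFramed houter hpq l

theorem exists_kind_ne_zero {m : ℕ} : ∀ {x : O.W × Bool},
    (T.closure h O).kind ((T.closure h O).next^[m] (T.port h O (.inr x))).1 ≠ 0 →
      ∃ m', (T'.closure h' O).kind
        ((T'.closure h' O).next^[m'] (T'.port h' O (.inr x))).1 ≠ 0 := by
  induction m with
  | zero => exact fun hx => ⟨0, hx⟩
  | succ m ih =>
    intro x hx
    have hnext : (T.closure h O).next (T.port h O (.inr x)) =
      T.port h O (T.inn (O.link (.inl x))) := next_port ..
    have hnext' : (T'.closure h' O).next (T'.port h' O (.inr x)) =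
      T'.port h' O (T'.inn (O.link (.inl x))) := next_port ..
    rw [iterate_succ_apply, hnext] at hx
    rcases hlink : O.link (.inl x) with x' | j
    · rw [hlink] at hx hnext'
      obtain ⟨m', hm'⟩ := ih hx
      refine ⟨m' + 1, ?_⟩
      rw [iterate_succ_apply, hnext']
      exact hm'
    · refine ⟨1, ?_⟩
      rw [iterate_one, hnext', hlink]
      exact hs.sign_ne_zero _

theorem noFreeCircle (hT : (T.closure h O).NoFreeCircle) : (T'.closure h' O).NoFreeCircle := by
  intro s
  obtain ⟨p | x, rfl⟩ := (T'.port h' O).surjective s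
  · exact ⟨0, hs.sign_ne_zero _⟩
  · obtain ⟨m, hm⟩ := hT (T.port h O (.inr x))
    exact hs.exists_kind_ne_zero h h' hm

theorem framedNormal (hT : (T.closure h O).FramedNormal) : (T'.closure h' O).FramedNormal :=
  ⟨hs.noFreeCircle h h' hT.1, hs.framed h h' hT.2⟩

end Similar

end Tangle

/-! ### Closures up to isomorphism -/

namespace Tangle

variable {n : ℕ}

/-- The ends at the crossings of a diagram whose crossings are identified by `φ` with those of a
tangle and of an outside. -/
def ends {W V : Type} (φ : Fin n ⊕ W → V) : Passage n ⊕ (W × Bool) → V × Bool :=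
  Sum.elim (fun p => (φ (.inl p.1), p.2)) fun x => (φ (.inr x.1), x.2)

theorem ends_vert {T : Tangle n} (h : T.Valid) (O : Outside) (s : Passage n ⊕ (O.W × Bool)) :
    ends (T.vert h O) s = T.port h O s := by
  rcases s with p | x <;> rfl

/-- `D` is obtained by gluing the tangle `T` to the outside `O`; `φ` identifies the crossings. -/
structure HasClosure (T : Tangle n) (O : Outside) (D : VDiagram) (φ : Fin n ⊕ O.W ≃ D.V) :
    Prop where
  kind_inl : ∀ i, D.kind (φ (.inl i)) = T.sign i
  kind_inr : ∀ x, D.kind (φ (.inr x)) = O.kind x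
  next_inl : ∀ p q, T.next p = .inl q → D.next (ends φ (.inl p)) = ends φ (.inl q)
  weight_inl : ∀ p q, T.next p = .inl q → D.weight (ends φ (.inl p)) = T.wt p
  next_out : ∀ y, D.next (ends φ (T.out y)) = ends φ (T.inn (O.link y))
  weight_out : ∀ y, D.weight (ends φ (T.out y)) =
    O.weight y + Sum.elim (fun _ => 0) (fun j => T.wt (T.last j)) y +
      Sum.elim (fun _ => 0) T.win (O.link y)

namespace HasClosure

variable {T : Tangle n} {O : Outside} {D : VDiagram} {φ : Fin n ⊕ O.W ≃ D.V}

theorem next_ends (hD : T.HasClosure O D φ) (h : T.Valid) (s : Passage n ⊕ (O.W × Bool)) :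
    D.next (ends φ s) = ends φ (T.join h O.link s) := by
  obtain ⟨y, rfl⟩ | ⟨p, q, rfl, hpq⟩ := h.eq_out_or_next s
  · rw [hD.next_out, Code.join_out]
  · rw [hD.next_inl p q hpq, Code.join_inl h _ hpq]

theorem weight_ends (hD : T.HasClosure O D φ) (h : T.Valid) (s : Passage n ⊕ (O.W × Bool)) :
    D.weight (ends φ s) = T.joinWt O.link T.wt T.win O.weight s := by
  obtain ⟨y, rfl⟩ | ⟨p, q, rfl, hpq⟩ := h.eq_out_or_next s
  · rw [hD.weight_out, Code.joinWt_out h]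
  · rw [hD.weight_inl p q hpq, Code.joinWt_inl _ _ _ _ hpq]

theorem iso (hD : T.HasClosure O D φ) (h : T.Valid) : VDiagram.Iso (T.closure h O) D := by
  have hends (s : Passage n ⊕ (O.W × Bool)) :
      (φ ((T.vert h O).symm (T.port h O s).1), (T.port h O s).2) = ends φ s := by
    rcases s with p | x <;> rfl
  refine ⟨(T.vert h O).symm.trans φ, ?_, ?_, ?_⟩
  · rintro (i | x)
    · exact hD.kind_inl i
    · exact hD.kind_inr x
  · intro v b
    obtain ⟨s, hs⟩ := (T.port h O).surjective (v, b)
    rw [← hs, next_port]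
    calc D.next (φ ((T.vert h O).symm v), b) = D.next (ends φ s) := by rw [← hends, hs]
      _ = ends φ (T.join h O.link s) := hD.next_ends h s
      _ = _ := (hends _).symm
  · intro v b
    obtain ⟨s, hs⟩ := (T.port h O).surjective (v, b)
    rw [← hs, weight_port, ← hD.weight_ends h, ← hends, hs]
    rfl

end HasClosure

end Tangle

namespace OTangle

variable {n : ℕ}

/-- The weighted tangle with given Gauss code; the open edges at the beginning of the strands have
weight zero. -/
def toTangle (T : OTangle n) : Tangle n where
  first := T.first
  rest := T.rest
  sign := T.sign
  wt := T.wt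
  win := fun _ => 0

variable {T : OTangle n} {O : Outside}

theorem ends_out {V : Type} (φ : Fin n ⊕ O.W → V) (y : O.End) :
    Tangle.ends φ (T.toTangle.out y) = Sum.elim (fun s => (φ (.inr s.1), s.2))
      (fun j => (φ (.inl (T.last j).1), (T.last j).2)) y := by
  rcases y with x | j <;> rfl

theorem ends_inn {V : Type} (φ : Fin n ⊕ O.W → V) (y : O.End) :
    Tangle.ends φ (T.toTangle.inn y) = Sum.elim (fun s => (φ (.inr s.1), s.2))
      (fun j => (φ (.inl (T.first j).1), (T.first j).2)) y := by
  rcases y with x | j <;> rfl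

theorem weight_out_toTangle (y : O.End) :
    O.weight y + Sum.elim (fun _ => 0) (fun j => T.toTangle.wt (T.toTangle.last j)) y +
        Sum.elim (fun _ => 0) T.toTangle.win (O.link y) =
      O.weight y + Sum.elim (fun _ => 0) (fun j => T.wt (T.last j)) y := by
  rcases O.link y with _ | _ <;> exact add_zero _

theorem hasClosure_toTangle {D : VDiagram} {φ : Fin n ⊕ O.W ≃ D.V} (hD : IsClosure T O D φ) :
    T.toTangle.HasClosure O D φ where
  kind_inl := hD.kind_in
  kind_inr := hD.kind_out
  next_inl p q hpq := by
    obtain ⟨j, hj⟩ := Code.infix_of_next hpq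
    exact hD.next_in j p q hj
  weight_inl p q hpq := by
    obtain ⟨j, hj⟩ := Code.infix_of_next hpq
    exact hD.weight_in j p q hj
  next_out y := by
    rw [ends_out, ends_inn]
    exact hD.next_out y
  weight_out y := by
    rw [ends_out, weight_out_toTangle]
    exact hD.weight_out y

theorem isClosure (h : T.toTangle.Valid)
    (hT : ∀ j p q, [p, q] <:+: T.first j :: T.rest j → T.toTangle.next p = .inl q) :
    IsClosure T O (T.toTangle.closure h O) (T.toTangle.vert h O) where
  kind_in _ := rfl
  kind_out _ := rfl
  next_in j p q hpq := (T.toTangle.next_port h O (.inl p)).trans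
    (congrArg _ (Code.join_inl h _ (hT j p q hpq)))
  weight_in j p q hpq := (T.toTangle.weight_port h O (.inl p)).trans
    (Code.joinWt_inl _ _ _ _ (hT j p q hpq))
  next_out y := by
    rw [← ends_out, ← ends_inn, Tangle.ends_vert, Tangle.ends_vert, Tangle.next_port,
      Code.join_out]
  weight_out y := by
    rw [← ends_out, Tangle.ends_vert, Tangle.weight_port, Code.joinWt_out h, weight_out_toTangle]

end OTangle

/-! ### H-moves at the crossings of a tangle -/

namespace Tangle

variable {n : ℕ} {T : Tangle n}

/-- Add the coboundary of a `0`-cochain on the crossings to the weights. -/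
def gauge (T : Tangle n) (f : Fin n → ℤ) : Tangle n :=
  { T with
    wt := fun p => T.wt p + Sum.elim (fun q => f q.1) (fun _ => 0) (T.next p) - f p.1
    win := fun j => T.win j + f (T.first j).1 }

/-- Extend a function on the crossings of a tangle by zero to the closure. -/
def extend (f : Fin n → ℤ) (h : T.Valid) (O : Outside) (v : (T.closure h O).V) : ℤ :=
  Sum.elim f (fun _ => 0) ((T.vert h O).symm v)

variable (f : Fin n → ℤ) (h : T.Valid) (O : Outside)

theorem extend_out (y : O.End) : extend f h O (T.port h O (T.out y)).1 =
    Sum.elim (fun _ => 0) (fun j => f (T.last j).1) y := by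
  rcases y with x | j <;> rfl

theorem extend_inn (y : O.End) : extend f h O (T.port h O (T.inn y)).1 =
    Sum.elim (fun _ => 0) (fun j => f (T.first j).1) y := by
  rcases y with x | j <;> rfl

theorem extend_inl (p : Passage n) : extend f h O (T.port h O (.inl p)).1 = f p.1 := rfl

theorem joinWt_gauge (s : Passage n ⊕ (O.W × Bool)) :
    T.joinWt O.link (T.gauge f).wt (T.gauge f).win O.weight s =
      T.joinWt O.link T.wt T.win O.weight s + extend f h O (T.port h O (T.join h O.link s)).1 -
        extend f h O (T.port h O s).1 := by
  obtain ⟨y, rfl⟩ | ⟨p, q, rfl, hpq⟩ := h.eq_out_or_next s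
  · have hlast j : (T.gauge f).wt (T.last j) = T.wt (T.last j) - f (T.last j).1 := by
      simp only [gauge, h.next_last, Sum.elim_inr, add_zero]
    rw [Code.join_out, Code.joinWt_out h, Code.joinWt_out h, extend_out, extend_inn]
    simp only [hlast]
    rcases y with x | j <;> rcases O.link _ with x' | j' <;>
      simp only [gauge, Sum.elim_inl, Sum.elim_inr] <;> ring
  · rw [Code.join_inl h _ hpq, Code.joinWt_inl _ _ _ _ hpq, Code.joinWt_inl _ _ _ _ hpq,
      extend_inl, extend_inl]
    simp only [gauge, hpq, Sum.elim_inl]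

theorem closure_gauge :
    (T.gauge f).closure h O = (T.closure h O).gauge (extend f h O) := by
  refine congrArg (fun w => ({ T.closure h O with weight := w } : VDiagram)) (funext fun s => ?_)
  obtain ⟨s, rfl⟩ := (T.port h O).surjective s
  rw [next_port, weight_port, ← joinWt_gauge]
  exact (T.gauge f).weight_port h O s

end Tangle

/-! ### Crossings which become part of the outside -/

/-- What surrounds a smaller tangle in a tangle with one more crossing: the strands of the larger
tangle run through the points `Sum.inl b`, the strands of the additional crossing, and
`Sum.inr j`, the strands of the smaller tangle. -/
structure Annulus extends Code (Bool ⊕ Fin 3) where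
  sign : SignType
  wt : Bool ⊕ Fin 3 → ℤ := fun _ => 0
  win : Fin 3 → ℤ := fun _ => 0

namespace Annulus

/-- The ends of the outside of the smaller tangle, as the points of the annulus together with the
ends of the outside of the larger tangle. -/
def endsEquiv (X : Type) : ((X ⊕ Unit) × Bool) ⊕ Fin 3 ≃ (Bool ⊕ Fin 3) ⊕ (X × Bool) where
  toFun := Sum.elim (fun s => Sum.elim (fun x => .inr (x, s.2)) (fun _ => .inl (.inl s.2)) s.1)
    fun j => .inl (.inr j)
  invFun := Sum.elim (Sum.elim (fun b => .inl (.inr (), b)) .inr) fun x => .inl (.inl x.1, x.2)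
  left_inv := by rintro (⟨x | ⟨⟩, b⟩ | j) <;> rfl
  right_inv := by rintro ((b | j) | ⟨x, b⟩) <;> rfl

/-- The outside of the smaller tangle. -/
def outside (A : Annulus) (hA : A.Valid) (O : Outside) : Outside :=
  haveI := O.fin
  { W := O.W ⊕ Unit
    kind := Sum.elim O.kind fun _ => A.sign
    link := (endsEquiv O.W).trans ((A.join hA O.link).trans (endsEquiv O.W).symm)
    weight := fun y => A.joinWt O.link A.wt A.win O.weight (endsEquiv O.W y) }

variable {A : Annulus} (hA : A.Valid) (O : Outside)

/-- The end of the outside of the smaller tangle at a point of the annulus or at an end of the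
outside of the larger tangle. -/
def toEnd : (Bool ⊕ Fin 3) ⊕ (O.W × Bool) ≃ (A.outside hA O).End := (endsEquiv O.W).symm

theorem link_toEnd (z : (Bool ⊕ Fin 3) ⊕ (O.W × Bool)) :
    (A.outside hA O).link (toEnd hA O z) = toEnd hA O (A.join hA O.link z) :=
  congrArg (fun z => (endsEquiv O.W).symm (A.join hA O.link z))
    ((endsEquiv O.W).apply_symm_apply z)

theorem weight_toEnd (z : (Bool ⊕ Fin 3) ⊕ (O.W × Bool)) :
    (A.outside hA O).weight (toEnd hA O z) = A.joinWt O.link A.wt A.win O.weight z :=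
  congrArg (A.joinWt O.link A.wt A.win O.weight) ((endsEquiv O.W).apply_symm_apply z)

end Annulus

namespace Tangle

variable {k n : ℕ}

/-- A passage of a tangle, seen in a tangle with one more crossing; `e` identifies the crossings. -/
def oldPassage (e : Fin k ⊕ Unit → Fin n) (p : Passage k) : Passage n := (e (.inl p.1), p.2)

/-- A passage of the additional crossing of a tangle; `e` identifies the crossings. -/
def newPassage (e : Fin k ⊕ Unit → Fin n) (b : Bool) : Passage n := (e (.inr ()), b)

/-- The passage at the end of a point of an annulus around `S`, where `e` identifies the crossings
of `S` and the additional crossing with those of the larger tangle. -/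
def glueLast (S : Tangle k) (e : Fin k ⊕ Unit → Fin n) : Bool ⊕ Fin 3 → Passage n :=
  Sum.elim (newPassage e) fun j => oldPassage e (S.last j)

/-- The passage at the beginning of a point of an annulus around `S`, where `e` identifies the
crossings of `S` and the additional crossing with those of the larger tangle. -/
def glueFirst (S : Tangle k) (e : Fin k ⊕ Unit → Fin n) : Bool ⊕ Fin 3 → Passage n :=
  Sum.elim (newPassage e) fun j => oldPassage e (S.first j)

/-- The tangle `T` consists of the tangle `S` and of the annulus `A`; the function `e`
identifies the crossings. -/
structure IsGlue (A : Annulus) (S : Tangle k) (T : Tangle n) (e : Fin k ⊕ Unit → Fin n) : Prop where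
  bijective : Bijective e
  sign_inl : ∀ i, T.sign (e (.inl i)) = S.sign i
  sign_inr : T.sign (e (.inr ())) = A.sign
  next_inner : ∀ p q, S.next p = .inl q → T.next (oldPassage e p) = .inl (oldPassage e q)
  wt_inner : ∀ p q, S.next p = .inl q → T.wt (oldPassage e p) = S.wt p
  next_glueLast : ∀ a, T.next (S.glueLast e a) = Sum.map (S.glueFirst e) id (A.next a)
  wt_glueLast : ∀ a, T.wt (S.glueLast e a) =
    A.wt a + Sum.elim (fun _ => 0) (fun j => S.wt (S.last j)) a +
      Sum.elim (Sum.elim (fun _ => 0) S.win) (fun _ => 0) (A.next a)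
  first : ∀ j, T.first j = S.glueFirst e (A.first j)
  win : ∀ j, T.win j = A.win j + Sum.elim (fun _ => 0) S.win (A.first j)

namespace IsGlue

variable {A : Annulus} {S : Tangle k} {T : Tangle n} {e : Fin k ⊕ Unit → Fin n}

theorem map_glueFirst_inn {X : Type} (H : IsGlue A S T e) (y : X ⊕ Fin 3) :
    Sum.map (S.glueFirst e) id (A.inn y) = T.inn y := by
  rcases y with x | j
  · rfl
  · exact congrArg Sum.inl (H.first j).symm

theorem map_glueLast_out {X : Type} (H : IsGlue A S T e) (hA : A.Valid) (hT : T.Valid)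
    (y : X ⊕ Fin 3) : Sum.map (S.glueLast e) id (A.out y) = T.out y := by
  rcases y with x | j
  · rfl
  · refine congrArg Sum.inl ((hT.next_eq_inr_iff _ j).1 ?_)
    rw [H.next_glueLast, hA.next_last]
    rfl

variable (H : IsGlue A S T e) (hA : A.Valid) (hT : T.Valid) (O : Outside)
include H

theorem join_map_glueLast (z : (Bool ⊕ Fin 3) ⊕ (O.W × Bool)) :
    T.join hT O.link (Sum.map (S.glueLast e) id z) =
      Sum.map (S.glueFirst e) id (A.join hA O.link z) := by
  obtain ⟨y, rfl⟩ | ⟨a, a', rfl, ha⟩ := hA.eq_out_or_next z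
  · rw [H.map_glueLast_out hA hT, Code.join_out, Code.join_out, H.map_glueFirst_inn]
  · have hnext := H.next_glueLast a
    rw [ha] at hnext
    rw [Code.join_inl hA _ ha]
    exact Code.join_inl hT _ hnext

include hT in
theorem joinWt_map_glueLast (z : (Bool ⊕ Fin 3) ⊕ (O.W × Bool)) :
    T.joinWt O.link T.wt T.win O.weight (Sum.map (S.glueLast e) id z) =
      A.joinWt O.link A.wt A.win O.weight z +
        Sum.elim (Sum.elim (fun _ => 0) fun j => S.wt (S.last j)) (fun _ => 0) z +
        Sum.elim (Sum.elim (fun _ => 0) S.win) (fun _ => 0) (A.join hA O.link z) := by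
  obtain ⟨y, rfl⟩ | ⟨a, a', rfl, ha⟩ := hA.eq_out_or_next z
  · have hlast j : T.last j = S.glueLast e (A.last j) :=
      (Sum.inl_injective (H.map_glueLast_out (X := Empty) hA hT (.inr j))).symm
    rw [H.map_glueLast_out hA hT, Code.joinWt_out hT, Code.joinWt_out hA, Code.join_out]
    simp only [hlast, H.wt_glueLast, hA.next_last]
    rcases y with x | j <;> rcases O.link _ with x' | j' <;>
      simp only [Code.out, Code.inn, Sum.elim_inl, Sum.elim_inr, H.win] <;> ring
  · have hnext := H.next_glueLast a
    rw [ha] at hnext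
    rw [Code.join_inl hA _ ha, Code.joinWt_inl _ _ _ _ ha, Sum.map_inl,
      Code.joinWt_inl _ _ _ _ hnext, H.wt_glueLast, ha]
    rfl

theorem iso (hS : S.Valid) :
    VDiagram.Iso (S.closure hS (A.outside hA O)) (T.closure hT O) := by
  let ε : Fin k ⊕ Unit ≃ Fin n := Equiv.ofBijective e H.bijective
  let φ : Fin k ⊕ (O.W ⊕ Unit) ≃ Fin n ⊕ O.W :=
    (Equiv.sumCongr (Equiv.refl _) (Equiv.sumComm _ _)).trans
      ((Equiv.sumAssoc _ _ _).symm.trans (Equiv.sumCongr ε (Equiv.refl _)))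
  let Φ : Fin k ⊕ (A.outside hA O).W ≃ (T.closure hT O).V := φ.trans (T.vert hT O)
  have hout z : ends Φ (S.out (Annulus.toEnd hA O z)) =
      T.port hT O (Sum.map (S.glueLast e) id z) := by
    rcases z with (b | j) | x <;> rfl
  have hinn z : ends Φ (S.inn (Annulus.toEnd hA O z)) =
      T.port hT O (Sum.map (S.glueFirst e) id z) := by
    rcases z with (b | j) | x <;> rfl
  have hwt z : Sum.elim (fun _ => 0) (fun j => S.wt (S.last j)) (Annulus.toEnd hA O z) =
      Sum.elim (Sum.elim (fun _ => 0) fun j => S.wt (S.last j)) (fun _ => 0) z := by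
    rcases z with (b | j) | x <;> rfl
  have hwin z : Sum.elim (fun _ => 0) S.win (Annulus.toEnd hA O z) =
      Sum.elim (Sum.elim (fun _ => 0) S.win) (fun _ => 0) z := by
    rcases z with (b | j) | x <;> rfl
  refine HasClosure.iso (φ := Φ) ⟨H.sign_inl, ?_, ?_, ?_, ?_, ?_⟩ hS
  · rintro (x | ⟨⟩)
    · rfl
    · exact H.sign_inr
  · intro p q hpq
    exact (next_port ..).trans (congrArg _ (Code.join_inl hT _ (H.next_inner p q hpq)))
  · intro p q hpq
    refine (weight_port ..).trans ((Code.joinWt_inl _ _ _ _ (H.next_inner p q hpq)).trans ?_)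
    exact H.wt_inner p q hpq
  · intro y
    obtain ⟨z, rfl⟩ := (Annulus.toEnd hA O).surjective y
    rw [hout, next_port, H.join_map_glueLast hA, Annulus.link_toEnd, hinn]
  · intro y
    obtain ⟨z, rfl⟩ := (Annulus.toEnd hA O).surjective y
    rw [hout, weight_port, H.joinWt_map_glueLast hA hT, Annulus.link_toEnd, Annulus.weight_toEnd,
      hwt, hwin]

end IsGlue

end Tangle

open VDiagram IntegralOGraph

namespace Tangle

variable {n n' : ℕ}

/-- All weights of the tangle `T` are zero. -/
structure Weightless (T : Tangle n) : Prop where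
  wt : ∀ p, T.wt p = 0
  win : ∀ j, T.win j = 0

section Weightless

variable {T : Tangle n} (hT : T.Weightless) (h : T.Valid) (O : Outside)

include hT

theorem Weightless.weight_inl {p q : Passage n} (hp : T.next p = .inl q) :
    (T.closure h O).weight (T.port h O (.inl p)) = 0 := by
  rw [weight_port, Code.joinWt_inl _ _ _ _ hp, hT.wt]

theorem Weightless.weight_out (y : O.End) :
    (T.closure h O).weight (T.port h O (T.out y)) = O.weight y := by
  rw [weight_port, Code.joinWt_out h]
  rcases y with x | j <;> rcases O.link _ with x' | j' <;> simp [hT.wt, hT.win]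

end Weightless

theorem next_port_inl {T : Tangle n} (h : T.Valid) (O : Outside) {p q : Passage n}
    (hp : T.next p = .inl q) :
    (T.closure h O).next (T.port h O (.inl p)) = T.port h O (.inl q) := by
  rw [next_port, Code.join_inl h _ hp]

theorem next_port_out {T : Tangle n} (h : T.Valid) (O : Outside) (y : O.End) :
    (T.closure h O).next (T.port h O (T.out y)) = T.port h O (T.inn (O.link y)) := by
  rw [next_port, Code.join_out]

theorem port_out_eq_edge_iff {T : Tangle n} (h : T.Valid) (O : Outside) {y : O.End} {j : Fin 3} :
    T.port h O (T.out y) = edge h O (.inr j) ↔ O.link y = .inr j := by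
  refine ⟨fun hy => ?_, fun hy => ?_⟩
  · exact (Equiv.eq_symm_apply _).1 (h.out_injective ((T.port h O).injective hy))
  · rw [(Equiv.eq_symm_apply O.link).2 hy, edge_inr]

/-- `T'` arises from `T` by inserting a virtual crossing `e (Sum.inr ())`, with its strand `b`
inserted into the edge `loc b`, where all weights in the tangles are zero. -/
structure IsRefined (T : Tangle n) (T' : Tangle n') (e : Fin n ⊕ Unit → Fin n')
    (loc : Bool → Passage n ⊕ Fin 3) : Prop where
  bijective : Bijective e
  loc_ne : loc true ≠ loc false
  sign_inl : ∀ i, T'.sign (e (.inl i)) = T.sign i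
  sign_inr : T'.sign (e (.inr ())) = 0
  weightless : T.Weightless
  weightless' : T'.Weightless
  next_of_ne : ∀ p, loc true ≠ .inl p → loc false ≠ .inl p →
    T'.next (oldPassage e p) = Sum.map (oldPassage e) id (T.next p)
  next_oldPassage : ∀ p b, loc b = .inl p → T'.next (oldPassage e p) = .inl (newPassage e b)
  next_newPassage : ∀ p b, loc b = .inl p →
    T'.next (newPassage e b) = Sum.map (oldPassage e) id (T.next p)
  first_of_ne : ∀ j, loc true ≠ .inr j → loc false ≠ .inr j → T'.first j = oldPassage e (T.first j)
  first_of_eq : ∀ j b, loc b = .inr j → T'.first j = newPassage e b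
  next_newPassage_of_eq_inr : ∀ j b, loc b = .inr j →
    T'.next (newPassage e b) = .inl (oldPassage e (T.first j))

namespace IsRefined

variable {T : Tangle n} {T' : Tangle n'} {e : Fin n ⊕ Unit → Fin n'}
  {loc : Bool → Passage n ⊕ Fin 3} (H : IsRefined T T' e loc) (h : T.Valid) (h' : T'.Valid)
  (O : Outside)

/-- The crossings of the closure after the insertion. -/
noncomputable def equiv : (T.closure h O).V ⊕ Unit ≃ (T'.closure h' O).V :=
  (Equiv.sumCongr (T.vert h O).symm (Equiv.refl _)).trans
    ((((Equiv.sumAssoc _ _ _).trans (Equiv.sumCongr (Equiv.refl _) (Equiv.sumComm _ _))).trans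
      ((Equiv.sumAssoc _ _ _).symm.trans (Equiv.sumCongr (Equiv.ofBijective e H.bijective)
        (Equiv.refl _)))).trans (T'.vert h' O))

/-- The edges of the closure after the insertion. -/
noncomputable abbrev edgeMap : ((T.closure h O).V ⊕ Unit) × Bool → (T'.closure h' O).V × Bool :=
  Prod.map (H.equiv h h' O) id

theorem edgeMap_oldEdge (s : Passage n ⊕ (O.W × Bool)) :
    H.edgeMap h h' O (oldEdge (T.port h O s)) =
      T'.port h' O (Sum.map (oldPassage e) id s) := by
  rcases s with p | x <;> rfl

theorem edgeMap_newEdge (b : Bool) :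
    H.edgeMap h h' O (newEdge b) = T'.port h' O (.inl (newPassage e b)) :=
  rfl

include H

theorem inn_eq (j : O.End) (hj : ∀ b i, loc b = .inr i → j ≠ .inr i) :
    T'.inn j = Sum.map (oldPassage e) id (T.inn j) := by
  rcases j with x | j
  · rfl
  · exact congrArg Sum.inl (H.first_of_ne j (fun hb => hj _ _ hb rfl) fun hb => hj _ _ hb rfl)

include h h' in
theorem out_eq (y : O.End) (hy : ∀ b p, loc b = .inl p → T.out y ≠ .inl p) :
    T'.out y = Sum.map (oldPassage e) id (T.out y) := by
  rcases y with x | j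
  · rfl
  · have hnext := H.next_of_ne (T.last j) (fun hj => hy _ _ hj rfl) fun hj => hy _ _ hj rfl
    rw [h.next_last] at hnext
    exact congrArg Sum.inl ((h'.next_eq_inr_iff _ j).1 hnext).symm

theorem next_port_out_of_ne (y : O.End)
    (hy : ∀ b j, loc b = .inr j → T.port h O (T.out y) ≠ edge h O (.inr j)) :
    (T'.closure h' O).next (T'.port h' O (T'.out y)) =
      H.edgeMap h h' O (oldEdge ((T.closure h O).next (T.port h O (T.out y)))) := by
  rw [next_port_out, next_port_out, H.edgeMap_oldEdge, H.inn_eq]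
  exact fun b j hb hlink => hy b j hb ((port_out_eq_edge_iff h O).2 hlink)

theorem undivided_out (y : O.End) (hy : ∀ b, T.port h O (T.out y) ≠ edge h O (loc b)) :
    (T'.closure h' O).next (H.edgeMap h h' O (oldEdge (T.port h O (T.out y)))) =
      H.edgeMap h h' O (oldEdge ((T.closure h O).next (T.port h O (T.out y)))) ∧
    (T'.closure h' O).weight (H.edgeMap h h' O (oldEdge (T.port h O (T.out y)))) =
      (T.closure h O).weight (T.port h O (T.out y)) := by
  rw [H.edgeMap_oldEdge, ← H.out_eq h h' O, H.weightless.weight_out, H.weightless'.weight_out]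
  · exact ⟨H.next_port_out_of_ne h h' O y fun b j hb => hb ▸ hy b, rfl⟩
  · intro b p hb hp
    apply hy b
    rw [hb, hp, edge_inl]

theorem undivided (x : (T.closure h O).V × Bool) (hx : ∀ b, x ≠ edge h O (loc b)) :
    (T'.closure h' O).next (H.edgeMap h h' O (oldEdge x)) =
      H.edgeMap h h' O (oldEdge ((T.closure h O).next x)) ∧
    (T'.closure h' O).weight (H.edgeMap h h' O (oldEdge x)) =
      (T.closure h O).weight x := by
  obtain ⟨s, rfl⟩ := (T.port h O).surjective x
  obtain ⟨y, rfl⟩ | ⟨p, q, rfl, hp⟩ := h.eq_out_or_next s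
  · exact H.undivided_out h h' O y hx
  · have hloc b : loc b ≠ .inl p := fun hb => hx b (by rw [hb]; rfl)
    have hnext := H.next_of_ne p (hloc true) (hloc false)
    rw [hp] at hnext
    rw [H.edgeMap_oldEdge, next_port_inl h O hp, H.edgeMap_oldEdge, H.weightless.weight_inl h O hp]
    exact ⟨next_port_inl h' O hnext, H.weightless'.weight_inl h' O hnext⟩

theorem next_edgeMap_newEdge_of_inl {b : Bool} {p : Passage n} (hb : loc b = .inl p)
    (hne : edge h O (loc b) ≠ edge h O (loc !b)) :
    (T'.closure h' O).next (H.edgeMap h h' O (newEdge b)) =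
      H.edgeMap h h' O (oldEdge ((T.closure h O).next (edge h O (.inl p)))) ∧
    (T'.closure h' O).weight (H.edgeMap h h' O (newEdge b)) =
      (T.closure h O).weight (edge h O (.inl p)) := by
  have hnew := H.next_newPassage p b hb
  rw [H.edgeMap_newEdge, edge_inl]
  rcases hp : T.next p with q | j
  · rw [hp] at hnew
    rw [next_port_inl h' O hnew, next_port_inl h O hp, H.edgeMap_oldEdge,
      H.weightless.weight_inl h O hp, H.weightless'.weight_inl h' O hnew]
    exact ⟨rfl, rfl⟩
  · rw [hp] at hnew
    obtain rfl : p = T.last j := (h.next_eq_inr_iff _ _).1 hp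
    have hnew : newPassage e b = T'.last j := (h'.next_eq_inr_iff _ _).1 hnew
    rw [hnew]
    refine ⟨H.next_port_out_of_ne h h' O (.inr j) ?_, ?_⟩
    · intro b' i hb' heq
      obtain rfl : b' = !b := Bool.eq_not.2 (by rintro rfl; rw [hb] at hb'; cases hb')
      rw [hb, hb'] at hne
      exact hne heq
    · exact (H.weightless'.weight_out h' O (.inr j)).trans
        (H.weightless.weight_out h O (.inr j)).symm

theorem divided_once (hne : edge h O (loc true) ≠ edge h O (loc false)) (b : Bool) :
    (T'.closure h' O).next (H.edgeMap h h' O (oldEdge (edge h O (loc b)))) =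
      H.edgeMap h h' O (newEdge b) ∧
    (T'.closure h' O).next (H.edgeMap h h' O (newEdge b)) =
      H.edgeMap h h' O (oldEdge ((T.closure h O).next (edge h O (loc b)))) ∧
    (T'.closure h' O).weight (H.edgeMap h h' O (oldEdge (edge h O (loc b)))) +
      (T'.closure h' O).weight (H.edgeMap h h' O (newEdge b)) =
      (T.closure h O).weight (edge h O (loc b)) := by
  replace hne : edge h O (loc b) ≠ edge h O (loc !b) := by
    cases b
    exacts [hne.symm, hne]
  rcases hb : loc b with p | j
  · obtain ⟨hnext, hweight⟩ := H.next_edgeMap_newEdge_of_inl h h' O hb hne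
    have hold := H.next_oldPassage p b hb
    refine ⟨next_port_inl h' O hold, hnext, ?_⟩
    rw [hweight]
    exact (congrArg (· + _) (H.weightless'.weight_inl h' O hold)).trans (zero_add _)
  · have hnew := H.next_newPassage_of_eq_inr j b hb
    have hout := H.out_eq h h' O (O.link.symm (.inr j)) fun b' p hb' hp => by
      obtain rfl : b' = !b := Bool.eq_not.2 (by rintro rfl; rw [hb] at hb'; cases hb')
      rw [hb, hb'] at hne
      exact hne (congrArg (T.port h O) hp)
    rw [next_edge_inr, H.edgeMap_newEdge, edge_inr]
    rw [H.edgeMap_oldEdge, ← hout, next_port_out, Equiv.apply_symm_apply, next_port_inl h' O hnew,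
      H.weightless.weight_out, H.weightless'.weight_out, H.weightless'.weight_inl h' O hnew]
    refine ⟨?_, rfl, add_zero _⟩
    exact congrArg (fun p => T'.port h' O (.inl p)) (H.first_of_eq j b hb)

theorem divided_twice {c : Bool} {p : Passage n} {j : Fin 3} (hc : loc c = .inl p)
    (hc' : loc (!c) = .inr j) (heq : edge h O (loc c) = edge h O (loc !c)) :
    (T'.closure h' O).next (H.edgeMap h h' O (oldEdge (edge h O (loc c)))) =
      H.edgeMap h h' O (newEdge c) ∧
    (T'.closure h' O).next (H.edgeMap h h' O (newEdge c)) =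
      H.edgeMap h h' O (newEdge !c) ∧
    (T'.closure h' O).next (H.edgeMap h h' O (newEdge !c)) =
      H.edgeMap h h' O (oldEdge ((T.closure h O).next (edge h O (loc c)))) ∧
    (T'.closure h' O).weight (H.edgeMap h h' O (oldEdge (edge h O (loc c)))) +
      (T'.closure h' O).weight (H.edgeMap h h' O (newEdge c)) +
      (T'.closure h' O).weight (H.edgeMap h h' O (newEdge !c)) =
      (T.closure h O).weight (edge h O (loc c)) := by
  rw [hc, hc', edge_inl, edge_inr] at heq
  obtain ⟨J, hJ⟩ : ∃ J, O.link.symm (.inr j) = .inr J := by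
    rcases hy : O.link.symm (.inr j) with x | J
    · rw [hy] at heq
      cases (T.port h O).injective heq
    · exact ⟨J, rfl⟩
  have hlink : O.link (.inr J) = .inr j := by rw [← hJ, Equiv.apply_symm_apply]
  obtain rfl : p = T.last J := by
    rw [hJ] at heq
    exact Sum.inl_injective ((T.port h O).injective heq)
  have hold := H.next_oldPassage _ c hc
  have hnew := H.next_newPassage_of_eq_inr j _ hc'
  have hlast : newPassage e c = T'.last J := by
    refine (h'.next_eq_inr_iff _ _).1 ((H.next_newPassage _ c hc).trans ?_)
    rw [h.next_last]
    rfl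
  have hweight' := H.weightless'.weight_out h' O (.inr J)
  have hnext' := next_port_out h' O (.inr J)
  have hnext := next_port_out h O (.inr J)
  have hweight := H.weightless.weight_out h O (.inr J)
  rw [hlink] at hnext' hnext
  change (T'.closure h' O).weight (T'.port h' O (.inl (T'.last J))) = _ at hweight'
  change (T'.closure h' O).next (T'.port h' O (.inl (T'.last J))) =
    T'.port h' O (.inl (T'.first j)) at hnext'
  change (T.closure h O).next (T.port h O (.inl (T.last J))) =
    T.port h O (.inl (T.first j)) at hnext
  change (T.closure h O).weight (T.port h O (.inl (T.last J))) = _ at hweight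
  rw [hc, edge_inl, hnext, hweight]
  simp only [H.edgeMap_oldEdge, H.edgeMap_newEdge, Sum.map_inl]
  rw [next_port_inl h' O hold, next_port_inl h' O hnew, H.weightless'.weight_inl h' O hold,
    H.weightless'.weight_inl h' O hnew, hlast, hnext', hweight', H.first_of_eq j _ hc']
  exact ⟨rfl, rfl, rfl, by ring⟩

theorem refines :
    Refines (T.closure h O) (T'.closure h' O) (H.equiv h h' O)
      (fun b => edge h O (loc b)) (loc true).isLeft where
  kind_inl x := by
    rcases x with i | x
    · exact H.sign_inl i
    · rfl
  kind_inr := H.sign_inr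
  undivided x htrue hfalse := H.undivided h h' O x (Bool.forall_bool.2 ⟨hfalse, htrue⟩)
  divided_once := H.divided_once h h' O
  divided_twice heq := by
    rcases htrue : loc true with p | i <;> rcases hfalse : loc false with q | j
    · rw [htrue, hfalse, edge_inl, edge_inl] at heq
      exact absurd ((T.port h O).injective heq) (by simpa [htrue, hfalse] using H.loc_ne)
    · exact H.divided_twice h h' O htrue hfalse heq
    · obtain ⟨hold, hnew, hnew', hweight⟩ := H.divided_twice h h' O hfalse htrue heq.symm
      exact ⟨hold, hnew, hnew', (add_right_comm _ _ _).trans hweight⟩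
    · rw [htrue, hfalse, edge_inr, edge_inr] at heq
      have hij := O.link.symm.injective (h.out_injective ((T.port h O).injective heq))
      exact absurd hij (by simpa [htrue, hfalse] using H.loc_ne)

end IsRefined

end Tangle

namespace IntegralOGraph

theorem Step.symm {Γ Γ' : IntegralOGraph} (h : Step Γ Γ') : Step Γ' Γ := ⟨h.2.1, h.1, h.2.2.symm⟩

/-- The diagrams are related by a sequence of basic moves and their inverses through framed
diagrams. -/
def Reach (D D' : VDiagram) : Prop := Relation.ReflTransGen Step (mk D) (mk D')

theorem Reach.symm {D D' : VDiagram} (h : Reach D D') : Reach D' D := by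
  have : Std.Symm Step := ⟨fun _ _ => Step.symm⟩
  exact symm_of (Relation.ReflTransGen Step) h

theorem Reach.trans {D D' D'' : VDiagram} (h : Reach D D') (h' : Reach D' D'') : Reach D D'' :=
  Relation.ReflTransGen.trans h h'

theorem Reach.of_eq {D D' : VDiagram} (h : mk D = mk D') : Reach D D' := by
  rw [Reach, h]

theorem Reach.of_iso {D D' : VDiagram} (h : Iso D D') : Reach D D' := .of_eq (mk_eq_of_iso h)

theorem Reach.of_basicMove {D D' : VDiagram} (hD : D.FramedNormal) (hD' : D'.FramedNormal)
    (h : BasicMove (mk D) (mk D')) : Reach D D' :=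
  .single ⟨(isFramed_mk_iff D).2 hD, (isFramed_mk_iff D').2 hD', .inl h⟩

theorem gauge_gauge (D : VDiagram) (f g : D.V → ℤ) : (D.gauge f).gauge g = D.gauge (f + g) := by
  unfold VDiagram.gauge
  congr 1
  funext s
  simp only [Pi.add_apply]
  ring

theorem gauge_zero (D : VDiagram) : D.gauge 0 = D := by
  unfold VDiagram.gauge
  cases D
  congr 1
  funext s
  simp

variable {D : VDiagram} (hD : D.FramedNormal)

include hD

open Classical in
theorem reach_gauge_single {v : D.V} (hv : D.kind v ≠ 0) (k : ℤ) :
    Reach D (D.gauge (Pi.single v k)) := by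
  have reach_succ (k : ℤ) :
      Reach (D.gauge (Pi.single v k)) (D.gauge (Pi.single v (k + 1))) := by
    refine .of_basicMove ((gauge_framedNormal_iff _ _).2 hD) ((gauge_framedNormal_iff _ _).2 hD)
      (.hMove ⟨_, _, rfl, rfl, v, hv, ?_⟩)
    rw [Pi.single_add, ← gauge_gauge]
    congr 1
    funext u
    exact Pi.single_apply v 1 u
  induction k using Int.induction_on with
  | zero =>
    rw [Pi.single_zero, gauge_zero]
    exact .of_eq rfl
  | succ k ih => exact ih.trans (reach_succ _)
  | pred k ih =>
    have hstep := reach_succ (-k - 1)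
    rw [sub_add_cancel] at hstep
    exact ih.trans hstep.symm

theorem reach_gauge {f : D.V → ℤ} (hf : ∀ v, D.kind v = 0 → f v = 0) : Reach D (D.gauge f) := by
  classical
  have := D.fin
  have := Fintype.ofFinite D.V
  suffices key : ∀ s : Finset D.V, Reach D (D.gauge (∑ v ∈ s, Pi.single v (f v))) by
    simpa only [univ_sum_single] using key univ
  intro s
  induction s using Finset.induction_on with
  | empty =>
    rw [sum_empty, gauge_zero]
    exact .of_eq rfl
  | insert v s hv ih =>
    rw [sum_insert hv, add_comm]
    by_cases hk : D.kind v = 0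
    · rw [hf v hk, Pi.single_zero, add_zero]
      exact ih
    · rw [← gauge_gauge]
      exact ih.trans (reach_gauge_single ((gauge_framedNormal_iff _ _).2 hD) hk _)

end IntegralOGraph

namespace SlideType

/-- The weight on the middle part of the right edge, as an integer. -/
def mid : SlideType → ℤ
  | I => 0 | II => 0 | III => 1 | IV => -1

/-- The direction of the left edge: `1` if it goes up. -/
def leftSign (t : SlideType) : ℤ := if t.leftUp then 1 else -1

/-- The direction of the right edge: `1` if it goes up. -/
def rightSign (t : SlideType) : ℤ := if t.rightUp then 1 else -1

/-- Twice the weight on the lower part of the right edge, in terms of twice the rotation number. -/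
def low (t : SlideType) (p : ℤ) : ℤ := -(t.rightSign * (p + 1)) - t.mid

theorem leftSign_mul_self (t : SlideType) : t.leftSign * t.leftSign = 1 := by cases t <;> rfl

theorem rightSign_mul_self (t : SlideType) : t.rightSign * t.rightSign = 1 := by cases t <;> rfl

theorem bottomSign_ne_zero (t : SlideType) : t.bottomSign ≠ 0 := by cases t <;> decide

theorem midWeight_eq (t : SlideType) : t.midWeight = t.mid := by cases t <;> simp [midWeight, mid]

theorem lowWeight_eq (t : SlideType) {p a : ℤ} (h : 2 * a = t.low p) :
    t.lowWeight ((p : ℚ) / 2) = a := by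
  have hcast : (2 * a : ℚ) = t.low p := by exact_mod_cast h
  cases t <;> simp [low, lowWeight, rightSign, rightUp, mid] at hcast ⊢ <;> linarith

end SlideType

/-- Kronecker's delta. -/
noncomputable def delta {X : Type*} (x y : X) : ℤ := open Classical in if x = y then 1 else 0

theorem delta_self {X : Type*} (x : X) : delta x x = 1 := by simp [delta]

theorem delta_of_ne {X : Type*} {x y : X} (h : x ≠ y) : delta x y = 0 := by simp [delta, h]

theorem ite_eq_mul_delta {X : Type*} (x y : X) [Decidable (x = y)] (a : ℤ) :
    (if x = y then a else 0) = a * delta x y := by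
  by_cases h : x = y <;> simp [delta, h]

theorem delta_apply {X Y : Type*} (e : X ≃ Y) (x y : X) : delta (e x) (e y) = delta x y := by
  by_cases h : x = y <;> simp [delta, h]

theorem lt_minimalPeriod_of_forall_ne {X : Type*} {σ : X → X} {x : X} (hx : x ∈ periodicPts σ)
    {n : ℕ} (h : ∀ i, 0 < i → i ≤ n → σ^[i] x ≠ x) : n < minimalPeriod σ x :=
  not_le.1 fun hle => h _ (minimalPeriod_pos_of_mem_periodicPts hx) hle iterate_minimalPeriod

namespace VDiagram

theorem succ_of_next (D : VDiagram) {s s' : D.V × Bool} {l : Fin 3} (hl : l ≠ 2) (h : D.next s = s')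
    (hs : D.kind s'.1 = 0) : D.succ (s, l) = (s', l) := by
  subst h
  rw [succ_eq, show D.arrival (s, l) = (D.next s, l) by simp [arrival, hl],
    depart_of_kind_eq_zero _ hs]
  simp [hl]

theorem succ_two_of_next (D : VDiagram) {s s' : D.V × Bool} (h : D.next s' = s)
    (hs : D.kind s.1 = 0) : D.succ (s, 2) = (s', 2) := by
  subst h
  rw [succ_eq, show D.arrival (D.next s', 2) = (D.next s', 2) by simp [arrival],
    depart_of_kind_eq_zero _ hs]
  simp

theorem IsPath.exists_complement {D : VDiagram} {x y : D.Germ} {m : ℕ} {r : ℤ}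
    (h : D.IsPath (· ≠ x) y x m r) :
    ∃ n < minimalPeriod D.succ x, D.succ^[n] x = y ∧
      birkhoffSum D.succ D.rot2 n x + r = cycleSum D.succ D.rot2 x := by
  have hperiod : D.succ^[minimalPeriod D.succ x] x = x := iterate_minimalPeriod
  have hle : m ≤ minimalPeriod D.succ x := by
    by_contra! hlt
    have hpos := minimalPeriod_pos_of_mem_periodicPts (D.mem_periodicPts_succ x)
    refine h.inner (m - minimalPeriod D.succ x) (by omega) (by omega)
      (D.succ_injective.iterate (minimalPeriod D.succ x) ?_)
    rw [← iterate_add_apply, Nat.add_sub_cancel' hlt.le, h.iterate_eq, hperiod]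
  obtain ⟨n, hn⟩ := Nat.exists_eq_add_of_le hle
  have hxy : D.succ^[n] x = y := by
    refine D.succ_injective.iterate m ?_
    rw [← iterate_add_apply, ← hn, hperiod, h.iterate_eq]
  refine ⟨n, by have := h.pos; omega, hxy, ?_⟩
  rw [cycleSum, hn, add_comm m n, birkhoffSum_add, hxy, h.birkhoffSum_eq]

section Slide

variable (D : VDiagram) (t : SlideType) (B T : D.V)

/-- The part of the left edge below the two crossings. -/
abbrev low₁ : D.V × Bool := D.lowEdge B t.leftOver t.leftUp

/-- The part of the right edge below the two crossings. -/
abbrev low₂ : D.V × Bool := D.lowEdge B (!t.leftOver) t.rightUp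

/-- The part of the left edge between the two crossings. -/
abbrev mid₁ : D.V × Bool := D.midEdge B T t.leftOver t.leftUp

/-- The part of the right edge between the two crossings. -/
abbrev mid₂ : D.V × Bool := D.midEdge B T (!t.leftOver) t.rightUp

/-- The part of the left edge above the two crossings. -/
abbrev high₁ : D.V × Bool := D.highEdge T t.leftOver t.leftUp

/-- The part of the right edge above the two crossings. -/
abbrev high₂ : D.V × Bool := D.highEdge T (!t.leftOver) t.rightUp

open Classical in
/-- The diagram after a pure sliding move with weight `a` on the edge `near` and weight
`-(a + t.mid)` on the edge `far`. The move as defined has `near` below and `far` above the two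
crossings; the roles are exchanged when the path of the move runs above them. -/
noncomputable def slid (near far : D.V × Bool) (a : ℤ) : VDiagram :=
  { D with
    kind := update (update D.kind B t.bottomSign) T (-t.bottomSign)
    weight := fun s => D.weight s + a * delta s near + t.mid * delta s (D.mid₂ t B T)
      - (a + t.mid) * delta s far }

open Classical in
variable {D t B T} in
theorem slid_eq {near far : D.V × Bool} {a : ℤ} {kind : D.V → SignType}
    {weight : D.V × Bool → ℤ} (htop : kind T = -t.bottomSign)
    (hbot : B ≠ T → kind B = t.bottomSign) (hkind : ∀ v, v ≠ B → v ≠ T → kind v = D.kind v)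
    (hweight : ∀ s, weight s = D.weight s + a * delta s near + t.mid * delta s (D.mid₂ t B T)
      - (a + t.mid) * delta s far) :
    D.slid t B T near far a = { D with kind := kind, weight := weight } := by
  have hupdate : update (update D.kind B t.bottomSign) T (-t.bottomSign) = kind := by
    funext v
    by_cases hT : v = T
    · rw [hT, update_self, htop]
    rw [update_of_ne hT]
    by_cases hB : v = B
    · rw [hB, update_self, hbot (hB ▸ hT)]
    · rw [update_of_ne hB, hkind v hB hT]
  rw [slid, hupdate, ← funext hweight]

theorem along_leftLine (s : D.V × Bool) : D.along (s, t.leftLine) = -(t.leftSign * D.weight s) := by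
  cases t <;> simp [along, SlideType.leftLine, SlideType.leftSign, SlideType.leftUp]

theorem along_rightLine (s : D.V × Bool) : D.along (s, t.rightLine) = t.rightSign * D.weight s := by
  cases t <;> simp [along, SlideType.rightLine, SlideType.rightSign, SlideType.rightUp]

/-- Two strands cross each other twice at virtual crossings. -/
structure Bigon : Prop where
  ne : B ≠ T
  kind_bot : D.kind B = 0
  kind_top : D.kind T = 0
  left : D.Passes B T t.leftOver t.leftUp
  right : D.Passes B T (!t.leftOver) t.rightUp

variable {D t B T}

theorem Bigon.slide (h : D.Bigon t B T) {n : ℕ} {a : ℤ}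
    (hlow₁ : D.weight (D.low₁ t B) = 0) (hmid₁ : D.weight (D.mid₁ t B T) = 0)
    (hlow₂ : D.weight (D.low₂ t B) = 0) (hmid₂ : D.weight (D.mid₂ t B T) = 0)
    (hn : n < minimalPeriod D.succ (D.low₁ t B, t.leftLine))
    (hsucc : D.succ^[n] (D.low₁ t B, t.leftLine) = (D.low₂ t B, t.rightLine))
    (ha : 2 * a = t.low (birkhoffSum D.succ D.rot2 n (D.low₁ t B, t.leftLine))) :
    Slide t D (D.slid t B T (D.low₂ t B) (D.high₂ t T) a) := by
  refine ⟨B, T, n, _, (D.slid t B T (D.low₂ t B) (D.high₂ t T) a).weight, h.ne,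
    h.kind_bot, h.kind_top, h.left, h.right, hlow₁, hmid₁, hlow₂, hmid₂, hn, hsucc, rfl, ?_, ?_⟩
  · intro s
    have hp : ∑ i ∈ range n, ((D.along (D.succ^[i] (D.low₁ t B, t.leftLine)) : ℚ) +
        D.turn (D.succ^[i] (D.low₁ t B, t.leftLine))) =
        (birkhoffSum D.succ D.rot2 n (D.low₁ t B, t.leftLine) : ℤ) / 2 := by
      rw [birkhoffSum, Int.cast_sum, sum_div]
      exact sum_congr rfl fun i _ => D.along_add_turn _
    rw [hp, t.lowWeight_eq ha, t.midWeight_eq]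
    simp only [slid, delta, mul_ite, mul_one, mul_zero]
    push_cast
    congr!
  · unfold slid
    congr!

theorem Bigon.reach_slid (h : D.Bigon t B T) {g : D.Germ} {a : ℤ}
    (hlow₁ : D.weight (D.low₁ t B) = 0) (hmid₁ : D.weight (D.mid₁ t B T) = 0)
    (hlow₂ : D.weight (D.low₂ t B) = 0) (hmid₂ : D.weight (D.mid₂ t B T) = 0)
    (hsucc_low₁ : D.succ (D.low₁ t B, t.leftLine) = g)
    (hsucc_g : D.succ g = (D.low₂ t B, t.rightLine))
    (hg : g.1 ≠ D.low₁ t B) (hlow : D.low₂ t B ≠ D.low₁ t B)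
    (ha : 2 * a = t.low (D.rot2 (D.low₁ t B, t.leftLine) + D.rot2 g))
    (hD : D.FramedNormal) (hD' : (D.slid t B T (D.low₂ t B) (D.high₂ t T) a).FramedNormal) :
    Reach D (D.slid t B T (D.low₂ t B) (D.high₂ t T) a) := by
  refine .of_basicMove hD hD' (.slide t ⟨_, _, rfl, rfl,
    h.slide (n := 2) hlow₁ hmid₁ hlow₂ hmid₂ ?_ ?_ ?_⟩)
  · refine lt_minimalPeriod_of_forall_ne (D.mem_periodicPts_succ _) fun i hi hi2 => ?_
    interval_cases i
    · rw [iterate_one, hsucc_low₁]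
      exact fun e => hg (congrArg Prod.fst e)
    · rw [iterate_succ_apply, iterate_one, hsucc_low₁, hsucc_g]
      exact fun e => hlow (congrArg Prod.fst e)
  · rw [iterate_succ_apply, iterate_one, hsucc_low₁, hsucc_g]
  · rw [birkhoffSum_succ, birkhoffSum_one, iterate_one, hsucc_low₁]
    exact ha

theorem Bigon.succ_high₁ (h : D.Bigon t B T) :
    D.succ (D.high₁ t T, t.leftLine) = (D.mid₁ t B T, t.leftLine) := by
  have hleft := h.left
  cases t
  · exact D.succ_two_of_next hleft h.kind_top
  · exact D.succ_two_of_next hleft h.kind_top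
  · exact D.succ_of_next (by decide) (D.next.apply_symm_apply _) h.kind_top
  · exact D.succ_two_of_next hleft h.kind_top

theorem Bigon.succ_mid₁ (h : D.Bigon t B T) :
    D.succ (D.mid₁ t B T, t.leftLine) = (D.low₁ t B, t.leftLine) := by
  have hleft := h.left
  cases t
  · exact D.succ_two_of_next (D.next.apply_symm_apply _) h.kind_bot
  · exact D.succ_two_of_next (D.next.apply_symm_apply _) h.kind_bot
  · exact D.succ_of_next (by decide) hleft h.kind_bot
  · exact D.succ_two_of_next (D.next.apply_symm_apply _) h.kind_bot

theorem Bigon.succ_low₂ (h : D.Bigon t B T) :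
    D.succ (D.low₂ t B, t.rightLine) = (D.mid₂ t B T, t.rightLine) := by
  have hright := h.right
  cases t
  · exact D.succ_of_next (by decide) (D.next.apply_symm_apply _) h.kind_bot
  · exact D.succ_of_next (by decide) (D.next.apply_symm_apply _) h.kind_bot
  · exact D.succ_of_next (by decide) (D.next.apply_symm_apply _) h.kind_bot
  · exact D.succ_two_of_next hright h.kind_bot

theorem Bigon.succ_mid₂ (h : D.Bigon t B T) :
    D.succ (D.mid₂ t B T, t.rightLine) = (D.high₂ t T, t.rightLine) := by
  have hright := h.right
  cases t
  · exact D.succ_of_next (by decide) hright h.kind_top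
  · exact D.succ_of_next (by decide) hright h.kind_top
  · exact D.succ_of_next (by decide) hright h.kind_top
  · exact D.succ_two_of_next (D.next.apply_symm_apply _) h.kind_top

/-! ### Pure sliding moves with the path above the crossings -/

theorem Passes.delta_eq {b up : Bool} (h : D.Passes B T b up) (s : D.V × Bool) :
    delta s (B, b) + delta s (T, b) - delta (D.next s) (B, b) - delta (D.next s) (T, b) =
      (if up then 1 else -1) * (delta s (D.highEdge T b up) - delta s (D.lowEdge B b up)) := by
  have hsymm (x y) : delta x (D.next.symm y) = delta (D.next x) y := by
    rw [← delta_apply D.next, Equiv.apply_symm_apply]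
  unfold Passes midEdge at h
  unfold highEdge lowEdge
  cases up
  · simp only [Bool.false_eq_true, if_false] at h ⊢
    rw [hsymm, ← h, delta_apply]
    ring
  · simp only [if_true] at h ⊢
    rw [hsymm, ← h, delta_apply]
    ring

theorem Passes.shift_shift {b up : Bool} (h : D.Passes B T b up) (w : D.V × Bool → ℤ) (k : ℤ) :
    D.shift (T, b) ((if up then 1 else -1) * k) (D.shift (B, b) ((if up then 1 else -1) * k) w) =
      fun s => w s + k * (delta s (D.highEdge T b up) - delta s (D.lowEdge B b up)) := by
  funext s
  have hdelta := h.delta_eq s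
  simp only [VDiagram.shift, ite_eq_mul_delta]
  cases up <;>
    simp only [Bool.false_eq_true, if_false, if_true] at hdelta ⊢
  · linear_combination (-k) * hdelta
  · linear_combination k * hdelta

theorem delta_fst {X : Type*} (x : X × Bool) (v : X) (b : Bool) :
    delta x.1 v = delta x (v, b) + delta x (v, !b) := by
  obtain ⟨u, c⟩ := x
  by_cases hu : u = v
  · cases b <;> cases c <;> simp [delta, hu]
  · simp [delta, hu]

theorem Bigon.delta_gauge (h : D.Bigon t B T) (s : D.V × Bool) :
    (delta (D.next s).1 B + delta (D.next s).1 T) - (delta s.1 B + delta s.1 T) =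
      -(t.leftSign * (delta s (D.high₁ t T) - delta s (D.low₁ t B)) +
        t.rightSign * (delta s (D.high₂ t T) - delta s (D.low₂ t B))) := by
  simp only [delta_fst _ _ t.leftOver, SlideType.leftSign, SlideType.rightSign]
  linear_combination -h.left.delta_eq s - h.right.delta_eq s

variable (D t B T) in
/-- The diagram with the weight `k` on the left edge and the weight `l` on the right edge pushed
from below the two crossings to above them. -/
noncomputable abbrev push (k l : ℤ) : VDiagram :=
  D.withWeight fun s => D.weight s + l * (delta s (D.high₂ t T) - delta s (D.low₂ t B))
    + k * (delta s (D.high₁ t T) - delta s (D.low₁ t B))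

theorem Bigon.push_mk_eq (h : D.Bigon t B T)
    (hshift : ∀ v, v = B ∨ v = T → ∀ w b u,
      IntegralOGraph.mk (D.withWeight (D.shift (v, b) u w)) = IntegralOGraph.mk (D.withWeight w))
    (k l : ℤ) : IntegralOGraph.mk (D.push t B T k l) = IntegralOGraph.mk D := by
  have hB := hshift B (.inl rfl)
  have hT := hshift T (.inr rfl)
  rw [push, ← h.left.shift_shift, ← h.right.shift_shift, hT, hB, hT, hB]

variable (D t B T) in
/-- The upper ends of the two strands of a bigon are joined by a path `high₂, g, high₁` in the
boundary of the `2`-cell between them. -/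
structure Cap (g : D.Germ) : Prop extends D.Bigon t B T where
  succ_high₂ : D.succ (D.high₂ t T, t.rightLine) = g
  succ_cap : D.succ g = (D.high₁ t T, t.leftLine)
  nodup : [D.mid₁ t B T, D.mid₂ t B T, D.high₁ t T, D.high₂ t T, g.1].Nodup
  low₁_notMem : D.low₁ t B ∉ [D.mid₁ t B T, D.mid₂ t B T, D.high₁ t T, D.high₂ t T, g.1]
  low₂_notMem : D.low₂ t B ∉ [D.mid₁ t B T, D.mid₂ t B T, D.high₁ t T, D.high₂ t T, g.1]

namespace Cap

variable {g : D.Germ} (h : D.Cap t B T g)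

include h

theorem push_weight_of_mem {s : D.V × Bool} (hs : s = D.mid₁ t B T ∨ s = D.mid₂ t B T ∨ s = g.1)
    (k l : ℤ) : (D.push t B T k l).weight s = D.weight s := by
  have hnodup := h.nodup
  have hlow₁ := h.low₁_notMem
  have hlow₂ := h.low₂_notMem
  have hne : s ≠ D.high₁ t T ∧ s ≠ D.high₂ t T ∧ s ≠ D.low₁ t B ∧ s ≠ D.low₂ t B := by
    rcases hs with rfl | rfl | rfl <;> simp_all [eq_comm]
  simp [delta_of_ne hne.1, delta_of_ne hne.2.1, delta_of_ne hne.2.2.1, delta_of_ne hne.2.2.2]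

theorem push_weight_high₁ (k l : ℤ) :
    (D.push t B T k l).weight (D.high₁ t T) = D.weight (D.high₁ t T) + k := by
  have hnodup := h.nodup
  have hlow₁ := h.low₁_notMem
  have hlow₂ := h.low₂_notMem
  simp only [List.nodup_cons, List.mem_cons, not_or] at hnodup hlow₁ hlow₂
  simp [delta_self, delta_of_ne hnodup.2.2.1.1, delta_of_ne (Ne.symm hlow₁.2.2.1),
    delta_of_ne (Ne.symm hlow₂.2.2.1)]

theorem push_weight_high₂ (k l : ℤ) :
    (D.push t B T k l).weight (D.high₂ t T) = D.weight (D.high₂ t T) + l := by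
  have hnodup := h.nodup
  have hlow₁ := h.low₁_notMem
  have hlow₂ := h.low₂_notMem
  simp only [List.nodup_cons, List.mem_cons, not_or] at hnodup hlow₁ hlow₂
  simp [delta_self, delta_of_ne (Ne.symm hnodup.2.2.1.1), delta_of_ne (Ne.symm hlow₁.2.2.2.1),
    delta_of_ne (Ne.symm hlow₂.2.2.2.1)]

theorem exists_push_weight_low_eq_zero : ∃ k l : ℤ,
    (D.push t B T k l).weight (D.low₁ t B) = 0 ∧ (D.push t B T k l).weight (D.low₂ t B) = 0 := by
  have hlow₁ := h.low₁_notMem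
  have hlow₂ := h.low₂_notMem
  simp only [List.mem_cons, not_or] at hlow₁ hlow₂
  simp only [delta_self, delta_of_ne hlow₁.2.2.1, delta_of_ne hlow₁.2.2.2.1,
    delta_of_ne hlow₂.2.2.1, delta_of_ne hlow₂.2.2.2.1]
  by_cases e : D.low₁ t B = D.low₂ t B
  · refine ⟨D.weight (D.low₁ t B), 0, by ring, ?_⟩
    rw [← e, delta_self]
    ring
  · refine ⟨D.weight (D.low₁ t B), D.weight (D.low₂ t B), ?_, ?_⟩
    · rw [delta_of_ne e]
      ring
    · rw [delta_of_ne (Ne.symm e)]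
      ring

theorem isPath : ∃ m, D.IsPath (· ≠ (D.low₁ t B, t.leftLine)) (D.low₂ t B, t.rightLine)
    (D.low₁ t B, t.leftLine) m
    (2 * (t.rightSign * (D.weight (D.low₂ t B) + D.weight (D.mid₂ t B T))) +
      (D.rot2 (D.high₂ t T, t.rightLine) + D.rot2 g) -
      2 * (t.leftSign * (D.weight (D.high₁ t T) + D.weight (D.mid₁ t B T)))) := by
  have hne {s : D.V × Bool} {l : Fin 3}
      (hs : s ∈ [D.mid₁ t B T, D.mid₂ t B T, D.high₁ t T, D.high₂ t T, g.1]) :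
      (s, l) ≠ (D.low₁ t B, t.leftLine) := by
    rintro ⟨⟩
    exact h.low₁_notMem hs
  have hpath := IsPath.single D (· ≠ (D.low₁ t B, t.leftLine)) (D.mid₁ t B T, t.leftLine)
  rw [← h.succ_high₁] at hpath
  replace hpath := hpath.cons (h.succ_high₁ ▸ hne (by simp))
  rw [← h.succ_cap] at hpath
  replace hpath := hpath.cons (h.succ_cap ▸ hne (by simp))
  rw [← h.succ_high₂] at hpath
  replace hpath := hpath.cons (h.succ_high₂ ▸ hne (by simp))
  rw [← h.succ_mid₂] at hpath
  replace hpath := hpath.cons (h.succ_mid₂ ▸ hne (by simp))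
  rw [← h.succ_low₂] at hpath
  replace hpath := hpath.cons (h.succ_low₂ ▸ hne (by simp))
  simp only [h.succ_low₂, h.succ_mid₂, h.succ_high₂, h.succ_cap, h.succ_high₁, h.succ_mid₁] at hpath
  refine ⟨6, ?_⟩
  convert hpath using 1
  simp only [rot2, h.succ_low₂, h.succ_mid₂, h.succ_high₁, h.succ_mid₁, along_leftLine,
    along_rightLine, turn2, if_true]
  ring

theorem rot2_push (k l : ℤ) : (D.push t B T k l).rot2 (D.high₂ t T, t.rightLine) =
      D.rot2 (D.high₂ t T, t.rightLine) + 2 * (t.rightSign * l) ∧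
    (D.push t B T k l).rot2 g = D.rot2 g := by
  have hweight := h.push_weight_of_mem (.inr (.inr rfl)) k l
  have hhigh₂ := h.push_weight_high₂ k l
  constructor
  · have hturn : ((D.push t B T k l).succ (D.high₂ t T, t.rightLine)).2 =
        (D.succ (D.high₂ t T, t.rightLine)).2 := rfl
    unfold rot2
    rw [hturn, along_rightLine, along_rightLine]
    linear_combination 2 * t.rightSign * hhigh₂
  · have hturn : ((D.push t B T k l).succ g).2 = (D.succ g).2 := rfl
    unfold rot2 along
    rw [hturn, hweight]

protected theorem push (k l : ℤ) : (D.push t B T k l).Cap t B T g :=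
  ⟨⟨h.ne, h.kind_bot, h.kind_top, h.left, h.right⟩, h.succ_high₂, h.succ_cap, h.nodup,
    h.low₁_notMem, h.low₂_notMem⟩

theorem slide {a : ℤ} (hD : D.Framed)
    (hlow₁ : D.weight (D.low₁ t B) = 0) (hmid₁ : D.weight (D.mid₁ t B T) = 0)
    (hlow₂ : D.weight (D.low₂ t B) = 0) (hmid₂ : D.weight (D.mid₂ t B T) = 0)
    (ha : 2 * a = t.low (-2 - (D.rot2 (D.high₂ t T, t.rightLine) + D.rot2 g) +
      2 * (t.leftSign * D.weight (D.high₁ t T)))) :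
    Slide t D (D.slid t B T (D.low₂ t B) (D.high₂ t T) a) := by
  obtain ⟨m, hpath⟩ := h.isPath
  obtain ⟨n, hn, hiterate, hsum⟩ := hpath.exists_complement
  rw [(framed_iff _).1 hD, hlow₂, hmid₁, hmid₂] at hsum
  refine h.toBigon.slide hlow₁ hmid₁ hlow₂ hmid₂ hn hiterate (ha.trans (congrArg t.low ?_))
  linear_combination -hsum

theorem slide_push {a : ℤ} (hmid₁ : D.weight (D.mid₁ t B T) = 0)
    (hmid₂ : D.weight (D.mid₂ t B T) = 0) (hhigh₁ : D.weight (D.high₁ t T) = 0)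
    (ha : 2 * a = t.low (D.rot2 (D.high₂ t T, t.rightLine) + D.rot2 g)) {k l : ℤ}
    (hframed : (D.push t B T k l).Framed)
    (hlow₁ : (D.push t B T k l).weight (D.low₁ t B) = 0)
    (hlow₂ : (D.push t B T k l).weight (D.low₂ t B) = 0) :
    Slide t (D.push t B T k l) ((D.push t B T k l).slid t B T (D.low₂ t B) (D.high₂ t T)
      (-(a + t.mid) + l - t.leftSign * t.rightSign * k)) := by
  refine (h.push k l).slide hframed hlow₁ ((h.push_weight_of_mem (.inl rfl) k l).trans hmid₁)
    hlow₂ ((h.push_weight_of_mem (.inr (.inl rfl)) k l).trans hmid₂) ?_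
  change _ = t.low (-2 - ((D.push t B T k l).rot2 (D.high₂ t T, t.rightLine) + _) +
    2 * (t.leftSign * (D.push t B T k l).weight (D.high₁ t T)))
  rw [(h.rot2_push k l).1, (h.rot2_push k l).2, h.push_weight_high₁, hhigh₁]
  unfold SlideType.low at ha ⊢
  linear_combination -ha - 2 * l * t.rightSign_mul_self

end Cap

theorem Bigon.slid_eq_gauge (h : D.Bigon t B T) (a k l : ℤ) :
    D.slid t B T (D.high₂ t T) (D.low₂ t B) a =
      ((D.push t B T k l).slid t B T (D.low₂ t B) (D.high₂ t T)
        (-(a + t.mid) + l - t.leftSign * t.rightSign * k)).gauge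
          fun v => t.leftSign * k * (delta v B + delta v T) := by
  unfold slid VDiagram.gauge
  congr 1
  funext s
  have hmid : delta s (D.mid₂ t B T) = delta s ((D.push t B T k l).mid₂ t B T) := rfl
  linear_combination (-t.leftSign * k) * h.delta_gauge s + t.mid * hmid +
    k * (delta s (D.high₁ t T) - delta s (D.low₁ t B)) * t.leftSign_mul_self

theorem Bigon.kind_slid_ne_zero (h : D.Bigon t B T) {near far : D.V × Bool} {a : ℤ} {v : D.V}
    (hv : v = B ∨ v = T) : (D.slid t B T near far a).kind v ≠ 0 := by
  classical
  have hsign := t.bottomSign_ne_zero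
  rcases hv with rfl | rfl
  · simpa [slid, h.ne] using hsign
  · simpa [slid] using hsign

/-- Pushing the weights of the strands up reduces to the case that they vanish at and below the two
crossings. There framedness of the cell between the strands determines the weight of the move, and
the result differs from the asserted one by H-moves at the two crossings. -/
theorem Cap.reach_slid {g : D.Germ} (h : D.Cap t B T g) {a : ℤ}
    (hshift : ∀ v, v = B ∨ v = T → ∀ w b u,
      IntegralOGraph.mk (D.withWeight (D.shift (v, b) u w)) = IntegralOGraph.mk (D.withWeight w))
    (hmid₁ : D.weight (D.mid₁ t B T) = 0) (hmid₂ : D.weight (D.mid₂ t B T) = 0)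
    (hhigh₁ : D.weight (D.high₁ t T) = 0)
    (ha : 2 * a = t.low (D.rot2 (D.high₂ t T, t.rightLine) + D.rot2 g))
    (hD : D.FramedNormal) (hD' : (D.slid t B T (D.high₂ t T) (D.low₂ t B) a).FramedNormal) :
    Reach D (D.slid t B T (D.high₂ t T) (D.low₂ t B) a) := by
  obtain ⟨k, l, hlow₁, hlow₂⟩ := h.exists_push_weight_low_eq_zero
  have hmk := h.toBigon.push_mk_eq hshift k l
  have hpush : (D.push t B T k l).FramedNormal := by
    rwa [← isFramed_mk_iff, hmk, isFramed_mk_iff]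
  have hslide := h.slide_push hmid₁ hmid₂ hhigh₁ ha hpush.2 hlow₁ hlow₂
  rw [h.toBigon.slid_eq_gauge a k l] at hD' ⊢
  rw [gauge_framedNormal_iff] at hD'
  refine (Reach.of_eq hmk.symm).trans
    ((Reach.of_basicMove hpush hD' (.slide t ⟨_, _, rfl, rfl, hslide⟩)).trans
      (reach_gauge hD' fun v hv => ?_))
  have hB : v ≠ B := fun e => (h.push k l).toBigon.kind_slid_ne_zero (.inl e) hv
  have hT : v ≠ T := fun e => (h.push k l).toBigon.kind_slid_ne_zero (.inr e) hv
  rw [delta_of_ne hB, delta_of_ne hT, add_zero, mul_zero]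

end Slide

end VDiagram

namespace Tangle

variable {n : ℕ}

/-! ### Pure sliding moves in tangles -/

section Slide

variable (T : Tangle n) (t : SlideType) (r : Bool) (B C : Fin n)

/-- Add `u` to the weight of an edge. -/
def addWt (x : Passage n ⊕ Fin 3) (u : ℤ) : Tangle n :=
  { T with
    wt := fun p => T.wt p + if .inl p = x then u else 0
    win := fun j => T.win j + if .inr j = x then u else 0 }

/-- The edge below the crossing `B` on a vertical strand. -/
def lowPart (b up : Bool) : Passage n ⊕ Fin 3 := if up then T.back (B, b) else .inl (B, b)

/-- The edge between the crossings `B` and `C` on a vertical strand, given by its first passage. -/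
def midPart (b up : Bool) : Passage n := if up then (B, b) else (C, b)

/-- The edge above the crossing `C` on a vertical strand. -/
def highPart (b up : Bool) : Passage n ⊕ Fin 3 := if up then .inl (C, b) else T.back (C, b)

/-- The end of the left strand of a sliding move on the side of the path: the edge below the two
crossings, or above them if `r = true`. -/
def nearLeft : Passage n ⊕ Fin 3 :=
  if r then T.highPart C t.leftOver t.leftUp else T.lowPart B t.leftOver t.leftUp

/-- The end of the left strand opposite to `nearLeft`. -/
def farLeft : Passage n ⊕ Fin 3 :=
  if r then T.lowPart B t.leftOver t.leftUp else T.highPart C t.leftOver t.leftUp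

/-- The end of the right strand of a sliding move on the side of the path. -/
def nearRight : Passage n ⊕ Fin 3 :=
  if r then T.highPart C (!t.leftOver) t.rightUp else T.lowPart B (!t.leftOver) t.rightUp

/-- The end of the right strand opposite to `nearRight`. -/
def farRight : Passage n ⊕ Fin 3 :=
  if r then T.lowPart B (!t.leftOver) t.rightUp else T.highPart C (!t.leftOver) t.rightUp

/-- The edge between the two crossings on the left strand. -/
def midLeft : Passage n := midPart B C t.leftOver t.leftUp

/-- The edge between the two crossings on the right strand. -/
def midRight : Passage n := midPart B C (!t.leftOver) t.rightUp

/-- The tangle after a pure sliding move, where `a` is the weight added to the right strand next to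
the path. -/
def slide (a : ℤ) : Tangle n :=
  { ((T.addWt (T.nearRight t r B C) a).addWt (.inl (midRight t B C)) t.mid).addWt
      (T.farRight t r B C) (-(a + t.mid)) with
    sign := update (update T.sign B t.bottomSign) C (-t.bottomSign) }

/-- Both ends of the edge are in the tangle. -/
def inner (x : Passage n ⊕ Fin 3) : Bool := Sum.elim (fun p => (T.next p).isLeft) (fun _ => false) x

/-- The line where the path of a sliding move starts: the path leaves the left strand downwards
and enters the right one upwards, or conversely if it runs above the crossings. -/
def pathStart : Line n :=
  if r then (T.nearRight t r B C, t.rightLine) else (T.nearLeft t r B C, t.leftLine)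

/-- The line where the path of a sliding move ends. -/
def pathEnd : Line n :=
  if r then (T.nearLeft t r B C, t.leftLine) else (T.nearRight t r B C, t.rightLine)

/-- The edges between the two crossings, the ends of the two strands near the path, and the edge
`x` of the path. -/
def cell (x : Passage n ⊕ Fin 3) : List (Passage n ⊕ Fin 3) :=
  [.inl (midLeft t B C), .inl (midRight t B C), T.nearLeft t r B C, T.nearRight t r B C, x]

/-- The conditions for a pure sliding move with a path through the line `g`. -/
structure CanSlide (g : Line n) (a : ℤ) : Prop where
  ne : B ≠ C
  sign_bot : T.sign B = 0
  sign_top : T.sign C = 0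
  next_midLeft : T.next (midLeft t B C) = .inl (midPart C B t.leftOver t.leftUp)
  next_midRight : T.next (midRight t B C) = .inl (midPart C B (!t.leftOver) t.rightUp)
  wt_eq_zero : ∀ p, T.wt p = 0
  inner_cell : ∀ x ∈ T.cell t r B C g.1, T.inner x = true
  nodup_cell : (T.cell t r B C g.1).Nodup
  inner_far : r = true → T.inner (T.farLeft t r B C) = false ∧ T.inner (T.farRight t r B C) = false
  step_start : (T.arrive (T.pathStart t r B C)).map T.step = some g
  step_path : (T.arrive g).map T.step = some (T.pathEnd t r B C)
  weight_eq : 2 * a = t.low (turn2 (T.pathStart t r B C).2 g.2 + turn2 g.2 (T.pathEnd t r B C).2)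

instance (g : Line n) (a : ℤ) : Decidable (T.CanSlide t r B C g a) :=
  decidable_of_iff (B ≠ C ∧ T.sign B = 0 ∧ T.sign C = 0 ∧
    T.next (midLeft t B C) = .inl (midPart C B t.leftOver t.leftUp) ∧
    T.next (midRight t B C) = .inl (midPart C B (!t.leftOver) t.rightUp) ∧
    (∀ p, T.wt p = 0) ∧ (∀ x ∈ T.cell t r B C g.1, T.inner x = true) ∧
    (T.cell t r B C g.1).Nodup ∧
    (r = true → T.inner (T.farLeft t r B C) = false ∧ T.inner (T.farRight t r B C) = false) ∧
    (T.arrive (T.pathStart t r B C)).map T.step = some g ∧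
    (T.arrive g).map T.step = some (T.pathEnd t r B C) ∧
    2 * a = t.low (turn2 (T.pathStart t r B C).2 g.2 + turn2 g.2 (T.pathEnd t r B C).2))
    ⟨fun ⟨h₁, h₂, h₃, h₄, h₅, h₆, h₇, h₈, h₉, h₁₀, h₁₁, h₁₂⟩ =>
      ⟨h₁, h₂, h₃, h₄, h₅, h₆, h₇, h₈, h₉, h₁₀, h₁₁, h₁₂⟩,
    fun ⟨h₁, h₂, h₃, h₄, h₅, h₆, h₇, h₈, h₉, h₁₀, h₁₁, h₁₂⟩ =>
      ⟨h₁, h₂, h₃, h₄, h₅, h₆, h₇, h₈, h₉, h₁₀, h₁₁, h₁₂⟩⟩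

end Slide

variable {T : Tangle n} (h : T.Valid) (O : Outside)

theorem exists_of_inner {x : Passage n ⊕ Fin 3} (hx : T.inner x = true) :
    ∃ p q, x = .inl p ∧ T.next p = .inl q := by
  rcases x with p | j
  · obtain ⟨q, hq⟩ := Sum.isLeft_iff.1 hx
    exact ⟨p, q, rfl, hq⟩
  · cases hx

theorem edge_eq_of_inner {x y : Passage n ⊕ Fin 3} (hx : T.inner x = true)
    (hxy : edge h O x = edge h O y) : x = y := by
  obtain ⟨p, q, rfl, hp⟩ := exists_of_inner hx
  rcases y with p' | j
  · exact congrArg _ (Sum.inl_injective ((T.port h O).injective hxy))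
  · have hout : (.inl p : Passage n ⊕ (O.W × Bool)) = T.out (O.link.symm (.inr j)) :=
      (T.port h O).injective hxy
    generalize O.link.symm (.inr j) = y at hout
    rcases y with z | k
    · cases hout
    · rw [Sum.inl_injective hout, h.next_last] at hp
      cases hp

theorem weight_edge_of_inner {x : Passage n ⊕ Fin 3} (hx : T.inner x = true)
    (hwt : ∀ p, T.wt p = 0) : (T.closure h O).weight (edge h O x) = 0 := by
  obtain ⟨p, q, rfl, hp⟩ := exists_of_inner hx
  rw [edge_inl, weight_port, Code.joinWt_inl _ _ _ _ hp, hwt]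

theorem succ_line_of_map {g g' : Line n} (hg : (T.arrive g).map T.step = some g') :
    (T.closure h O).succ (line h O g) = line h O g' := by
  obtain ⟨a, ha, rfl⟩ := Option.map_eq_some_iff.1 hg
  rw [succ_eq, arrival_line h O ha, depart_port_inl]

theorem rot2_line_of_map {g g' : Line n} (hg : (T.arrive g).map T.step = some g')
    (hinner : T.inner g.1 = true) (hwt : ∀ p, T.wt p = 0) :
    (T.closure h O).rot2 (line h O g) = turn2 g.2 g'.2 := by
  have hweight := weight_edge_of_inner h O hinner hwt
  rw [rot2, succ_line_of_map h O hg, along]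
  simp [line, hweight]

theorem delta_port_out (x : Passage n ⊕ Fin 3) (y : O.End) :
    delta (T.port h O (T.out y)) (edge h O x) =
      Sum.elim (fun _ => 0) (fun j => delta (.inl (T.last j)) x) y +
        Sum.elim (fun _ => 0) (fun i => delta (.inr i) x) (O.link y) := by
  rcases x with p | i
  · have hlink : Sum.elim (fun _ => 0) (fun i => delta (.inr i) (.inl p : Passage n ⊕ Fin 3))
        (O.link y) = 0 := by
      rcases O.link y with z | j <;> simp [delta]
    rw [hlink, edge_inl, delta_apply]
    rcases y with z | j <;> simp [delta, Code.out]
  · have hlast : Sum.elim (fun _ => 0)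
        (fun j => delta (.inl (T.last j)) (.inr i : Passage n ⊕ Fin 3))
        y = 0 := by
      rcases y with z | j <;> simp [delta]
    have hiff := T.port_out_eq_edge_iff h O (y := y) (j := i)
    rw [hlast, delta, hiff]
    rcases O.link y with z | j <;> simp [delta]

theorem weight_addWt_out (x : Passage n ⊕ Fin 3) (u : ℤ) (y : O.End) :
    T.joinWt O.link (T.addWt x u).wt (T.addWt x u).win O.weight (T.out y) =
      (T.closure h O).weight (T.port h O (T.out y)) +
        u * delta (T.port h O (T.out y)) (edge h O x) := by
  rw [weight_port, delta_port_out, Code.joinWt_out h, Code.joinWt_out h]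
  rcases y with z | j <;> rcases O.link _ with z' | i <;>
    simp [addWt, ite_eq_mul_delta] <;> ring

theorem weight_addWt_inl (x : Passage n ⊕ Fin 3) (u : ℤ) {p q : Passage n}
    (hp : T.next p = .inl q) :
    T.joinWt O.link (T.addWt x u).wt (T.addWt x u).win O.weight (.inl p) =
      (T.closure h O).weight (T.port h O (.inl p)) +
        u * delta (T.port h O (.inl p)) (edge h O x) := by
  have hinner : T.inner (.inl p) = true := by simp [inner, hp]
  have hdelta : delta (T.port h O (.inl p)) (edge h O x) = delta (.inl p) x := by
    have hiff : T.port h O (.inl p) = edge h O x ↔ .inl p = x :=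
      ⟨edge_eq_of_inner h O hinner, fun hx => hx ▸ rfl⟩
    rw [delta, hiff]
    rfl
  rw [weight_port, hdelta, Code.joinWt_inl _ _ _ _ hp, Code.joinWt_inl _ _ _ _ hp]
  simp only [addWt, ite_eq_mul_delta]

theorem weight_addWt (x : Passage n ⊕ Fin 3) (u : ℤ) (s : (T.closure h O).V × Bool) :
    ((T.addWt x u).closure h O).weight s =
      (T.closure h O).weight s + u * delta s (edge h O x) := by
  obtain ⟨s, rfl⟩ := (T.port h O).surjective s
  refine ((T.addWt x u).weight_port h O s).trans ?_
  rcases h.eq_out_or_next s with ⟨y, rfl⟩ | ⟨p, q, rfl, hp⟩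
  · exact weight_addWt_out h O x u y
  · exact weight_addWt_inl h O x u hp

theorem closure_slide (t : SlideType) (r : Bool) (B C : Fin n) (a : ℤ) :
    (T.slide t r B C a).closure h O =
      (T.closure h O).slid t (T.vert h O (.inl B)) (T.vert h O (.inl C))
        (edge h O (T.nearRight t r B C)) (edge h O (T.farRight t r B C)) a := by
  have hvert {i j : Fin n} : T.vert h O (.inl i) ≠ T.vert h O (.inl j) ↔ i ≠ j :=
    (T.vert h O).injective.ne_iff.trans Sum.inl_injective.ne_iff
  have hmid : edge h O (.inl (midRight t B C)) =
      (T.closure h O).mid₂ t (T.vert h O (.inl B)) (T.vert h O (.inl C)) := by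
    cases t <;> rfl
  refine (Eq.trans (slid_eq (D := T.closure h O)
    (kind := ((T.slide t r B C a).closure h O).kind)
    (weight := ((T.slide t r B C a).closure h O).weight) ?_ ?_ ?_ ?_) rfl).symm
  · exact update_self ..
  · intro hne
    exact (update_of_ne (hvert.1 hne) ..).trans (update_self ..)
  · intro v hB hC
    obtain ⟨i | w, rfl⟩ := (T.vert h O).surjective v
    · exact (update_of_ne (hvert.1 hC) ..).trans (update_of_ne (hvert.1 hB) ..)
    · rfl
  · intro s
    let S := T.addWt (T.nearRight t r B C) a
    let S' := S.addWt (.inl (midRight t B C)) t.mid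
    have hnear : (S.closure h O).weight s =
        (T.closure h O).weight s + a * delta s (edge h O (T.nearRight t r B C)) :=
      weight_addWt h O _ a s
    have hmidRight : (S'.closure h O).weight s =
        (S.closure h O).weight s + t.mid * delta s (edge h O (.inl (midRight t B C))) :=
      weight_addWt (T := S) h O _ t.mid s
    have hfar : ((T.slide t r B C a).closure h O).weight s =
        (S'.closure h O).weight s + -(a + t.mid) * delta s (edge h O (T.farRight t r B C)) :=
      weight_addWt (T := S') h O _ _ s
    rw [← hmid]
    linear_combination hfar + hmidRight + hnear

theorem lowEdge_vert (B : Fin n) (b up : Bool) :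
    (T.closure h O).lowEdge (T.vert h O (.inl B)) b up = edge h O (T.lowPart B b up) := by
  cases up
  · rfl
  · exact symm_port_inl h O (B, b)

theorem highEdge_vert (B : Fin n) (b up : Bool) :
    (T.closure h O).highEdge (T.vert h O (.inl B)) b up = edge h O (T.highPart B b up) := by
  cases up
  · exact symm_port_inl h O (B, b)
  · rfl

theorem midEdge_vert (B C : Fin n) (b up : Bool) :
    (T.closure h O).midEdge (T.vert h O (.inl B)) (T.vert h O (.inl C)) b up =
      edge h O (.inl (midPart B C b up)) := by
  cases up <;> rfl

theorem passes_vert {B C : Fin n} {b up : Bool}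
    (hnext : T.next (midPart B C b up) = .inl (midPart C B b up)) :
    (T.closure h O).Passes (T.vert h O (.inl B)) (T.vert h O (.inl C)) b up := by
  rw [Passes, midEdge_vert, edge_inl, next_port_inl h O hnext]
  cases up <;> rfl

namespace CanSlide

variable {t : SlideType} {r : Bool} {B C : Fin n} {g : Line n} {a : ℤ}

theorem bigon (H : T.CanSlide t r B C g a) :
    (T.closure h O).Bigon t (T.vert h O (.inl B)) (T.vert h O (.inl C)) where
  ne := fun e => H.ne (Sum.inl_injective ((T.vert h O).injective e))
  kind_bot := H.sign_bot
  kind_top := H.sign_top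
  left := passes_vert h O H.next_midLeft
  right := passes_vert h O H.next_midRight

theorem weight_cell (H : T.CanSlide t r B C g a) {x : Passage n ⊕ Fin 3}
    (hx : x ∈ T.cell t r B C g.1) : (T.closure h O).weight (edge h O x) = 0 :=
  weight_edge_of_inner h O (H.inner_cell x hx) H.wt_eq_zero

theorem rot2_path (H : T.CanSlide t r B C g a) :
    (T.closure h O).rot2 (line h O (T.pathStart t r B C)) + (T.closure h O).rot2 (line h O g) =
      turn2 (T.pathStart t r B C).2 g.2 + turn2 g.2 (T.pathEnd t r B C).2 := by
  have hstart : T.inner (T.pathStart t r B C).1 = true := by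
    refine H.inner_cell _ ?_
    cases r <;> simp [cell, pathStart]
  rw [rot2_line_of_map h O H.step_start hstart H.wt_eq_zero,
    rot2_line_of_map h O H.step_path (H.inner_cell _ (by simp [cell])) H.wt_eq_zero]

theorem cap (H : T.CanSlide t true B C g a) :
    (T.closure h O).Cap t (T.vert h O (.inl B)) (T.vert h O (.inl C)) (line h O g) := by
  have hmap : [(T.closure h O).mid₁ t (T.vert h O (.inl B)) (T.vert h O (.inl C)),
      (T.closure h O).mid₂ t (T.vert h O (.inl B)) (T.vert h O (.inl C)),
      (T.closure h O).high₁ t (T.vert h O (.inl C)), (T.closure h O).high₂ t (T.vert h O (.inl C)),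
      (line h O g).1] = (T.cell t true B C g.1).map (edge h O) := by
    rw [mid₁, mid₂, high₁, high₂, midEdge_vert, midEdge_vert, highEdge_vert, highEdge_vert]
    rfl
  have hnotMem {x : Passage n ⊕ Fin 3} (hx : T.inner x = false) :
      edge h O x ∉ (T.cell t true B C g.1).map (edge h O) := by
    intro hmem
    obtain ⟨y, hy, hxy⟩ := List.mem_map.1 hmem
    have hinner := H.inner_cell y hy
    rw [edge_eq_of_inner h O hinner hxy, hx] at hinner
    cases hinner
  refine ⟨H.bigon h O, ?_, ?_, ?_, ?_, ?_⟩
  · rw [high₂, highEdge_vert]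
    exact succ_line_of_map h O H.step_start
  · rw [high₁, highEdge_vert]
    exact succ_line_of_map h O H.step_path
  · rw [hmap]
    exact H.nodup_cell.map_on fun x hx y _ hxy => edge_eq_of_inner h O (H.inner_cell x hx) hxy
  · rw [hmap, low₁, lowEdge_vert]
    exact hnotMem (H.inner_far rfl).1
  · rw [hmap, low₂, lowEdge_vert]
    exact hnotMem (H.inner_far rfl).2

theorem reach_of_path_below (H : T.CanSlide t false B C g a)
    (hD : (T.closure h O).FramedNormal)
    (hD' : ((T.slide t false B C a).closure h O).FramedNormal) :
    Reach (T.closure h O) ((T.slide t false B C a).closure h O) := by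
  have hleft : (T.closure h O).low₁ t (T.vert h O (.inl B)) =
    edge h O (T.nearLeft t false B C) := lowEdge_vert h O ..
  have hright : (T.closure h O).low₂ t (T.vert h O (.inl B)) =
    edge h O (T.nearRight t false B C) := lowEdge_vert h O ..
  have hfar : (T.closure h O).high₂ t (T.vert h O (.inl C)) =
    edge h O (T.farRight t false B C) := highEdge_vert h O ..
  have hnodup := H.nodup_cell
  simp only [cell, List.nodup_cons, List.mem_cons, not_or] at hnodup
  rw [closure_slide, ← hright, ← hfar] at hD' ⊢
  refine (H.bigon h O).reach_slid (g := line h O g) ?_ ?_ ?_ ?_ ?_ ?_ ?_ ?_ ?_ hD hD'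
  · rw [hleft]
    exact H.weight_cell h O (by simp [cell])
  · rw [mid₁, midEdge_vert]
    exact H.weight_cell h O (List.mem_cons_self ..)
  · rw [hright]
    exact H.weight_cell h O (by simp [cell])
  · rw [mid₂, midEdge_vert]
    exact H.weight_cell h O (List.mem_cons_of_mem _ (List.mem_cons_self ..))
  · rw [hleft]
    exact succ_line_of_map h O H.step_start
  · rw [hright]
    exact succ_line_of_map h O H.step_path
  · rw [hleft]
    intro e
    exact hnodup.2.2.1.2.1 (edge_eq_of_inner h O (H.inner_cell _ (by simp [cell])) e).symm
  · rw [hleft, hright]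
    intro e
    exact hnodup.2.2.1.1 (edge_eq_of_inner h O (H.inner_cell _ (by simp [cell])) e).symm
  · rw [hleft]
    exact H.weight_eq.trans (congrArg _ (H.rot2_path h O).symm)

theorem reach_of_path_above (H : T.CanSlide t true B C g a)
    (hshift : ∀ v, v = T.vert h O (.inl B) ∨ v = T.vert h O (.inl C) → ∀ w b u,
      IntegralOGraph.mk ((T.closure h O).withWeight ((T.closure h O).shift (v, b) u w)) =
        IntegralOGraph.mk ((T.closure h O).withWeight w))
    (hD : (T.closure h O).FramedNormal)
    (hD' : ((T.slide t true B C a).closure h O).FramedNormal) :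
    Reach (T.closure h O) ((T.slide t true B C a).closure h O) := by
  have hleft : (T.closure h O).high₁ t (T.vert h O (.inl C)) =
    edge h O (T.nearLeft t true B C) := highEdge_vert h O ..
  have hright : (T.closure h O).high₂ t (T.vert h O (.inl C)) =
    edge h O (T.nearRight t true B C) := highEdge_vert h O ..
  have hfar : (T.closure h O).low₂ t (T.vert h O (.inl B)) =
    edge h O (T.farRight t true B C) := lowEdge_vert h O ..
  rw [closure_slide, ← hright, ← hfar] at hD' ⊢
  refine (H.cap h O).reach_slid hshift ?_ ?_ ?_ ?_ hD hD'
  · rw [mid₁, midEdge_vert]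
    exact H.weight_cell h O (List.mem_cons_self ..)
  · rw [mid₂, midEdge_vert]
    exact H.weight_cell h O (List.mem_cons_of_mem _ (List.mem_cons_self ..))
  · rw [hleft]
    exact H.weight_cell h O (by simp [cell])
  · rw [hright]
    exact H.weight_eq.trans (congrArg _ (H.rot2_path h O).symm)

theorem reach (H : T.CanSlide t r B C g a)
    (hshift : r = true → ∀ v, v = T.vert h O (.inl B) ∨ v = T.vert h O (.inl C) → ∀ w b u,
      IntegralOGraph.mk ((T.closure h O).withWeight ((T.closure h O).shift (v, b) u w)) =
        IntegralOGraph.mk ((T.closure h O).withWeight w))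
    (hD : (T.closure h O).FramedNormal) (hD' : ((T.slide t r B C a).closure h O).FramedNormal) :
    Reach (T.closure h O) ((T.slide t r B C a).closure h O) := by
  cases r
  · exact H.reach_of_path_below h O hD hD'
  · exact H.reach_of_path_above h O (hshift rfl) hD hD'

end CanSlide

end Tangle

/-! ### Replacing tangles by detours -/

namespace Tangle

section Decidable

variable {k n : ℕ}

instance (T : Tangle n) : Decidable T.Weightless :=
  decidable_of_iff ((∀ p, T.wt p = 0) ∧ ∀ j, T.win j = 0) ⟨fun h => ⟨h.1, h.2⟩, fun h => ⟨h.1, h.2⟩⟩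

set_option synthInstance.maxSize 2000 in
instance (T : Tangle k) (T' : Tangle n) (e : Fin k ⊕ Unit → Fin n)
    (loc : Bool → Passage k ⊕ Fin 3) : Decidable (IsRefined T T' e loc) :=
  decidable_of_iff (Bijective e ∧ loc true ≠ loc false ∧ (∀ i, T'.sign (e (.inl i)) = T.sign i) ∧
    T'.sign (e (.inr ())) = 0 ∧ T.Weightless ∧ T'.Weightless ∧
    (∀ p, loc true ≠ .inl p → loc false ≠ .inl p →
      T'.next (oldPassage e p) = Sum.map (oldPassage e) id (T.next p)) ∧
    (∀ p b, loc b = .inl p → T'.next (oldPassage e p) = .inl (newPassage e b)) ∧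
    (∀ p b, loc b = .inl p → T'.next (newPassage e b) = Sum.map (oldPassage e) id (T.next p)) ∧
    (∀ j, loc true ≠ .inr j → loc false ≠ .inr j → T'.first j = oldPassage e (T.first j)) ∧
    (∀ j b, loc b = .inr j → T'.first j = newPassage e b) ∧
    ∀ j b, loc b = .inr j → T'.next (newPassage e b) = .inl (oldPassage e (T.first j)))
    ⟨fun ⟨h₁, h₂, h₃, h₄, h₅, h₆, h₇, h₈, h₉, h₁₀, h₁₁, h₁₂⟩ =>
      ⟨h₁, h₂, h₃, h₄, h₅, h₆, h₇, h₈, h₉, h₁₀, h₁₁, h₁₂⟩,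
    fun ⟨h₁, h₂, h₃, h₄, h₅, h₆, h₇, h₈, h₉, h₁₀, h₁₁, h₁₂⟩ =>
      ⟨h₁, h₂, h₃, h₄, h₅, h₆, h₇, h₈, h₉, h₁₀, h₁₁, h₁₂⟩⟩

instance (A : Annulus) (S : Tangle k) (T : Tangle n) (e : Fin k ⊕ Unit → Fin n) :
    Decidable (IsGlue A S T e) :=
  decidable_of_iff (Bijective e ∧ (∀ i, T.sign (e (.inl i)) = S.sign i) ∧
    T.sign (e (.inr ())) = A.sign ∧
    (∀ p q, S.next p = .inl q → T.next (oldPassage e p) = .inl (oldPassage e q)) ∧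
    (∀ p q, S.next p = .inl q → T.wt (oldPassage e p) = S.wt p) ∧
    (∀ a, T.next (S.glueLast e a) = Sum.map (S.glueFirst e) id (A.next a)) ∧
    (∀ a, T.wt (S.glueLast e a) =
      A.wt a + Sum.elim (fun _ => 0) (fun j => S.wt (S.last j)) a +
        Sum.elim (Sum.elim (fun _ => 0) S.win) (fun _ => 0) (A.next a)) ∧
    (∀ j, T.first j = S.glueFirst e (A.first j)) ∧
    ∀ j, T.win j = A.win j + Sum.elim (fun _ => 0) S.win (A.first j))
    ⟨fun ⟨h₁, h₂, h₃, h₄, h₅, h₆, h₇, h₈, h₉⟩ => ⟨h₁, h₂, h₃, h₄, h₅, h₆, h₇, h₈, h₉⟩,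
    fun ⟨h₁, h₂, h₃, h₄, h₅, h₆, h₇, h₈, h₉⟩ => ⟨h₁, h₂, h₃, h₄, h₅, h₆, h₇, h₈, h₉⟩⟩

end Decidable

variable {n : ℕ}

/-- Insert a virtual crossing `v` with its strand `b` inserted into the edge `loc b`. -/
def insert (T : Tangle n) (v : Fin (n + 1)) (loc : Bool → Passage n ⊕ Fin 3) : Tangle (n + 1) :=
  let inserted : Passage n ⊕ Fin 3 → List (Passage (n + 1)) := fun x =>
    (if loc true = x then [(v, true)] else []) ++ if loc false = x then [(v, false)] else []
  let strand : Fin 3 → List (Passage (n + 1)) := fun j =>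
    inserted (.inr j) ++
      (T.first j :: T.rest j).flatMap fun p => (v.succAbove p.1, p.2) :: inserted (.inl p)
  { first := fun j => (strand j).headD (v, true)
    rest := fun j => (strand j).tail
    sign := v.insertNth 0 T.sign
    wt := fun _ => 0
    win := fun _ => 0 }

/-- The identification of crossings for the insertion of a crossing `v`. -/
def insertMap (v : Fin (n + 1)) : Fin n ⊕ Unit → Fin (n + 1) := Sum.elim v.succAbove fun _ => v

/-- The open edge at the end (`x.1 = true`) or at the beginning of the strand `x.2`. -/
def openEdge (T : Tangle n) (x : Bool × Fin 3) : Passage n ⊕ Fin 3 :=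
  if x.1 then .inl (T.last x.2) else .inr x.2

theorem gauge_framedNormal {T : Tangle n} (h : T.Valid) (O : Outside) (f : Fin n → ℤ)
    (hD : (T.closure h O).FramedNormal) : ((T.gauge f).closure h O).FramedNormal := by
  rw [closure_gauge]
  exact (gauge_framedNormal_iff _ _).2 hD

theorem reach_gauge {T : Tangle n} (h : T.Valid) (O : Outside) (hT : ∀ i, T.sign i ≠ 0)
    (f : Fin n → ℤ) (hD : (T.closure h O).FramedNormal) :
    Reach (T.closure h O) ((T.gauge f).closure h O) := by
  rw [closure_gauge]
  refine IntegralOGraph.reach_gauge hD ?_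
  rintro (i | x) hv
  · exact absurd hv (hT i)
  · rfl

/-- The tangle `T` can be replaced by `T'` by a sequence of moves. -/
def Replaceable {n' : ℕ} (T : Tangle n) (T' : Tangle n') (h : T.Valid) (h' : T'.Valid) : Prop :=
  ∀ O, (T.closure h O).FramedNormal → Reach (T.closure h O) (T'.closure h' O)

end Tangle

/-- The data of a way to replace a tangle `T` with two crossings by a tangle `T'` with three. First
slide the open edge `left` of `T` over the open edge `right`, along a path which runs above the two
new crossings if `above`. Of the four crossings, one then belongs to `annulus`, and the other ones
form a tangle to which the inverse of a known move `R ⟶ R'` applies; `T'` consists of `R` and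
`annulus`. The integers say how to adjust the weights by H-moves. -/
structure Detour where
  slideType : SlideType
  above : Bool
  left : Bool × Fin 3
  right : Bool × Fin 3
  annulus : Annulus
  gaugeSlid : Fin 4 → ℤ := 0
  crossings : Fin 3 ⊕ Unit → Fin 4
  gaugeAfter : Fin 3 → ℤ := 0
  crossingsAfter : Fin 2 ⊕ Unit → Fin 3

namespace Detour

open Tangle

variable (d : Detour) (T : Tangle 2)

/-- The open edge which becomes the strand `b` of the new crossings. -/
def moved (b : Bool) : Bool × Fin 3 := if b = d.slideType.leftOver then d.left else d.right

/-- The edge into which the strand `b` of a first virtual crossing is inserted. -/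
def firstLoc (b : Bool) : Passage 2 ⊕ Fin 3 := T.openEdge (d.moved b)

/-- The tangle with one virtual crossing of the two open edges. -/
def cross : Tangle 3 := T.insert 2 (d.firstLoc T)

/-- The edge into which the strand `b` of a second virtual crossing is inserted, nearer to the old
crossings than the first one if `near`. -/
def secondLoc (near : Bool) (b : Bool) : Passage 3 ⊕ Fin 3 :=
  let x := d.moved b
  if near = x.1 then
    if near then .inl ((T.last x.2).1.castSucc, (T.last x.2).2) else .inr x.2
  else .inl (2, b)

/-- The tangle with two virtual crossings of the two open edges, `2` below and `3` above. -/
def bigon : Tangle 4 := (d.cross T).insert 3 (d.secondLoc T d.above)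

/-- The line in the middle of the path of the sliding move. -/
def pathLine : Line 4 :=
  (((d.bigon T).arrive ((d.bigon T).pathStart d.slideType d.above 2 3)).map
    (d.bigon T).step).getD (.inr 0, 0)

/-- The weight which the sliding move adds to the right strand next to the path. -/
def pathWeight : ℤ :=
  d.slideType.low (turn2 ((d.bigon T).pathStart d.slideType d.above 2 3).2 (d.pathLine T).2 +
    turn2 (d.pathLine T).2 ((d.bigon T).pathEnd d.slideType d.above 2 3).2) / 2

/-- The tangle after the sliding move. -/
def slid : Tangle 4 := (d.bigon T).slide d.slideType d.above 2 3 (d.pathWeight T)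

/-- The conditions under which the detour `d` replaces `T` by `T'` with the inverse of a move which
replaces `R` by `R'`. -/
structure IsValid (T' : Tangle 3) (R : Tangle 2) (R' : Tangle 3) : Prop where
  valid_annulus : d.annulus.Valid
  valid_cross : (d.cross T).Valid
  valid_bigon : (d.bigon T).Valid
  refined_cross : IsRefined T (d.cross T) (insertMap 2) (d.firstLoc T)
  refined_top : IsRefined (d.cross T) (d.bigon T) (insertMap 3) (d.secondLoc T d.above)
  refined_bot : IsRefined (d.cross T) (d.bigon T) (insertMap 2) (d.secondLoc T !d.above)
  canSlide : (d.bigon T).CanSlide d.slideType d.above 2 3 (d.pathLine T) (d.pathWeight T)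
  similar_slid : T.Similar (d.slid T)
  similar : T.Similar T'
  glue_slid : IsGlue d.annulus R' ((d.slid T).gauge d.gaugeSlid) d.crossings
  glue : IsGlue d.annulus R (T'.gauge d.gaugeAfter) d.crossingsAfter

instance (T' : Tangle 3) (R : Tangle 2) (R' : Tangle 3) : Decidable (d.IsValid T T' R R') :=
  decidable_of_iff (d.annulus.Valid ∧ (d.cross T).Valid ∧ (d.bigon T).Valid ∧
    IsRefined T (d.cross T) (insertMap 2) (d.firstLoc T) ∧
    IsRefined (d.cross T) (d.bigon T) (insertMap 3) (d.secondLoc T d.above) ∧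
    IsRefined (d.cross T) (d.bigon T) (insertMap 2) (d.secondLoc T !d.above) ∧
    (d.bigon T).CanSlide d.slideType d.above 2 3 (d.pathLine T) (d.pathWeight T) ∧
    T.Similar (d.slid T) ∧ T.Similar T' ∧
    IsGlue d.annulus R' ((d.slid T).gauge d.gaugeSlid) d.crossings ∧
    IsGlue d.annulus R (T'.gauge d.gaugeAfter) d.crossingsAfter)
    ⟨fun ⟨h₁, h₂, h₃, h₄, h₅, h₆, h₇, h₈, h₉, h₁₀, h₁₁⟩ =>
      ⟨h₁, h₂, h₃, h₄, h₅, h₆, h₇, h₈, h₉, h₁₀, h₁₁⟩,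
    fun ⟨h₁, h₂, h₃, h₄, h₅, h₆, h₇, h₈, h₉, h₁₀, h₁₁⟩ =>
      ⟨h₁, h₂, h₃, h₄, h₅, h₆, h₇, h₈, h₉, h₁₀, h₁₁⟩⟩

variable {d T} {T' : Tangle 3} {R : Tangle 2} {R' : Tangle 3}

namespace IsValid

theorem mk_closure_bigon (H : d.IsValid T T' R R') (hT : T.Valid) (O : Outside) :
    IntegralOGraph.mk (T.closure hT O) =
      IntegralOGraph.mk ((d.bigon T).closure H.valid_bigon O) :=
  (H.refined_cross.refines hT H.valid_cross O).mk_eq.trans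
    (H.refined_top.refines H.valid_cross H.valid_bigon O).mk_eq

theorem reach_slid (H : d.IsValid T T' R R') (hT : T.Valid) (O : Outside)
    (hO : (T.closure hT O).FramedNormal) :
    Reach (T.closure hT O) ((d.slid T).closure H.valid_bigon O) := by
  have hmk := H.mk_closure_bigon hT O
  have hbigon : ((d.bigon T).closure H.valid_bigon O).FramedNormal := by
    rwa [← isFramed_mk_iff, ← hmk, isFramed_mk_iff]
  refine (Reach.of_eq hmk).trans (H.canSlide.reach H.valid_bigon O (fun _ => ?_) hbigon
    (H.similar_slid.framedNormal hT _ hO))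
  rintro _ (rfl | rfl) w b u
  · exact (H.refined_bot.refines H.valid_cross H.valid_bigon O).shift_mk_eq w b u
  · exact (H.refined_top.refines H.valid_cross H.valid_bigon O).shift_mk_eq w b u

theorem replaceable (H : d.IsValid T T' R R') {hT : T.Valid} {hT' : T'.Valid} {hR : R.Valid}
    {hR' : R'.Valid} (hRR' : Replaceable R R' hR hR') : Replaceable T T' hT hT' := by
  intro O hO
  have hslid : ((d.slid T).closure H.valid_bigon O).FramedNormal :=
    H.similar_slid.framedNormal hT _ hO
  have hT'O : (T'.closure hT' O).FramedNormal := H.similar.framedNormal hT hT' hO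
  have isoSlid := H.glue_slid.iso H.valid_annulus H.valid_bigon O hR'
  have isoAfter := H.glue.iso H.valid_annulus hT' O hR
  have hR0 : (R.closure hR (d.annulus.outside H.valid_annulus O)).FramedNormal :=
    isoAfter.framedNormal_iff.2 (gauge_framedNormal hT' O d.gaugeAfter hT'O)
  have reach_R' : Reach (T.closure hT O) (R'.closure hR' (d.annulus.outside H.valid_annulus O)) :=
    (H.reach_slid hT O hO).trans ((Tangle.reach_gauge (T := d.slid T) H.valid_bigon O
      H.similar_slid.sign_ne_zero d.gaugeSlid hslid).trans (Reach.of_iso isoSlid).symm)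
  have reach_T' : Reach (R.closure hR (d.annulus.outside H.valid_annulus O)) (T'.closure hT' O) :=
    (Reach.of_iso isoAfter).trans
      (Tangle.reach_gauge hT' O H.similar.sign_ne_zero d.gaugeAfter hT'O).symm
  exact reach_R'.trans ((hRR' _ hR0).symm.trans reach_T')

end IsValid

end Detour

/-! ### The sixteen moves -/

theorem IsClosure.reach_gauge {n : ℕ} {T : OTangle n} {O : Outside} {D : VDiagram}
    {φ : Fin n ⊕ O.W ≃ D.V} (hclosure : IsClosure T O D φ) (hT : ∀ i, T.sign i ≠ 0)
    (f : Fin n → ℤ) (hD : D.FramedNormal) :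
    Reach D (D.gauge fun v => Sum.elim f (fun _ => 0) (φ.symm v)) := by
  refine IntegralOGraph.reach_gauge hD fun v hv => ?_
  obtain ⟨i | x, rfl⟩ := φ.surjective v
  · exact absurd ((hclosure.kind_in i).symm.trans hv) (hT i)
  · rw [Equiv.symm_apply_apply, Sum.elim_inr]

namespace MPType

open Tangle

theorem valid_before (m : MPType) : m.before.toTangle.Valid := by
  cases m <;> decide

theorem valid_after (m : MPType) : m.after.toTangle.Valid := by
  cases m <;> decide +kernel

theorem similar (m : MPType) : m.before.toTangle.Similar m.after.toTangle := by
  cases m <;> decide +kernel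

theorem sign_before_ne_zero (m : MPType) (i : Fin 2) : m.before.sign i ≠ 0 := by
  cases m <;> revert i <;> decide

/-- The move can be replaced by a sequence of basic moves and their inverses, for the weights of the
tangles given by the table. -/
def Derivable (m : MPType) : Prop :=
  Replaceable m.before.toTangle m.after.toTangle m.valid_before m.valid_after

theorem Derivable.reach {m : MPType} (hm : m.Derivable) {h : Fin 2 → ℤ} {h' : Fin 3 → ℤ}
    {D D' : VDiagram} (hD : D.FramedNormal) (hMP : VDiagram.MP m h h' D D') : Reach D D' := by
  obtain ⟨O, E, E', φ, φ', hE, hE', rfl, rfl⟩ := hMP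
  rw [gauge_framedNormal_iff] at hD
  have iso := (OTangle.hasClosure_toTangle hE).iso m.valid_before
  have iso' := (OTangle.hasClosure_toTangle hE').iso m.valid_after
  have hbefore := iso.framedNormal_iff.2 hD
  have hE'framed := iso'.framedNormal_iff.1 (m.similar.framedNormal _ m.valid_after hbefore)
  have reach_closure : Reach E E' := (Reach.of_iso iso).symm.trans
    ((hm O hbefore).trans (Reach.of_iso iso'))
  exact (hE.reach_gauge m.sign_before_ne_zero h hD).symm.trans
    (reach_closure.trans (hE'.reach_gauge m.similar.sign_ne_zero h' hE'framed))

theorem Derivable.of_detour {m m' : MPType} (h : m'.Derivable) (d : Detour)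
    (hd : d.IsValid m.before.toTangle m.after.toTangle m'.before.toTangle m'.after.toTangle) :
    m.Derivable :=
  hd.replaceable h

theorem derivable_D2 : D2.Derivable := by
  intro O hO
  have gauge_eq_self {n : ℕ} (D : VDiagram) (φ : Fin n ⊕ O.W ≃ D.V) :
      D = D.gauge fun v => Sum.elim 0 (fun _ => 0) (φ.symm v) := by
    refine (gauge_zero D).symm.trans (congrArg D.gauge (funext fun v => ?_))
    rcases φ.symm v with _ | _ <;> rfl
  refine .of_basicMove hO (D2.similar.framedNormal _ _ hO) (.primary ⟨_, _, rfl, rfl, O, _, _, _, _,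
    OTangle.isClosure (valid_before D2) ?_, OTangle.isClosure (valid_after D2) ?_,
    gauge_eq_self _ _, gauge_eq_self _ _⟩)
  · decide
  · decide +kernel

theorem derivable_A1 : A1.Derivable := derivable_D2.of_detour
  { slideType := .I
    above := false
    left := (true, 1)
    right := (true, 2)
    annulus :=
      { first := ![.inr 2, .inr 0, .inr 1]
        rest := ![[], [.inl true], [.inl false]]
        sign := -1 }
    crossings := Sum.elim ![0, 1, 2] fun _ => 3
    crossingsAfter := Sum.elim ![0, 1] fun _ => 2 }
  (by decide +kernel)

theorem derivable_B3 : B3.Derivable := derivable_D2.of_detour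
  { slideType := .II
    above := true
    left := (false, 2)
    right := (false, 1)
    annulus :=
      { first := ![.inr 1, .inl true, .inl false]
        rest := ![[], [.inr 2], [.inr 0]]
        sign := -1 }
    crossings := Sum.elim ![3, 0, 1] fun _ => 2
    crossingsAfter := Sum.elim ![0, 1] fun _ => 2 }
  (by decide +kernel)

theorem derivable_C3 : C3.Derivable := derivable_D2.of_detour
  { slideType := .III
    above := true
    left := (true, 1)
    right := (false, 2)
    annulus :=
      { first := ![.inr 0, .inr 2, .inl false]
        rest := ![[], [.inl true], [.inr 1]]
        sign := -1
        wt := Sum.elim (fun b => cond b (-1) 0) ![0, 0, 1] }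
    gaugeSlid := ![0, 0, 1, 0]
    crossings := Sum.elim ![0, 3, 1] fun _ => 2
    crossingsAfter := Sum.elim ![0, 1] fun _ => 2 }
  (by decide +kernel)

theorem derivable_C4 : C4.Derivable := derivable_A1.of_detour
  { slideType := .II
    above := true
    left := (false, 2)
    right := (false, 0)
    annulus :=
      { first := ![.inl true, .inr 0, .inl false]
        rest := ![[.inr 1], [], [.inr 2]]
        sign := -1 }
    crossings := Sum.elim ![3, 0, 1] fun _ => 2
    crossingsAfter := Sum.elim ![0, 1] fun _ => 2 }
  (by decide +kernel)

theorem derivable_C1 : C1.Derivable := derivable_B3.of_detour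
  { slideType := .I
    above := false
    left := (true, 1)
    right := (true, 0)
    annulus :=
      { first := ![.inr 2, .inr 1, .inr 0]
        rest := ![[.inl false], [.inl true], []]
        sign := -1 }
    crossings := Sum.elim ![1, 2, 0] fun _ => 3
    crossingsAfter := Sum.elim ![0, 1] fun _ => 2 }
  (by decide +kernel)

theorem derivable_A2 : A2.Derivable := derivable_C3.of_detour
  { slideType := .IV
    above := true
    left := (false, 1)
    right := (true, 2)
    annulus :=
      { first := ![.inr 1, .inl true, .inr 2]
        rest := ![[], [.inr 0], [.inl false]]
        sign := -1
        wt := Sum.elim (fun b => cond b (-1) 0) ![1, 1, 0]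
        win := ![-1, 0, 0] }
    gaugeSlid := ![-1, 0, 0, -1]
    crossings := Sum.elim ![3, 0, 1] fun _ => 2
    gaugeAfter := ![-1, 0, 0]
    crossingsAfter := Sum.elim ![0, 1] fun _ => 2 }
  (by decide +kernel)

theorem derivable_B4 : B4.Derivable := derivable_C3.of_detour
  { slideType := .IV
    above := true
    left := (false, 1)
    right := (true, 2)
    annulus :=
      { first := ![.inr 2, .inl true, .inr 0]
        rest := ![[], [.inr 1], [.inl false]]
        sign := -1
        wt := Sum.elim (fun b => cond b (-1) 0) ![0, 1, 0] }
    gaugeSlid := ![0, 0, 0, -1]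
    crossings := Sum.elim ![1, 3, 0] fun _ => 2
    crossingsAfter := Sum.elim ![0, 1] fun _ => 2 }
  (by decide +kernel)

theorem derivable_B2 : B2.Derivable := derivable_C4.of_detour
  { slideType := .IV
    above := true
    left := (false, 2)
    right := (true, 1)
    annulus :=
      { first := ![.inr 2, .inr 0, .inl true]
        rest := ![[], [.inl false], [.inr 1]]
        sign := -1
        wt := Sum.elim (fun b => cond b 0 1) ![-1, 0, 0] }
    crossings := Sum.elim ![3, 1, 0] fun _ => 2
    crossingsAfter := Sum.elim ![0, 1] fun _ => 2 }
  (by decide +kernel)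

theorem derivable_D1 : D1.Derivable := derivable_C4.of_detour
  { slideType := .I
    above := false
    left := (true, 2)
    right := (true, 1)
    annulus :=
      { first := ![.inr 0, .inr 2, .inr 1]
        rest := ![[], [.inl false], [.inl true]]
        sign := -1 }
    crossings := Sum.elim ![1, 2, 0] fun _ => 3
    crossingsAfter := Sum.elim ![0, 1] fun _ => 2 }
  (by decide +kernel)

theorem derivable_A4 : A4.Derivable := derivable_C1.of_detour
  { slideType := .IV
    above := true
    left := (false, 2)
    right := (true, 1)
    annulus :=
      { first := ![.inr 1, .inr 2, .inl true]
        rest := ![[], [.inl false], [.inr 0]]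
        sign := -1
        wt := Sum.elim (fun b => cond b 0 1) ![0, 0, -1] }
    crossings := Sum.elim ![0, 3, 1] fun _ => 2
    crossingsAfter := Sum.elim ![2, 0] fun _ => 1 }
  (by decide +kernel)

theorem derivable_D4 : D4.Derivable := derivable_C1.of_detour
  { slideType := .II
    above := true
    left := (false, 1)
    right := (false, 2)
    annulus :=
      { first := ![.inr 0, .inl false, .inl true]
        rest := ![[], [.inr 2], [.inr 1]]
        sign := -1 }
    crossings := Sum.elim ![3, 0, 1] fun _ => 2
    crossingsAfter := Sum.elim ![2, 0] fun _ => 1 }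
  (by decide +kernel)

theorem derivable_D3 : D3.Derivable := derivable_B2.of_detour
  { slideType := .III
    above := true
    left := (true, 2)
    right := (false, 0)
    annulus :=
      { first := ![.inl false, .inr 0, .inr 2]
        rest := ![[.inr 1], [], [.inl true]]
        sign := -1
        wt := Sum.elim (fun _ => 0) ![0, 0, 1]
        win := ![0, 0, -1] }
    gaugeSlid := ![0, -1, 0, -1]
    crossings := Sum.elim ![3, 0, 1] fun _ => 2
    gaugeAfter := ![-1, 0, 0]
    crossingsAfter := Sum.elim ![2, 0] fun _ => 1 }
  (by decide +kernel)

theorem derivable_B1 : B1.Derivable := derivable_D1.of_detour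
  { slideType := .II
    above := true
    left := (false, 1)
    right := (false, 2)
    annulus :=
      { first := ![.inr 1, .inl false, .inl true]
        rest := ![[], [.inr 0], [.inr 2]]
        sign := -1 }
    crossings := Sum.elim ![3, 0, 1] fun _ => 2
    crossingsAfter := Sum.elim ![2, 0] fun _ => 1 }
  (by decide +kernel)

theorem derivable_A3 : A3.Derivable := derivable_D4.of_detour
  { slideType := .I
    above := false
    left := (true, 2)
    right := (true, 1)
    annulus :=
      { first := ![.inr 2, .inr 1, .inr 0]
        rest := ![[], [.inl false], [.inl true]]
        sign := -1 }
    crossings := Sum.elim ![2, 0, 1] fun _ => 3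
    crossingsAfter := Sum.elim ![0, 1] fun _ => 2 }
  (by decide +kernel)

theorem derivable_C2 : C2.Derivable := derivable_D3.of_detour
  { slideType := .IV
    above := true
    left := (false, 1)
    right := (true, 2)
    annulus :=
      { first := ![.inr 0, .inl true, .inr 1]
        rest := ![[], [.inr 2], [.inl false]]
        sign := -1 }
    crossings := Sum.elim ![3, 0, 1] fun _ => 2
    crossingsAfter := Sum.elim ![0, 2] fun _ => 1 }
  (by decide +kernel)

theorem derivable : ∀ m : MPType, m.Derivable
  | A1 => derivable_A1
  | A2 => derivable_A2
  | A3 => derivable_A3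
  | A4 => derivable_A4
  | B1 => derivable_B1
  | B2 => derivable_B2
  | B3 => derivable_B3
  | B4 => derivable_B4
  | C1 => derivable_C1
  | C2 => derivable_C2
  | C3 => derivable_C3
  | C4 => derivable_C4
  | D1 => derivable_D1
  | D2 => derivable_D2
  | D3 => derivable_D3
  | D4 => derivable_D4

end MPType

end

theorem mainTheorem4 (m : MPType) (Γ Γ' : IntegralOGraph) (hΓ : Γ.IsFramed)
    (hMP : IntegralOGraph.MPMove m Γ Γ') :
    Relation.ReflTransGen IntegralOGraph.Step Γ Γ' := by
  obtain ⟨h, h', D, D', rfl, rfl, hD⟩ := hMP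
  exact m.derivable.reach ((IntegralOGraph.isFramed_mk_iff D).1 hΓ) hD
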